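/- Let $\Bbbk$ be an arbitrary field and let all graphs be finite and simple. For a graph $H$ let $S=\Bbbk[V(H)]$, let $I(H)$ and $J(H)$ be its edge ideal and its cover ideal in $S$, and let $\mathrm{Min}(H)$ be its set of minimal vertex covers. $H$ is Cohen–Macaulay if $S/I(H)$ is. **Clique-whiskered presentation and complex.** Let $w_1,\dots,w_r$ be vertices of $H$, let $G=H-\{w_1,\dots,w_r\}$, and let $\pi=\{W_1,\dots,W_r\}$ be a family of (possibly empty) cliques of $G$ whose disjoint union is $V(G)$. Then $H=G^\pi$ means that the edges of $H$ are those of $G$ together with $\{x,w_i\}$ for $x\in W_i$, $1\le i\le r$. Fix a linear order on $V(H)$. For $C\in\mathrm{Min}(H)$ put $D(C)=V(G)\setminus C$. Let $\mathbb F$ be the complex of free $S$-modules $F_p$ ($p\ge 0$) with basis the symbols $\mathbf f(C;\sigma)$, where $C\in\mathrm{Min}(H)$, $\sigma\subseteq D(C)$, $|\sigma|=p$, of multidegree $\prod_{v\in C}v\cdot\prod_{v\in\sigma}v$, with augmentation $d_0(\mathbf f(C;\emptyset))=\prod_{v\in C}v$ and, for $p\ge 1$, $$d_p(\mathbf f(C;\sigma))=\sum_{i=1}^r\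 \sum_{x\in\sigma\cap W_i}(-1)^{|\{y\in\sigma\,:\,y>x\}|}\bigl[w_i\,\mathbf f((C\setminus\{w_i\})\cup\{x\};\sigma\setminus\{x\})-x\,\mathbf f(C;\sigma\setminus\{x\})\bigr].$$ **Theorem.** In each of the following three cases, $H=G^\pi$ for the indicated $w_1,\dots,w_r$ and $\pi$: 1. $H$ is a Cohen–Macaulay chordal graph, $F_1,\dots,F_r$ are the distinct maximal cliques of $H$ that admit a free vertex (a vertex contained in no other maximal clique), $w_i$ is any free vertex of $F_i$, and $W_i=F_i\setminus\{w_i\}$. 2. $H=G_0\circ\mathcal H$ is a clique corona graph: $G_0$ is a graph on $x_1,\dots,x_r$, and $H$ is the disjoint union of $G_0$ and of nonempty complete graphs $K^{(1)},\dots,K^{(r)}$ with $x_i$ joined to all vertices of $K^{(i)}$; $w_i$ is any vertex of $K^{(i)}$, and $W_i=(V(K^{(i)})\cup\{x_i\})\setminus\{w_i\}$. 3. $H$ is a Cohen–Macaulay Cameron–Walker graph, i.e. $H$ is connected, its induced matching number equals its matching number, it is neither a star (including the one-vertex graph) nor a star triangle (triangles sharing one common vertex), and $S/I(H)$ is Cohen–Macaulay.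 Such an $H$ consists of a connected bipartite graph with parts $\{x_1,\dots,x_n\}$ and $\{y_1,\dots,y_m\}$, exactly one leaf edge $\{x_i,w_i\}$ at each $x_i$ and exactly one pendant triangle $\{y_j,z_j,w_{n+j}\}$ at each $y_j$; and for every such description, $r=n+m$, $W_i=\{x_i\}$ for $i\le n$ and $W_{n+j}=\{y_j,z_j\}$ for $j\le m$. Moreover, in each case: * $\mathbb F$ is a minimal multigraded free resolution of $J(H)$; * for all $p\ge0$, $\displaystyle\beta_p(J(H))=\beta_{p,\,p+|V(H)|-r}(J(H))=\sum_{C\in\mathrm{Min}(H)}\binom{|D(C)|}{p}$, and $\beta_{p,j}(J(H))=0$ for $j\neq p+|V(H)|-r$; in particular, the graded Betti numbers do not depend on $\Bbbk$; * $\mathrm{pd}\,J(H)=\max\{|D(C)| : C\in\mathrm{Min}(H)\}$; * $\dim S/I(H)=r$, and the top local cohomology $H^r_{\mathfrak m}(S/I(H))$, where $\mathfrak m$ is the ideal generated by the variables, has finite-dimensional graded pieces and Hilbert series $$\sum_{\ell\in\mathbb Z}\dim_\Bbbk[H^r_{\mathfrak m}(S/I(H))]_\ell\,t^\ell=\sum_{p\ge0}\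 \sum_{C\in\mathrm{Min}(H)}\binom{|D(C)|}{p}\left(\frac{t^{-1}}{1-t^{-1}}\right)^{r-p},$$ expanded as a Laurent series in $t^{-1}$. -/

import Mathlib

universe u v

/-! ## Graphs -/

/-- `C` is a minimal vertex cover of `H`. -/
def IsMinVertexCover {V : Type u} (H : SimpleGraph V) (C : Finset V) : Prop :=
  Minimal (fun D : Finset V => H.IsVertexCover (D : Set V)) C

open scoped Classical in
/-- `Min(H)`, the set of minimal vertex covers. -/
noncomputable def minVertexCovers {V : Type u} [Fintype V] (H : SimpleGraph V) :
    Finset (Finset V) :=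
  Finset.univ.filter (fun C => IsMinVertexCover H C)

/-- The family `W` consists of cliques (possibly empty) whose disjoint union is the vertex set. -/
structure IsCliquePartition {V : Type u} {ι : Type v} (G : SimpleGraph V) (W : ι → Set V) :
    Prop where
  clique : ∀ i, G.IsClique (W i)
  partition : ∀ x, ∃! i, x ∈ W i

/-- The clique-whiskered graph `G^π` for `π = {W i}`: one new vertex `w i = inr i` for every `i`,
joined to all vertices of `W i` and to nothing else. -/
def cliqueWhisker {V : Type u} {ι : Type v} (G : SimpleGraph V) (W : ι → Set V) :
    SimpleGraph (V ⊕ ι) where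
  Adj
    | Sum.inl a, Sum.inl b => G.Adj a b
    | Sum.inl a, Sum.inr i => a ∈ W i
    | Sum.inr i, Sum.inl a => a ∈ W i
    | Sum.inr _, Sum.inr _ => False
  symm := ⟨by
    rintro (a | i) (b | j) h
    · exact G.symm.symm _ _ h
    · exact h
    · exact h
    · exact h⟩
  loopless := ⟨by
    rintro (a | i) h
    · exact G.loopless.irrefl a h
    · exact h⟩

/-- `H = (H - {w i})^π` with `π = {W i}`, where `W` is a clique partition of `H - {w i}` and
the whisker vertex belonging to `W i` is `w i`. -/
structure IsCliqueWhiskerPresentation {V : Type u} {ι : Type v} (H : SimpleGraph V)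
    (w : ι → V) (W : ι → Set V) : Prop where
  subset : ∀ i, W i ⊆ (Set.range w)ᶜ
  cliquePartition : IsCliquePartition (H.induce (Set.range w)ᶜ)
    (fun i => (Subtype.val ⁻¹' W i : Set ((Set.range w)ᶜ : Set V)))
  iso : ∃ e : cliqueWhisker (H.induce (Set.range w)ᶜ)
      (fun i => (Subtype.val ⁻¹' W i : Set ((Set.range w)ᶜ : Set V))) ≃g H,
    (∀ x : ((Set.range w)ᶜ : Set V), e (Sum.inl x) = x) ∧ ∀ i, e (Sum.inr i) = w i

/-- Every cycle of length at least four has a chord. -/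
def IsChordalGraph {V : Type u} (H : SimpleGraph V) : Prop :=
  ∀ (a : V) (c : H.Walk a a), c.IsCycle → 4 ≤ c.length →
    ∃ x ∈ c.support, ∃ y ∈ c.support, H.Adj x y ∧ s(x, y) ∉ c.edges

def IsMaximalClique {V : Type u} (H : SimpleGraph V) (F : Set V) : Prop :=
  Maximal (fun s : Set V => H.IsClique s) F

/-- `x` is a free vertex of the maximal clique `F`: `F` is the only maximal clique containing
`x`. -/
def IsFreeVertex {V : Type u} (H : SimpleGraph V) (F : Set V) (x : V) : Prop :=
  IsMaximalClique H F ∧ x ∈ F ∧ ∀ F' : Set V, IsMaximalClique H F' → x ∈ F' → F' = F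

/-- The corona graph `G ∘ 𝓗`: the disjoint union of `G` and all `𝓗 i`, with every vertex `i` of
`G` joined to all vertices of `𝓗 i`. -/
def coronaGraph {X : Type u} {Y : X → Type u} (G : SimpleGraph X)
    (𝓗 : ∀ i, SimpleGraph (Y i)) : SimpleGraph (X ⊕ (Σ i, Y i)) where
  Adj
    | Sum.inl a, Sum.inl b => G.Adj a b
    | Sum.inl a, Sum.inr q => q.1 = a
    | Sum.inr p, Sum.inl b => p.1 = b
    | Sum.inr p, Sum.inr q => ∃ h : p.1 = q.1, (𝓗 q.1).Adj (h ▸ p.2) q.2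
  symm := ⟨by
    rintro (a | ⟨i, p⟩) (b | ⟨j, q⟩) h
    · exact G.symm.symm _ _ h
    · exact h
    · exact h
    · obtain ⟨h1, h2⟩ := h
      dsimp only at h1
      subst h1
      exact ⟨rfl, (𝓗 _).symm.symm _ _ h2⟩⟩
  loopless := ⟨by
    rintro (a | ⟨i, p⟩) h
    · exact G.loopless.irrefl a h
    · obtain ⟨_, h2⟩ := h
      exact (𝓗 i).loopless.irrefl p h2⟩

/-- A set of pairwise disjoint edges. -/
def IsMatchingSet {V : Type u} (H : SimpleGraph V) (M : Finset (Sym2 V)) : Prop :=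
  (∀ e ∈ M, e ∈ H.edgeSet) ∧ ∀ e ∈ M, ∀ f ∈ M, e ≠ f → ∀ x, x ∈ e → x ∉ f

/-- A matching such that no other edge is contained in the union of its edges. -/
def IsInducedMatchingSet {V : Type u} (H : SimpleGraph V) (M : Finset (Sym2 V)) : Prop :=
  IsMatchingSet H M ∧ ∀ f ∈ H.edgeSet, f ∉ M → ¬ ∀ x ∈ f, ∃ e ∈ M, x ∈ e

/-- `m(H)`, for a finite graph. -/
noncomputable def matchingNumber {V : Type u} (H : SimpleGraph V) : ℕ :=
  sSup {n | ∃ M : Finset (Sym2 V), IsMatchingSet H M ∧ M.card = n}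

/-- `im(H)`, for a finite graph. -/
noncomputable def inducedMatchingNumber {V : Type u} (H : SimpleGraph V) : ℕ :=
  sSup {n | ∃ M : Finset (Sym2 V), IsInducedMatchingSet H M ∧ M.card = n}

/-- A star: edges sharing one common vertex (the one-point graph is the star without edges). -/
def IsStarGraph {V : Type u} (H : SimpleGraph V) : Prop :=
  ∃ c, ∀ x y, H.Adj x y ↔ x ≠ y ∧ (x = c ∨ y = c)

/-- A star triangle: triangles sharing one common vertex `c`, that is, `c` is joined to all other
vertices, and the other vertices are joined to each other in disjoint pairs. -/
def IsStarTriangle {V : Type u} (H : SimpleGraph V) : Prop :=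
  ∃ c, (∀ x, x ≠ c → H.Adj c x) ∧ ∀ x, x ≠ c → ∃! y, y ≠ c ∧ H.Adj x y

structure IsCameronWalker {V : Type u} (H : SimpleGraph V) : Prop where
  connected : H.Connected
  inducedMatchingNumber_eq : inducedMatchingNumber H = matchingNumber H
  not_star : ¬ IsStarGraph H
  not_starTriangle : ¬ IsStarTriangle H

/-- `H` consists of a connected bipartite graph with parts `{x i}` and `{y j}`, exactly one leaf
edge `{x i, l i}` at each `x i`, and exactly one pendant triangle `{y j, z j, w j}` at each `y j`. -/
structure IsCameronWalkerLabelling {V : Type u} (H : SimpleGraph V) {n m : ℕ}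
    (x l : Fin n → V) (y z w : Fin m → V) : Prop where
  bijective : Function.Bijective
    (Sum.elim x (Sum.elim y (Sum.elim l (Sum.elim z w))))
  not_adj_x : ∀ i j, ¬ H.Adj (x i) (x j)
  not_adj_y : ∀ i j, ¬ H.Adj (y i) (y j)
  connected : (H.induce (Set.range x ∪ Set.range y)).Connected
  leaf : ∀ i a, H.Adj (l i) a ↔ a = x i
  triangle_z : ∀ j a, H.Adj (z j) a ↔ a = y j ∨ a = w j
  triangle_w : ∀ j a, H.Adj (w j) a ↔ a = y j ∨ a = z j

/-! ## Ideals of graphs, Cohen–Macaulay rings -/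

/-- The edge ideal `I(H)`. -/
noncomputable def edgeIdeal (k : Type u) [Field k] {V : Type u} (H : SimpleGraph V) :
    Ideal (MvPolynomial V k) :=
  Ideal.span {f | ∃ a b, H.Adj a b ∧ f = MvPolynomial.X a * MvPolynomial.X b}

/-- The cover ideal `J(H)`. -/
noncomputable def coverIdeal (k : Type u) [Field k] {V : Type u} (H : SimpleGraph V) :
    Ideal (MvPolynomial V k) :=
  Ideal.span {f | ∃ C : Finset V, H.IsVertexCover (C : Set V) ∧
    f = ∏ a ∈ C, MvPolynomial.X a}

/-- A Noetherian ring all of whose localizations `A` at maximal ideals satisfy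
`depth A = dim A`, i.e. the maximal ideal of `A` contains an `A`-regular sequence of
length `dim A`. -/
structure IsCohenMacaulayRing (R : Type u) [CommRing R] : Prop where
  noetherian : IsNoetherianRing R
  regularSequence : ∀ (p : Ideal R) [p.IsMaximal], ∃ rs : List (Localization.AtPrime p),
    (∀ r ∈ rs, r ∈ IsLocalRing.maximalIdeal (Localization.AtPrime p)) ∧
    RingTheory.Sequence.IsRegular (Localization.AtPrime p) rs ∧
    (rs.length : WithBot ℕ∞) = ringKrullDim (Localization.AtPrime p)

/-- `H` is Cohen–Macaulay over `k`. -/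
def IsCohenMacaulayGraph (k : Type u) [Field k] {V : Type u} (H : SimpleGraph V) : Prop :=
  IsCohenMacaulayRing (MvPolynomial V k ⧸ edgeIdeal k H)

/-! ## Graded free resolutions and Betti numbers -/

/-- The data `⋯ → F 2 → F 1 → F 0 → S` of free modules `F i` over `S = k[V]` with finite bases
`B i`, whose elements carry degrees in `Γ`, and of linear maps `d i : F (i + 1) → F i` and
`ε : F 0 → S`. -/
structure GradedFreeComplex (k : Type u) [Field k] (V : Type u) (Γ : Type v) where
  B : ℕ → Type u
  finite : ∀ i, Finite (B i)
  deg : ∀ i, B i → Γ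
  ε : (B 0 →₀ MvPolynomial V k) →ₗ[MvPolynomial V k] MvPolynomial V k
  d : ∀ i, (B (i + 1) →₀ MvPolynomial V k) →ₗ[MvPolynomial V k] (B i →₀ MvPolynomial V k)

/-- `⋯ → F 1 → F 0 → J → 0` is a minimal graded free resolution of the ideal `J`, where the
variable `a` has degree `wt a`. -/
structure GradedFreeComplex.IsMinimalFreeResolution {k : Type u} [Field k] {V : Type u}
    {Γ : Type v} [AddCommMonoid Γ] (F : GradedFreeComplex k V Γ) (wt : V → Γ)
    (J : Ideal (MvPolynomial V k)) : Prop where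
  /-- the maps preserve degrees -/
  homogeneous_ε : ∀ q, ∀ e ∈ (F.ε (Finsupp.single q 1)).support,
    Finsupp.weight wt e = F.deg 0 q
  homogeneous_d : ∀ i q q', ∀ e ∈ (F.d i (Finsupp.single q 1) q').support,
    Finsupp.weight wt e + F.deg i q' = F.deg (i + 1) q
  range_ε : LinearMap.range F.ε = J
  exact_zero : LinearMap.ker F.ε = LinearMap.range (F.d 0)
  exact_succ : ∀ i, LinearMap.ker (F.d i) = LinearMap.range (F.d (i + 1))
  /-- `d (F (i + 1)) ⊆ 𝔪 F i` -/
  minimal : ∀ i, LinearMap.range (F.d i) ≤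
    Ideal.span (Set.range (MvPolynomial.X : V → MvPolynomial V k)) •
      (⊤ : Submodule (MvPolynomial V k) (F.B i →₀ MvPolynomial V k))

open scoped Classical in
/-- The graded Betti number `β_{i,j}(J)`: the number of copies of `S(-j)` in the `i`-th module
of a minimal `ℤ`-graded free resolution of the homogeneous ideal `J`. -/
noncomputable def gradedBettiNumber {k : Type u} [Field k] {V : Type u}
    (J : Ideal (MvPolynomial V k)) (i : ℕ) (j : ℤ) : ℕ :=
  if h : ∃ F : GradedFreeComplex k V ℤ,
      F.IsMinimalFreeResolution (fun _ => 1) J then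
    Nat.card {q : h.choose.B i // h.choose.deg i q = j}
  else 0

/-- `β_i(J) = ∑_j β_{i,j}(J)`. -/
noncomputable def bettiNumber {k : Type u} [Field k] {V : Type u}
    (J : Ideal (MvPolynomial V k)) (i : ℕ) : ℕ :=
  ∑ᶠ j : ℤ, gradedBettiNumber J i j

/-! ## The complex of a clique-whiskered graph -/

section Construction

variable {V : Type u} [Fintype V] [LinearOrder V] {ι : Type v} [Fintype ι]

/-- `(V ∖ {w i}) ∖ C`. -/
def whiskerFree (w : ι → V) (C : Finset V) : Finset V :=
  (Finset.univ \ Finset.univ.image w) \ C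

/-- The symbols `f(C; σ)` with `C` a minimal vertex cover, `σ ⊆ (V ∖ {w i}) ∖ C`, `|σ| = n`. -/
def WhiskerBasis (H : SimpleGraph V) (w : ι → V) (n : ℕ) : Type u :=
  {q : Finset V × Finset V //
    IsMinVertexCover H q.1 ∧ q.2 ⊆ whiskerFree w q.1 ∧ q.2.card = n}

open scoped Classical in
/-- The symbol `f(C; σ)` as an element of the free module. (For a pair `(C, σ)` that is not
admissible it is `0`; in a clique-whiskered graph such pairs do not occur in the differential.) -/
noncomputable def whiskerSymbol (k : Type u) [Field k] (H : SimpleGraph V) (w : ι → V) (n : ℕ)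
    (C σ : Finset V) : WhiskerBasis H w n →₀ MvPolynomial V k :=
  if h : IsMinVertexCover H C ∧ σ ⊆ whiskerFree w C ∧ σ.card = n then
    Finsupp.single ⟨(C, σ), h⟩ 1
  else 0

open scoped Classical in
/-- The complex with basis `f(C; σ)` of multidegree `z_C x_σ`, with `ε (f(C; ∅)) = z_C` and
`d (f(C; σ)) = ∑_i ∑_{a ∈ σ ∩ W i} (-1)^{#{b ∈ σ : b > a}} •
  [w_i f((C ∖ {w_i}) ∪ {a}; σ ∖ {a}) - a f(C; σ ∖ {a})]`. -/
noncomputable def whiskerComplex (k : Type u) [Field k] (H : SimpleGraph V) (w : ι → V)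
    (W : ι → Set V) : GradedFreeComplex k V (V →₀ ℕ) where
  B n := WhiskerBasis H w n
  finite n := by unfold WhiskerBasis; infer_instance
  deg n q := ∑ a ∈ q.1.1, Finsupp.single a 1 + ∑ a ∈ q.1.2, Finsupp.single a 1
  ε := Finsupp.linearCombination (MvPolynomial V k)
    (fun q => (∏ a ∈ q.1.1, MvPolynomial.X a : MvPolynomial V k))
  d n := Finsupp.linearCombination (MvPolynomial V k) (fun q =>
    ∑ i, ∑ a ∈ q.1.2.filter (fun a => a ∈ W i),
      (-1 : MvPolynomial V k) ^ (q.1.2.filter (fun b => a < b)).card •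
        ((MvPolynomial.X (w i) : MvPolynomial V k) •
            whiskerSymbol k H w n (insert a (q.1.1.erase (w i))) (q.1.2.erase a)
          - (MvPolynomial.X a : MvPolynomial V k) • whiskerSymbol k H w n q.1.1 (q.1.2.erase a)))

end Construction

/-! ## Graded local cohomology, through the Čech complex on the variables -/

section LocalCohomology

variable {k : Type u} [Field k] {V : Type u} (I : Ideal (MvPolynomial V k))

/-- The multiplicative set of `S ⧸ I` generated by the variables in `U`. -/
noncomputable def variableMonoid (U : Finset V) : Submonoid (MvPolynomial V k ⧸ I) :=
  Submonoid.closure ((fun a => Ideal.Quotient.mk I (MvPolynomial.X a)) '' (U : Set V))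

/-- The localization of `S ⧸ I` at the product of the variables in `U`. -/
abbrev CechRing (U : Finset V) : Type u := Localization (variableMonoid I U)

theorem variableMonoid_mono {U U' : Finset V} (h : U ⊆ U') :
    variableMonoid I U ≤ variableMonoid I U' :=
  Submonoid.closure_mono (Set.image_mono (Finset.coe_subset.mpr h))

/-- The localization map for `U ⊆ U'`. -/
noncomputable def cechRestrict {U U' : Finset V} (h : U ⊆ U') : CechRing I U →ₐ[k] CechRing I U' :=
  IsLocalization.liftAlgHom (A := k) (R := MvPolynomial V k ⧸ I) (M := variableMonoid I U)
    (S := CechRing I U) (P := CechRing I U')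
    (f := IsScalarTower.toAlgHom k (MvPolynomial V k ⧸ I) (CechRing I U'))
    (fun y => IsLocalization.map_units (CechRing I U')
      (⟨y.1, variableMonoid_mono I h y.2⟩ : variableMonoid I U'))

/-- The homogeneous elements of degree `l` of the localization (for homogeneous `I`): the
fractions `f / s` with `f` a form, `s` a monomial in the variables from `U`, and
`deg f - deg s = l`. -/
noncomputable def cechDegree (U : Finset V) (l : ℤ) : Submodule k (CechRing I U) :=
  Submodule.span k {c | ∃ (f s : MvPolynomial V k) (p q : ℕ),
    f.IsHomogeneous p ∧ s.IsHomogeneous q ∧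
    s ∈ Submonoid.closure (MvPolynomial.X '' (U : Set V) : Set (MvPolynomial V k)) ∧
    (p : ℤ) - q = l ∧
    c * algebraMap (MvPolynomial V k ⧸ I) (CechRing I U) (Ideal.Quotient.mk I s) =
      algebraMap (MvPolynomial V k ⧸ I) (CechRing I U) (Ideal.Quotient.mk I f)}

/-- The degree `l` part of the `n`-th module `⨁_{|U| = n} (S ⧸ I)_U` of the Čech complex, as a
subspace of the sum over all `U`. -/
noncomputable def cechCochains (n : ℕ) (l : ℤ) : Submodule k (∀ U : Finset V, CechRing I U) where
  carrier := {c | ∀ U, c U ∈ cechDegree I U l ∧ (U.card ≠ n → c U = 0)}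
  add_mem' := fun ha hb U => ⟨(cechDegree I U l).add_mem (ha U).1 (hb U).1,
    fun h => by simp [(ha U).2 h, (hb U).2 h]⟩
  zero_mem' := fun U => ⟨(cechDegree I U l).zero_mem, fun _ => rfl⟩
  smul_mem' := fun r _ ha U => ⟨(cechDegree I U l).smul_mem r (ha U).1,
    fun h => by simp [(ha U).2 h]⟩

variable [LinearOrder V]

/-- `(d c)_U = ∑_{a ∈ U} (-1)^{#{b ∈ U : b < a}} c_{U ∖ {a}}`. -/
noncomputable def cechDifferential :
    (∀ U : Finset V, CechRing I U) →ₗ[k] (∀ U : Finset V, CechRing I U) :=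
  LinearMap.pi (fun U => ∑ a ∈ U,
    (-1 : k) ^ (U.filter (fun b => b < a)).card •
      ((cechRestrict I (U.erase_subset a)).toLinearMap ∘ₗ LinearMap.proj (U.erase a)))

noncomputable def cechCocycles (n : ℕ) (l : ℤ) : Submodule k (∀ U : Finset V, CechRing I U) :=
  cechCochains I n l ⊓ LinearMap.ker (cechDifferential I)

noncomputable def cechCoboundaries : ℕ → ℤ → Submodule k (∀ U : Finset V, CechRing I U)
  | 0, _ => ⊥
  | n + 1, l => (cechCochains I n l).map (cechDifferential I)

/-- `[H^n_𝔪(S ⧸ I)]_l`, for a homogeneous ideal `I` and `𝔪` generated by the variables. -/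
abbrev LocalCohomologyDegree (n : ℕ) (l : ℤ) : Type u :=
  cechCocycles I n l ⧸ (cechCoboundaries I n l).submoduleOf (cechCocycles I n l)

end LocalCohomology

/-- The Laurent series expansion of `t⁻¹ / (1 - t⁻¹)` in the variable `t⁻¹`, so that the
coefficient at `n` is that of `t ^ (-n)`. -/
noncomputable def invFraction : LaurentSeries ℚ :=
  HahnSeries.single (1 : ℤ) (1 : ℚ) / (1 - HahnSeries.single (1 : ℤ) (1 : ℚ))

/-- `H` is the clique-whiskered graph `(H - {w i})^π` with `π = {W i}`, its cover ideal is
minimally resolved by the complex of this presentation, and the Betti numbers, the projective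
dimension, and the Hilbert series of the top local cohomology have the resulting values. -/
structure IsResolvedByWhiskerComplex (k : Type u) [Field k] {V : Type u} [Fintype V]
    [LinearOrder V] {ι : Type v} [Fintype ι] (H : SimpleGraph V) (w : ι → V) (W : ι → Set V) :
    Prop where
  presentation : IsCliqueWhiskerPresentation H w W
  /-- The complex is a minimal multigraded free resolution of `J(H)`. -/
  resolution : (whiskerComplex k H w W).IsMinimalFreeResolution
    (fun a => Finsupp.single a 1) (coverIdeal k H)
  betti : ∀ i, bettiNumber (coverIdeal k H) i =
    ∑ C ∈ minVertexCovers H, (whiskerFree w C).card.choose i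
  /-- `β_i` is concentrated in degree `i + |V ∖ {w i}|`. -/
  gradedBetti : ∀ i j, gradedBettiNumber (coverIdeal k H) i j =
    if j = i + ((Fintype.card V : ℤ) - Fintype.card ι) then
      ∑ C ∈ minVertexCovers H, (whiskerFree w C).card.choose i
    else 0
  /-- The graded Betti numbers do not depend on the field. -/
  gradedBetti_field : ∀ (k' : Type u) [Field k'] (i : ℕ) (j : ℤ),
    gradedBettiNumber (coverIdeal k' H) i j = gradedBettiNumber (coverIdeal k H) i j
  /-- `pd J(H)` is the largest `i` with a nonzero `β_{i,j}`. -/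
  projDim_betti : IsGreatest {i | ∃ j, gradedBettiNumber (coverIdeal k H) i j ≠ 0}
    ((minVertexCovers H).sup fun C => (whiskerFree w C).card)
  projDim : CategoryTheory.projectiveDimension
      (ModuleCat.of (MvPolynomial V k) (coverIdeal k H)) =
    (((minVertexCovers H).sup fun C => (whiskerFree w C).card : ℕ) : WithBot ℕ∞)
  /-- `S ⧸ I(H)` has dimension `|ι|`, so that the local cohomology below is the top one. -/
  dim : ringKrullDim (MvPolynomial V k ⧸ edgeIdeal k H) = (Fintype.card ι : WithBot ℕ∞)
  finite_localCohomology : ∀ l : ℤ, Module.Finite k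
    (LocalCohomologyDegree (edgeIdeal k H) (Fintype.card ι) l)
  /-- The terms of the sum with `i > |V|` vanish. -/
  hilbert : ∀ l : ℤ, (Module.finrank k
      (LocalCohomologyDegree (edgeIdeal k H) (Fintype.card ι) l) : ℚ) =
    HahnSeries.coeff (∑ i ∈ Finset.range (Fintype.card V + 1), ∑ C ∈ minVertexCovers H,
      ((whiskerFree w C).card.choose i : LaurentSeries ℚ) *
        invFraction ^ ((Fintype.card ι : ℤ) - i)) (-l)

/-! Everything about resolutions and cohomology follows from one combinatorial structure,
`IsWhiskered`: a colouring whose classes $W_i\cup\{w_i\}$ are cliques, with $w_i$ adjacent only to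
its own class. A vertex cover is then minimal exactly when its complement is an independent set with
one vertex of each colour (`isMinVertexCover_iff`), and a non-whisker outside a minimal cover may be
exchanged for the whisker of its colour (`swap`).

Resolution. For a non-whisker $v$ let $h_v$ divide the coefficient by $v$ and add $v$ to $\sigma$.
On a cell where this is possible, $dh_v+h_vd$ is the identity minus the map that trades the factor
$v$ for the whisker of its colour and $C$ for the exchanged cover; it is the identity when
$v\in\sigma$ and zero otherwise. Hence a cycle can be reduced at one vertex after another modulo
boundaries (`reduce_succ`). Nothing reduced at all vertices survives in positive degrees, and in
degree zero a reduced cell is determined by its monomial image, so the augmentation is injective on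
reduced chains. Betti numbers count symbols because minimal graded resolutions are unique
(`exists_gradedEquiv`); the projective dimension comes from dimension shifting and Nakayama.

Local cohomology. The localization of $S/I(H)$ at $U$ vanishes if $U$ contains an edge, and for an
independent $U$ with $r$ vertices its graded pieces are spanned by Laurent monomials. Modulo
coboundaries a monomial with a positive exponent dies, and one with exponent zero at a whisker is
rewritten on sets with fewer whiskers. The remaining monomials are independent, since the
alternating functionals `basicFunctional` vanish on coboundaries and are dual to them. Sorting them
by cover, zero set and negative exponents gives the Hilbert series.

The three families. Coronas are whiskered by construction. For the others, Cohen–Macaulayness is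
used only through unmixedness (`IsCohenMacaulayGraph.card_eq`): a regular sequence is no longer than
the coheight of an associated prime. In a chordal graph, simplicial vertices (Dirac) and exchanges
of independent sets show that the cliques with free vertices partition the vertices
(`IsChordalGraph.exists_isWhiskered`). In a Cameron–Walker graph a maximum matching is induced;
augmenting paths and exchanges force the description by leaf edges and pendant triangles
(`IsInducedMaximumMatching.exists_labelling`). -/

/-! ## Clique-whiskered graphs with a colouring of the vertices -/

/-- `H` is obtained by attaching the whisker vertices `w i` to the cliques formed by the other
vertices of colour `i`. -/
structure IsWhiskered {V : Type u} {ι : Type v} (H : SimpleGraph V) (w : ι → V) (col : V → ι) :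
    Prop where
  col_w : ∀ i, col (w i) = i
  adj_w : ∀ i a, H.Adj (w i) a ↔ a ∉ Set.range w ∧ col a = i
  clique : ∀ a b, a ≠ b → a ∉ Set.range w → b ∉ Set.range w → col a = col b → H.Adj a b

namespace IsWhiskered

variable {V : Type u} {ι : Type v} {H : SimpleGraph V} {w : ι → V} {col : V → ι}

theorem injective (h : IsWhiskered H w col) : Function.Injective w :=
  Function.LeftInverse.injective (g := col) h.col_w

theorem w_inj (h : IsWhiskered H w col) {i j : ι} : w i = w j ↔ i = j := h.injective.eq_iff

theorem eq_w (h : IsWhiskered H w col) {a : V} (ha : a ∈ Set.range w) : a = w (col a) := by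
  obtain ⟨i, rfl⟩ := ha
  rw [h.col_w]

/-- The whisker is adjacent to every other vertex of its class, so the class stays a clique when the
whisker is added. -/
theorem adj_of_col (h : IsWhiskered H w col) {a b : V} (hab : a ≠ b) (hc : col a = col b) :
    H.Adj a b := by
  by_cases ha : a ∈ Set.range w
  · obtain ⟨i, rfl⟩ := ha
    rw [h.adj_w]
    refine ⟨fun hb => hab ?_, by rw [← hc, h.col_w]⟩
    rw [h.eq_w hb, ← hc, h.col_w]
  · by_cases hb : b ∈ Set.range w
    · obtain ⟨i, rfl⟩ := hb
      exact ((h.adj_w i a).2 ⟨ha, by rw [hc, h.col_w]⟩).symm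
    · exact h.clique a b hab ha hb hc

theorem adj_w' (h : IsWhiskered H w col) {i : ι} {a : V} : H.Adj a (w i) ↔
    a ∉ Set.range w ∧ col a = i := by rw [H.adj_comm, h.adj_w]

theorem presentation (h : IsWhiskered H w col) {W : ι → Set V}
    (hW : ∀ i a, a ∈ W i ↔ a ∉ Set.range w ∧ col a = i) : IsCliqueWhiskerPresentation H w W where
  subset i a ha := ((hW i a).1 ha).1
  cliquePartition :=
    { clique := by
        rintro i ⟨a, ha⟩ hai ⟨b, hb⟩ hbi hab
        simp only [Set.mem_preimage, hW] at hai hbi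
        exact h.clique a b (fun e => hab (Subtype.ext e)) ha hb (hai.2.trans hbi.2.symm)
      partition := by
        rintro ⟨a, ha⟩
        refine ⟨col a, (hW _ _).2 ⟨ha, rfl⟩, fun j hj => ((hW _ _).1 hj).2.symm⟩ }
  iso := by
    refine ⟨⟨Equiv.ofBijective (Sum.elim Subtype.val w) ⟨?_, ?_⟩, ?_⟩, fun _ => rfl, fun _ => rfl⟩
    · rintro (⟨a, ha⟩ | i) (⟨b, hb⟩ | j) e
      · exact congrArg Sum.inl (Subtype.ext e)
      · exact absurd ⟨j, e.symm⟩ ha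
      · exact absurd ⟨i, e⟩ hb
      · exact congrArg Sum.inr (h.injective e)
    · intro a
      by_cases ha : a ∈ Set.range w
      · obtain ⟨i, rfl⟩ := ha
        exact ⟨Sum.inr i, rfl⟩
      · exact ⟨Sum.inl ⟨a, ha⟩, rfl⟩
    · rintro (⟨a, ha⟩ | i) (⟨b, hb⟩ | j)
      · exact Iff.rfl
      · change H.Adj a (w j) ↔ a ∈ W j
        rw [h.adj_w', hW]
      · change H.Adj (w i) b ↔ b ∈ W i
        rw [h.adj_w, hW]
      · change H.Adj (w i) (w j) ↔ False
        rw [h.adj_w]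
        simp

/-! ### Minimal vertex covers as complements of transversals of the colouring. -/

section Covers

/-- If a minimal cover contained a whole class, its whisker could be dropped, because all neighbours
of the whisker lie in that class. Conversely, a missing vertex of the colour of `a` forces `a` into
every smaller cover, through the edge between the two. -/
theorem isMinVertexCover_iff [DecidableEq V] (h : IsWhiskered H w col) {C : Finset V} :
    IsMinVertexCover H C ↔ H.IsVertexCover (C : Set V) ∧ ∀ i, ∃ a ∉ C, col a = i := by
  constructor
  · intro hC
    refine ⟨hC.prop, fun i => ?_⟩
    by_cases hi : w i ∈ C
    · by_contra! hne
      have : H.IsVertexCover ((C.erase (w i) : Finset V) : Set V) := by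
        intro a b hab
        rcases hC.prop hab with ha | hb
        · by_cases e : a = w i
          · subst e
            have hb := (h.adj_w i b).1 hab
            right
            have : b ∈ C := by
              by_contra hbC
              exact hne b hbC hb.2
            simp only [Finset.coe_erase, Set.mem_sdiff, Finset.mem_coe, Set.mem_singleton_iff]
            exact ⟨this, fun e => hb.1 ⟨i, e.symm⟩⟩
          · left; simpa using ⟨ha, e⟩
        · by_cases e : b = w i
          · subst e
            have ha := (h.adj_w i a).1 hab.symm
            left
            have : a ∈ C := by
              by_contra haC
              exact hne a haC ha.2
            simp only [Finset.coe_erase, Set.mem_sdiff, Finset.mem_coe, Set.mem_singleton_iff]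
            exact ⟨this, fun e => ha.1 ⟨i, e.symm⟩⟩
          · right; simpa using ⟨hb, e⟩
      have := hC.le_of_le this (Finset.erase_subset _ _) hi
      simp at this
    · exact ⟨w i, hi, h.col_w i⟩
  · rintro ⟨h1, h2⟩
    refine ⟨h1, fun D hD hDC a ha => ?_⟩
    obtain ⟨b, hb, hba⟩ := h2 (col a)
    have hab : a ≠ b := fun e => hb (e ▸ ha)
    rcases hD (h.adj_of_col hab hba.symm) with h' | h'
    · exact h'
    · exact absurd (hDC h') hb

theorem eq_of_notMem (h : IsWhiskered H w col) {C : Finset V} (hC : IsMinVertexCover H C)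
    {a b : V} (ha : a ∉ C) (hb : b ∉ C) (hab : col a = col b) : a = b := by
  by_contra hne
  rcases hC.prop (h.adj_of_col hne hab) with h' | h'
  · exact ha h'
  · exact hb h'

theorem exists_notMem [DecidableEq V] (h : IsWhiskered H w col) {C : Finset V}
    (hC : IsMinVertexCover H C) (i : ι) : ∃ a ∉ C, col a = i :=
  (h.isMinVertexCover_iff.1 hC).2 i

theorem w_mem (h : IsWhiskered H w col) {C : Finset V} (hC : IsMinVertexCover H C) {a : V}
    (ha : a ∉ C) (haw : a ∉ Set.range w) : w (col a) ∈ C := by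
  by_contra hn
  exact haw ⟨_, h.eq_of_notMem hC hn ha (h.col_w _)⟩

/-- On complements, `a` is replaced by the whisker of its colour. Only edges at that whisker could
become uncovered, and their other ends are `a` or vertices of the same colour, which lie in `C`
because `a` is the only one that does not. -/
theorem swap [DecidableEq V] (h : IsWhiskered H w col) {C : Finset V}
    (hC : IsMinVertexCover H C) {a : V} (ha : a ∉ C) (haw : a ∉ Set.range w) :
    IsMinVertexCover H (insert a (C.erase (w (col a)))) := by
  rw [h.isMinVertexCover_iff]
  have key : ∀ x y, H.Adj x y → x ∈ C →
      x ∈ insert a (C.erase (w (col a))) ∨ y ∈ insert a (C.erase (w (col a))) := by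
    intro x y hxy hx
    by_cases e : x = w (col a)
    · subst e
      right
      have hy := (h.adj_w _ _).1 hxy
      by_cases hya : y = a
      · simp [hya]
      · have : y ∈ C := by
          by_contra hyC
          exact hya (h.eq_of_notMem hC hyC ha hy.2)
        rw [Finset.mem_insert, Finset.mem_erase]
        exact Or.inr ⟨fun e => hy.1 ⟨_, e.symm⟩, this⟩
    · left
      simp [e, hx]
  refine ⟨fun x y hxy => ?_, fun i => ?_⟩
  · rcases hC.prop hxy with hx | hy
    · exact key x y hxy hx
    · exact (key y x hxy.symm hy).symm
  · by_cases hi : i = col a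
    · subst hi
      refine ⟨w (col a), ?_, h.col_w _⟩
      rw [Finset.mem_insert, not_or]
      exact ⟨fun e => haw ⟨_, e⟩, by simp⟩
    · obtain ⟨b, hb, rfl⟩ := h.exists_notMem hC i
      refine ⟨b, ?_, rfl⟩
      rw [Finset.mem_insert, not_or]
      exact ⟨fun e => hi (by rw [e]), fun e => hb (Finset.mem_of_mem_erase e)⟩

variable [Fintype V] [LinearOrder V] [Fintype ι]

theorem mem_whiskerFree (w : ι → V) {C : Finset V} {a : V} :
    a ∈ whiskerFree w C ↔ a ∉ Set.range w ∧ a ∉ C := by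
  simp [whiskerFree]

/-- `col` restricts to a bijection from the complement onto the set of colours. -/
theorem card_compl (h : IsWhiskered H w col) {C : Finset V} (hC : IsMinVertexCover H C) :
    Cᶜ.card = Fintype.card ι := by
  rw [← Finset.card_univ]
  refine Finset.card_bij (fun a _ => col a) (fun _ _ => Finset.mem_univ _) ?_ ?_
  · intro a ha b hb hab
    exact h.eq_of_notMem hC (by simpa using ha) (by simpa using hb) hab
  · intro i _
    obtain ⟨a, ha, hai⟩ := h.exists_notMem hC i
    exact ⟨a, by simpa using ha, hai⟩

theorem card_add (h : IsWhiskered H w col) {C : Finset V} (hC : IsMinVertexCover H C) :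
    C.card + Fintype.card ι = Fintype.card V := by
  rw [← h.card_compl hC, Finset.card_add_card_compl]

/-- Apart from `a`, the exchange touches only a whisker, and whiskers are never counted here. -/
theorem whiskerFree_swap {C : Finset V} {a : V} :
    whiskerFree w (insert a (C.erase (w (col a)))) = (whiskerFree w C).erase a := by
  ext b
  simp only [mem_whiskerFree, Finset.mem_erase, Finset.mem_insert, Set.mem_range, not_exists]
  constructor
  · rintro ⟨h1, h2⟩
    push Not at h2
    exact ⟨h2.1, h1, h2.2 fun e => h1 _ e.symm⟩
  · rintro ⟨h1, h2, h3⟩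
    exact ⟨h2, by tauto⟩

/-- The complement is the set of whiskers. This guarantees that minimal covers exist, so that the
maximum of the free sets is attained. -/
theorem isMinVertexCover_compl_range (h : IsWhiskered H w col) :
    IsMinVertexCover H (Finset.univ \ Finset.univ.image w) := by
  rw [h.isMinVertexCover_iff]
  refine ⟨fun a b hab => ?_, fun i => ⟨w i, by simp, h.col_w i⟩⟩
  by_cases ha : a ∈ Set.range w
  · obtain ⟨i, rfl⟩ := ha
    have := ((h.adj_w i b).1 hab).1
    right; simpa using this
  · left; simpa using ha

end Covers

end IsWhiskered

/-- Every vertex cover contains a minimal one. -/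
theorem exists_isMinVertexCover_subset {V : Type u} (H : SimpleGraph V) {C : Finset V}
    (hC : H.IsVertexCover (C : Set V)) : ∃ D ⊆ C, IsMinVertexCover H D := by
  obtain ⟨D, hDC, hD⟩ := exists_minimal_le_of_wellFoundedLT
    (fun D : Finset V => H.IsVertexCover (D : Set V)) C hC
  exact ⟨D, hDC, hD⟩

theorem mem_minVertexCovers {V : Type u} [Fintype V] {H : SimpleGraph V} {C : Finset V} :
    C ∈ minVertexCovers H ↔ IsMinVertexCover H C := by
  simp [minVertexCovers]

section

open MvPolynomial

set_option linter.unusedSectionVars false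

/-! ## The complex of a clique-whiskered graph is a resolution -/

section WhiskerComplex

variable {k : Type u} [Field k] {V : Type u} [Fintype V] [LinearOrder V] {ι : Type v} [Fintype ι]
  {H : SimpleGraph V} {w : ι → V} {col : V → ι} {W : ι → Set V}

/-- The sign `(-1) ^ #{b ∈ σ : a < b}`. -/
def upperSign (R : Type*) [CommRing R] (σ : Finset V) (a : V) : R :=
  (-1) ^ (σ.filter (fun b => a < b)).card

theorem upperSign_mul_self (R : Type*) [CommRing R] (σ : Finset V) (a : V) :
    upperSign R σ a * upperSign R σ a = 1 := by
  rw [upperSign, ← mul_pow]; simp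

theorem upperSign_insert_self (R : Type*) [CommRing R] (σ : Finset V) (a : V) :
    upperSign R (insert a σ) a = upperSign R σ a := by
  simp [upperSign, Finset.filter_insert]

theorem upperSign_erase_self (R : Type*) [CommRing R] (σ : Finset V) (a : V) :
    upperSign R (σ.erase a) a = upperSign R σ a := by
  rw [upperSign, upperSign, Finset.filter_erase, Finset.erase_eq_of_notMem (by simp)]

theorem upperSign_insert_of_lt (R : Type*) [CommRing R] {σ : Finset V} {a b : V} (hb : b ∉ σ)
    (h : a < b) : upperSign R (insert b σ) a = - upperSign R σ a := by
  rw [upperSign, upperSign, Finset.filter_insert, if_pos h, Finset.card_insert_of_notMem (by simp [hb]),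
    pow_succ]
  ring

theorem upperSign_insert_of_gt (R : Type*) [CommRing R] {σ : Finset V} {a b : V}
    (h : b < a) : upperSign R (insert b σ) a = upperSign R σ a := by
  rw [upperSign, upperSign, Finset.filter_insert, if_neg h.not_gt]

/-- Only the smaller of `a` and `b` notices in its sign whether the other is present. This makes the
terms of $dh_v$ and $h_vd$ away from $v$ cancel. -/
theorem upperSign_antisymm (R : Type*) [CommRing R] {σ : Finset V} {a b : V} (ha : a ∈ σ)
    (hb : b ∉ σ) : upperSign R σ b * upperSign R (insert b σ) a =
      -(upperSign R σ a * upperSign R (σ.erase a) b) := by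
  have hab : a ≠ b := fun e => hb (e ▸ ha)
  obtain ⟨τ, hτ, rfl⟩ : ∃ τ, a ∉ τ ∧ insert a τ = σ :=
    ⟨σ.erase a, by simp, Finset.insert_erase ha⟩
  rw [Finset.erase_insert hτ]
  have hbτ : b ∉ τ := fun h => hb (by simp [h])
  have e : insert b (insert a τ) = insert a (insert b τ) := Finset.insert_comm _ _ _
  rw [e, upperSign_insert_self, upperSign_insert_self]
  rcases lt_or_gt_of_ne hab with h | h
  · rw [upperSign_insert_of_lt R hbτ h, upperSign_insert_of_gt R h]; ring
  · rw [upperSign_insert_of_lt R hτ h, upperSign_insert_of_gt R h]; ring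

/-- The sign rule behind $d^2=0$: the preceding identity for `σ.erase b`, rearranged by using that
signs square to one. -/
theorem upperSign_erase_antisymm (R : Type*) [CommRing R] {σ : Finset V} {a b : V} (ha : a ∈ σ)
    (hb : b ∈ σ) (hab : a ≠ b) : upperSign R σ b * upperSign R (σ.erase b) a =
      -(upperSign R σ a * upperSign R (σ.erase a) b) := by
  have hs := upperSign_antisymm R (σ := σ.erase b) (a := a) (b := b) (by simp [ha, hab]) (by simp)
  rw [Finset.insert_erase hb, upperSign_erase_self, Finset.erase_right_comm,
    upperSign_erase_self] at hs
  have h1 := upperSign_mul_self R σ a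
  have h2 := upperSign_mul_self R (σ.erase b) a
  linear_combination (upperSign R σ a * upperSign R (σ.erase b) a) * hs
    - upperSign R (σ.erase b) a * upperSign R σ b * h1 -
      upperSign R σ a * upperSign R (σ.erase a) b * h2

namespace WhiskerBasis

/-- The cover `C` of the symbol `f(C; σ)`. -/
def cover {n : ℕ} (q : WhiskerBasis H w n) : Finset V := q.1.1

/-- The set `σ` of the symbol `f(C; σ)`. -/
def face {n : ℕ} (q : WhiskerBasis H w n) : Finset V := q.1.2

theorem admissible {n : ℕ} (q : WhiskerBasis H w n) : IsMinVertexCover H q.cover ∧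
    q.face ⊆ whiskerFree w q.cover ∧ q.face.card = n := q.2

/-- The symbol `f(C; σ)`. -/
def mk {n : ℕ} {C σ : Finset V} (h : IsMinVertexCover H C ∧
    σ ⊆ whiskerFree w C ∧ σ.card = n) : WhiskerBasis H w n := ⟨(C, σ), h⟩

@[simp] theorem cover_mk {n : ℕ} {C σ : Finset V} (h : IsMinVertexCover H C ∧
    σ ⊆ whiskerFree w C ∧ σ.card = n) : (mk h).cover = C := rfl

@[simp] theorem face_mk {n : ℕ} {C σ : Finset V} (h : IsMinVertexCover H C ∧
    σ ⊆ whiskerFree w C ∧ σ.card = n) : (mk h).face = σ := rfl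

theorem ext' {n : ℕ} {q q' : WhiskerBasis H w n} (h : q.cover = q'.cover)
    (h' : q.face = q'.face) : q = q' := Subtype.ext (Prod.ext h h')

end WhiskerBasis

theorem whiskerSymbol_mk {n : ℕ} {C σ : Finset V} (h : IsMinVertexCover H C ∧
    σ ⊆ whiskerFree w C ∧ σ.card = n) :
    whiskerSymbol k H w n C σ = Finsupp.single (WhiskerBasis.mk h) 1 := by
  rw [whiskerSymbol, dif_pos h]; rfl

theorem whiskerSymbol_of_not {n : ℕ} {C σ : Finset V} (h : ¬ (IsMinVertexCover H C ∧
    σ ⊆ whiskerFree w C ∧ σ.card = n)) :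
    whiskerSymbol k H w n C σ = 0 := by
  rw [whiskerSymbol, dif_neg h]

theorem single_eq_smul_whiskerSymbol {n : ℕ} (q : WhiskerBasis H w n) (f : MvPolynomial V k) :
    Finsupp.single q f = f • whiskerSymbol k H w n q.cover q.face := by
  rw [whiskerSymbol_mk q.admissible, Finsupp.smul_single_one]
  rfl

/-- The minimal cover in which `a` replaces the whisker vertex of its colour. -/
def swapCover (w : ι → V) (col : V → ι) (a : V) (C : Finset V) : Finset V :=
  insert a (C.erase (w (col a)))

variable (k H w col) in
/-- The summand of `d (f(C; σ))` belonging to `a ∈ σ`, up to sign. -/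
noncomputable def whiskerTerm (n : ℕ) (C σ : Finset V) (a : V) :
    WhiskerBasis H w n →₀ MvPolynomial V k :=
  (X (w (col a)) : MvPolynomial V k) • whiskerSymbol k H w n (swapCover w col a C) (σ.erase a)
    - (X a : MvPolynomial V k) • whiskerSymbol k H w n C (σ.erase a)

variable (k H w W) in
/-- The differential of `whiskerComplex`. -/
noncomputable def whiskerD (n : ℕ) : (WhiskerBasis H w (n + 1) →₀ MvPolynomial V k)
    →ₗ[MvPolynomial V k] (WhiskerBasis H w n →₀ MvPolynomial V k) :=
  (whiskerComplex k H w W).d n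

variable (k H w W) in
/-- The augmentation of `whiskerComplex`. -/
noncomputable def whiskerAug : (WhiskerBasis H w 0 →₀ MvPolynomial V k)
    →ₗ[MvPolynomial V k] MvPolynomial V k :=
  (whiskerComplex k H w W).ε

/-- Each `a ∈ σ` belongs to `W i` only for its own colour, so the double sum collapses to a sum over
`σ`. -/
theorem whiskerD_symbol (hW : ∀ i a, a ∈ W i ↔ a ∉ Set.range w ∧ col a = i) {n : ℕ}
    {C σ : Finset V} (h : IsMinVertexCover H C ∧ σ ⊆ whiskerFree w C ∧ σ.card = n + 1) :
    whiskerD k H w W n (whiskerSymbol k H w (n + 1) C σ) =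
      ∑ a ∈ σ, upperSign (MvPolynomial V k) σ a • whiskerTerm k H w col n C σ a := by
  classical
  rw [whiskerSymbol_mk h]
  simp only [whiskerD, whiskerComplex]
  erw [Finsupp.linearCombination_single]
  rw [one_smul]
  simp only [Finset.sum_filter]
  rw [Finset.sum_comm]
  refine Finset.sum_congr rfl fun a ha => ?_
  have haw := (IsWhiskered.mem_whiskerFree w).1 (h.2.1 ha)
  rw [Finset.sum_eq_single (col a)]
  · rw [if_pos ((hW _ _).2 ⟨haw.1, rfl⟩)]
    rfl
  · intro i _ hi
    rw [if_neg]
    intro hai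
    exact hi ((hW _ _).1 hai).2.symm
  · simp

theorem whiskerAug_symbol {C : Finset V} (h : IsMinVertexCover H C) :
    whiskerAug k H w W (whiskerSymbol k H w 0 C ∅) = ∏ a ∈ C, X a := by
  rw [whiskerSymbol_mk ⟨h, by simp, by simp⟩]
  simp only [whiskerAug, whiskerComplex]
  erw [Finsupp.linearCombination_single]
  rw [one_smul]
  rfl

theorem mem_swapCover_of_ne {C : Finset V} {a b : V}
    (hb : b ∉ Set.range w) (hab : b ≠ a) : b ∈ swapCover w col a C ↔ b ∈ C := by
  rw [swapCover, Finset.mem_insert, Finset.mem_erase]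
  constructor
  · rintro (h | h)
    · exact absurd h hab
    · exact h.2
  · intro h
    exact Or.inr ⟨fun e => hb ⟨_, e.symm⟩, h⟩

theorem swapCover_admissible (hw : IsWhiskered H w col) {n : ℕ}
    {C σ : Finset V} (h : IsMinVertexCover H C ∧ σ ⊆ whiskerFree w C ∧ σ.card = n + 1)
    {a : V} (ha : a ∈ σ) : IsMinVertexCover H (swapCover w col a C) ∧
      σ.erase a ⊆ whiskerFree w (swapCover w col a C) ∧ (σ.erase a).card = n := by
  have haw := (IsWhiskered.mem_whiskerFree w).1 (h.2.1 ha)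
  refine ⟨hw.swap h.1 haw.2 haw.1, ?_, by rw [Finset.card_erase_of_mem ha, h.2.2]; rfl⟩
  rw [swapCover, IsWhiskered.whiskerFree_swap]
  exact Finset.erase_subset_erase _ h.2.1

theorem erase_admissible {n : ℕ}
    {C σ : Finset V} (h : IsMinVertexCover H C ∧ σ ⊆ whiskerFree w C ∧ σ.card = n + 1)
    {a : V} (ha : a ∈ σ) : IsMinVertexCover H C ∧
      σ.erase a ⊆ whiskerFree w C ∧ (σ.erase a).card = n :=
  ⟨h.1, (Finset.erase_subset _ _).trans h.2.1,
    by rw [Finset.card_erase_of_mem ha, h.2.2]; rfl⟩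

/-- Neither `a` nor `b` is a whisker, so an erasure never undoes an insertion, even if both have the
same colour. -/
theorem swapCover_comm {C : Finset V} {a b : V}
    (ha : a ∉ Set.range w) (hb : b ∉ Set.range w) :
    swapCover w col a (swapCover w col b C) = swapCover w col b (swapCover w col a C) := by
  have h1 : ∀ i, w i ≠ a := fun i e => ha ⟨i, e⟩
  have h2 : ∀ i, w i ≠ b := fun i e => hb ⟨i, e⟩
  ext x
  simp only [swapCover, Finset.mem_insert, Finset.mem_erase]
  have := h1 (col a); have := h1 (col b); have := h2 (col a); have := h2 (col b)
  constructor <;> rintro (h | h) <;> grind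

theorem whiskerD_term (hw : IsWhiskered H w col)
    (hW : ∀ i a, a ∈ W i ↔ a ∉ Set.range w ∧ col a = i) {n : ℕ}
    {C σ : Finset V} (h : IsMinVertexCover H C ∧ σ ⊆ whiskerFree w C ∧ σ.card = n + 2)
    {a : V} (ha : a ∈ σ) :
    whiskerD k H w W n (whiskerTerm k H w col (n + 1) C σ a) =
      ∑ b ∈ σ.erase a, upperSign (MvPolynomial V k) (σ.erase a) b •
        ((X (w (col a)) : MvPolynomial V k) •
            whiskerTerm k H w col n (swapCover w col a C) (σ.erase a) b
          - (X a : MvPolynomial V k) • whiskerTerm k H w col n C (σ.erase a) b) := by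
  rw [whiskerTerm, map_sub, map_smul, map_smul,
    whiskerD_symbol hW (swapCover_admissible hw h ha),
    whiskerD_symbol hW (erase_admissible h ha), Finset.smul_sum, Finset.smul_sum,
    ← Finset.sum_sub_distrib]
  refine Finset.sum_congr rfl fun b _ => ?_
  rw [smul_sub, smul_comm, smul_comm (X a : MvPolynomial V k)]

/-- Up to sign both summands expand to $abA_1-adA_2-bcA_3+cdA_4$, and the hypothesis makes the signs
opposite. -/
theorem smul_combination {R M : Type*} [CommRing R] [AddCommGroup M] [Module R M]
    {s s' t t' : R} (h : s * s' = -(t * t')) (a b c d : R) (A₁ A₂ A₃ A₄ : M) :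
    t • t' • (a • (b • A₁ - d • A₂) - c • (b • A₃ - d • A₄)) +
      s • s' • (b • (a • A₁ - c • A₃) - d • (a • A₂ - c • A₄)) = 0 := by
  have e : t • t' • (a • (b • A₁ - d • A₂) - c • (b • A₃ - d • A₄)) +
      s • s' • (b • (a • A₁ - c • A₃) - d • (a • A₂ - c • A₄)) =
      (s * s' + t * t') • (a • (b • A₁ - d • A₂) - c • (b • A₃ - d • A₄)) := by module
  rw [e, h, neg_add_cancel, zero_smul]

/-- Deleting `a` and then `b` cancels against deleting `b` and then `a`: the exchanges of covers
commute and the signs are opposite. -/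
theorem whiskerD_comp_d_symbol (hw : IsWhiskered H w col)
    (hW : ∀ i a, a ∈ W i ↔ a ∉ Set.range w ∧ col a = i) {n : ℕ}
    {C σ : Finset V} (h : IsMinVertexCover H C ∧ σ ⊆ whiskerFree w C ∧ σ.card = n + 2) :
    whiskerD k H w W n (whiskerD k H w W (n + 1)
      (whiskerSymbol k H w (n + 2) C σ)) = 0 := by
  rw [whiskerD_symbol hW h, map_sum]
  simp only [map_smul]
  rw [Finset.sum_congr rfl (fun a ha => by rw [whiskerD_term hw hW h ha])]
  simp only [Finset.smul_sum]
  rw [Finset.sum_sigma']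
  refine Finset.sum_involution (fun x _ => ⟨x.2, x.1⟩) ?_ ?_ ?_ ?_
  · rintro ⟨a, b⟩ hab
    simp only [Finset.mem_sigma, Finset.mem_erase] at hab
    obtain ⟨ha, hba, hb⟩ := hab
    have haw := ((IsWhiskered.mem_whiskerFree w).1 (h.2.1 ha)).1
    have hbw := ((IsWhiskered.mem_whiskerFree w).1 (h.2.1 hb)).1
    simp only [whiskerTerm]
    rw [swapCover_comm hbw haw, Finset.erase_right_comm (a := b) (b := a)]
    exact smul_combination (upperSign_erase_antisymm _ ha hb hba.symm) _ _ _ _ _ _ _ _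
  · rintro ⟨a, b⟩ hab _ e
    simp only [Finset.mem_sigma, Finset.mem_erase] at hab
    exact hab.2.1 (congrArg Sigma.fst e)
  · rintro ⟨a, b⟩ hab
    simp only [Finset.mem_sigma, Finset.mem_erase] at hab ⊢
    exact ⟨hab.2.2, hab.2.1.symm, hab.1⟩
  · rintro ⟨a, b⟩ _
    rfl

theorem whiskerD_comp_whiskerD (hw : IsWhiskered H w col)
    (hW : ∀ i a, a ∈ W i ↔ a ∉ Set.range w ∧ col a = i) (n : ℕ) :
    whiskerD k H w W n ∘ₗ whiskerD k H w W (n + 1) = 0 := by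
  refine Finsupp.lhom_ext fun q f => ?_
  rw [single_eq_smul_whiskerSymbol, LinearMap.comp_apply, map_smul, map_smul,
    whiskerD_comp_d_symbol hw hW q.admissible, smul_zero, LinearMap.zero_apply]

/-- The exchange puts `a` into the product and takes `w (col a)` out. Hence the two terms of the
differential at `a` have the same augmentation. -/
theorem prod_swapCover (hw : IsWhiskered H w col) {C : Finset V} (hC : IsMinVertexCover H C)
    {a : V} (ha : a ∉ C) (haw : a ∉ Set.range w) :
    X (w (col a)) * ∏ b ∈ swapCover w col a C, (X b : MvPolynomial V k) =
      X a * ∏ b ∈ C, X b := by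
  rw [swapCover, Finset.prod_insert (by simp [ha]), mul_left_comm,
    Finset.mul_prod_erase _ _ (hw.w_mem hC ha haw)]

theorem whiskerAug_comp_whiskerD (hw : IsWhiskered H w col)
    (hW : ∀ i a, a ∈ W i ↔ a ∉ Set.range w ∧ col a = i) :
    whiskerAug k H w W ∘ₗ whiskerD k H w W 0 = 0 := by
  refine Finsupp.lhom_ext fun q f => ?_
  rw [single_eq_smul_whiskerSymbol, LinearMap.comp_apply, map_smul, map_smul]
  have h := q.admissible
  generalize q.cover = C at h ⊢
  generalize q.face = σ at h ⊢
  rw [whiskerD_symbol hW h, map_sum, LinearMap.zero_apply]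
  refine smul_eq_zero_of_right _ (Finset.sum_eq_zero fun a ha => ?_)
  have haw := (IsWhiskered.mem_whiskerFree w).1 (h.2.1 ha)
  have he : σ.erase a = ∅ := by
    rw [← Finset.card_eq_zero, Finset.card_erase_of_mem ha, h.2.2]
  rw [map_smul, whiskerTerm, map_sub, map_smul, map_smul, he, whiskerAug_symbol h.1,
    whiskerAug_symbol (swapCover_admissible hw h ha).1, smul_eq_mul, smul_eq_mul,
    prod_swapCover hw h.1 haw.2 haw.1, smul_eq_mul, sub_self, mul_zero]

/-! ### A contracting homotopy for every variable -/

variable (k H w) in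
open scoped Classical in
/-- The homotopy `x^m f(C; σ) ↦ ∓ x^(m - v) f(C; σ ∪ {v})`. -/
noncomputable def whiskerHomotopy (v : V) (n : ℕ) :
    (WhiskerBasis H w n →₀ MvPolynomial V k) →ₗ[k]
      (WhiskerBasis H w (n + 1) →₀ MvPolynomial V k) :=
  Finsupp.lsum k fun q => (basisMonomials V k).constr k fun m =>
    if v ∉ q.cover ∧ v ∉ q.face ∧ m v ≠ 0 then
      (-upperSign k q.face v) • (monomial (m - Finsupp.single v 1) (1 : k) •
        whiskerSymbol k H w (n + 1) q.cover (insert v q.face))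
    else 0

-- Pairs that are not symbols are allowed: if `f(C; σ)` is zero by convention, so is `f(C; σ ∪
-- {v})`, since admissibility would pass to the smaller set.
open scoped Classical in
theorem whiskerHomotopy_monomial_smul (v : V) (n : ℕ) (m : V →₀ ℕ) (C σ : Finset V) :
    whiskerHomotopy k H w v n (monomial m (1 : k) • whiskerSymbol k H w n C σ) =
    if v ∉ C ∧ v ∉ σ ∧ m v ≠ 0 then
      (-upperSign k σ v) • (monomial (m - Finsupp.single v 1) (1 : k) •
        whiskerSymbol k H w (n + 1) C (insert v σ))
    else 0 := by
  by_cases h : IsMinVertexCover H C ∧ σ ⊆ whiskerFree w C ∧ σ.card = n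
  · have := single_eq_smul_whiskerSymbol (WhiskerBasis.mk h) (monomial m (1 : k))
    rw [WhiskerBasis.cover_mk, WhiskerBasis.face_mk] at this
    rw [← this, whiskerHomotopy, Finsupp.lsum_single]
    exact (basisMonomials V k).constr_basis k _ m
  · rw [whiskerSymbol_of_not h, smul_zero, map_zero]
    split_ifs with hv
    · rw [whiskerSymbol_of_not, smul_zero, smul_zero]
      rintro ⟨h1, h2, h3⟩
      rw [Finset.card_insert_of_notMem hv.2.1] at h3
      exact h ⟨h1, (Finset.subset_insert _ _).trans h2, by omega⟩
    · rfl

end WhiskerComplex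

section WhiskerExact

variable {k : Type u} [Field k] {V : Type u} [Fintype V] [LinearOrder V] {ι : Type v} [Fintype ι]
  {H : SimpleGraph V} {w : ι → V} {col : V → ι} {W : ι → Set V}

variable (k H w) in
/-- The element `x^m f(C; σ)`. -/
noncomputable def whiskerCell (n : ℕ) (m : V →₀ ℕ) (C σ : Finset V) :
    WhiskerBasis H w n →₀ MvPolynomial V k :=
  monomial m (1 : k) • whiskerSymbol k H w n C σ

theorem upperSign_smul {M : Type*} [AddCommGroup M] [Module k M] [Module (MvPolynomial V k) M]
    [IsScalarTower k (MvPolynomial V k) M] (σ : Finset V) (a : V) (x : M) :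
    upperSign (MvPolynomial V k) σ a • x = upperSign k σ a • x := by
  rw [← algebraMap_smul (MvPolynomial V k) (upperSign k σ a) x]
  simp [upperSign]

theorem monomial_smul_whiskerTerm (n : ℕ) (m : V →₀ ℕ) (C σ : Finset V) (a : V) :
    monomial m (1 : k) • whiskerTerm k H w col n C σ a =
      whiskerCell k H w n (m + Finsupp.single (w (col a)) 1) (swapCover w col a C) (σ.erase a)
        - whiskerCell k H w n (m + Finsupp.single a 1) C (σ.erase a) := by
  rw [whiskerTerm, smul_sub, smul_smul, smul_smul, X, X, monomial_mul, monomial_mul, one_mul]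
  rfl

theorem whiskerD_cell (hW : ∀ i a, a ∈ W i ↔ a ∉ Set.range w ∧ col a = i) {n : ℕ} (m : V →₀ ℕ)
    {C σ : Finset V} (h : IsMinVertexCover H C ∧ σ ⊆ whiskerFree w C ∧ σ.card = n + 1) :
    whiskerD k H w W n (whiskerCell k H w (n + 1) m C σ) = ∑ a ∈ σ, upperSign k σ a •
      (whiskerCell k H w n (m + Finsupp.single (w (col a)) 1) (swapCover w col a C) (σ.erase a)
        - whiskerCell k H w n (m + Finsupp.single a 1) C (σ.erase a)) := by
  rw [whiskerCell, map_smul, whiskerD_symbol hW h, Finset.smul_sum]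
  refine Finset.sum_congr rfl fun a _ => ?_
  rw [smul_comm, upperSign_smul, monomial_smul_whiskerTerm]

theorem whiskerHomotopy_cell {v : V} {n : ℕ} {m : V →₀ ℕ} {C σ : Finset V}
    (h : v ∉ C ∧ v ∉ σ ∧ m v ≠ 0) :
    whiskerHomotopy k H w v n (whiskerCell k H w n m C σ) = (-upperSign k σ v) •
      whiskerCell k H w (n + 1) (m - Finsupp.single v 1) C (insert v σ) := by
  classical
  rw [whiskerCell, whiskerHomotopy_monomial_smul, if_pos h]
  rfl

theorem whiskerHomotopy_cell_eq_zero {v : V} {n : ℕ} {m : V →₀ ℕ} {C σ : Finset V}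
    (h : ¬ (v ∉ C ∧ v ∉ σ ∧ m v ≠ 0)) :
    whiskerHomotopy k H w v n (whiskerCell k H w n m C σ) = 0 := by
  classical
  rw [whiskerCell, whiskerHomotopy_monomial_smul, if_neg h]

theorem insert_admissible {n : ℕ}
    {C σ : Finset V} (h : IsMinVertexCover H C ∧ σ ⊆ whiskerFree w C ∧ σ.card = n)
    {v : V} (hv : v ∉ Set.range w) (hvC : v ∉ C) (hvσ : v ∉ σ) : IsMinVertexCover H C ∧
      insert v σ ⊆ whiskerFree w C ∧ (insert v σ).card = n + 1 := by
  refine ⟨h.1, Finset.insert_subset ((IsWhiskered.mem_whiskerFree w).2 ⟨hv, hvC⟩) h.2.1, ?_⟩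
  rw [Finset.card_insert_of_notMem hvσ, h.2.2]

/-- In the differential of the enlarged cell, the summand at `v` returns the original cell, with
coefficient one by the choice of sign, and its exchanged companion. The summands at `a ∈ σ` are
those to be cancelled by $h_vd$. -/
theorem whiskerD_homotopy_cell
    (hW : ∀ i a, a ∈ W i ↔ a ∉ Set.range w ∧ col a = i) {n : ℕ} {m : V →₀ ℕ}
    {C σ : Finset V} (h : IsMinVertexCover H C ∧ σ ⊆ whiskerFree w C ∧ σ.card = n)
    {v : V} (hv : v ∉ Set.range w) (hv' : v ∉ C ∧ v ∉ σ ∧ m v ≠ 0) :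
    whiskerD k H w W n (whiskerHomotopy k H w v n (whiskerCell k H w n m C σ)) =
      whiskerCell k H w n m C σ - whiskerCell k H w n
        (m - Finsupp.single v 1 + Finsupp.single (w (col v)) 1) (swapCover w col v C) σ
      - ∑ a ∈ σ, (upperSign k σ v * upperSign k (insert v σ) a) •
      (whiskerCell k H w n (m - Finsupp.single v 1 + Finsupp.single (w (col a)) 1)
          (swapCover w col a C) (insert v (σ.erase a))
        - whiskerCell k H w n (m - Finsupp.single v 1 + Finsupp.single a 1) C
          (insert v (σ.erase a))) := by
  rw [whiskerHomotopy_cell hv', LinearMap.map_smul_of_tower,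
    whiskerD_cell hW _ (insert_admissible h hv hv'.1 hv'.2.1),
    Finset.sum_insert hv'.2.1, upperSign_insert_self, Finset.erase_insert hv'.2.1, smul_add,
    smul_smul, neg_mul, upperSign_mul_self, neg_one_smul, neg_sub, tsub_add_cancel_of_le, neg_smul,
    ← sub_eq_add_neg, Finset.smul_sum]
  · congr 1
    refine Finset.sum_congr rfl fun a ha => ?_
    have hav : v ≠ a := fun e => hv'.2.1 (e ▸ ha)
    rw [smul_smul, Finset.erase_insert_of_ne hav]
  · rw [Finsupp.single_le_iff]
    exact Nat.one_le_iff_ne_zero.2 hv'.2.2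

/-- The homotopy formula where `v` is active. -/
theorem whiskerHomotopy_formula_active
    (hW : ∀ i a, a ∈ W i ↔ a ∉ Set.range w ∧ col a = i) {n : ℕ} {m : V →₀ ℕ}
    {C σ : Finset V} (h : IsMinVertexCover H C ∧ σ ⊆ whiskerFree w C ∧ σ.card = n + 1)
    {v : V} (hv : v ∉ Set.range w) (hv' : v ∉ C ∧ v ∉ σ ∧ m v ≠ 0) :
    whiskerD k H w W (n + 1) (whiskerHomotopy k H w v (n + 1) (whiskerCell k H w (n + 1) m C σ)) +
      whiskerHomotopy k H w v n (whiskerD k H w W n (whiskerCell k H w (n + 1) m C σ)) =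
      whiskerCell k H w (n + 1) m C σ - whiskerCell k H w (n + 1)
        (m - Finsupp.single v 1 + Finsupp.single (w (col v)) 1) (swapCover w col v C) σ := by
  rw [whiskerD_homotopy_cell hW h hv hv', whiskerD_cell hW _ h, map_sum, sub_add_eq_add_sub,
    sub_eq_iff_eq_add]
  congr 1
  -- `v` stays active in both cells at `a`: it is not `a`, so it does not enter the cover, and its
  -- exponent does not drop. The signs match by antisymmetry.
  refine Finset.sum_congr rfl fun a ha => ?_
  have hav : v ≠ a := fun e => hv'.2.1 (e ▸ ha)
  have hle : Finsupp.single v 1 ≤ m := by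
    rw [Finsupp.single_le_iff]
    exact Nat.one_le_iff_ne_zero.2 hv'.2.2
  rw [LinearMap.map_smul, map_sub, whiskerHomotopy_cell, whiskerHomotopy_cell,
    upperSign_antisymm k ha hv'.2.1, tsub_add_eq_add_tsub hle, tsub_add_eq_add_tsub hle,
    ← smul_sub, smul_smul, mul_neg]
  · refine ⟨hv'.1, by simp [hv'.2.1], ?_⟩
    simp [hv'.2.2]
  · refine ⟨by rw [mem_swapCover_of_ne hv hav]; exact hv'.1, by simp [hv'.2.1], ?_⟩
    simp [hv'.2.2]

/-- The homotopy kills every cell whose `σ` contains `v`, so after the differential only the summand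
at `v` matters. There the exchanged cell has `v` in its cover and is killed too; the other term
gives back the original cell, two minus signs cancelling. -/
theorem whiskerHomotopy_formula_mem
    (hW : ∀ i a, a ∈ W i ↔ a ∉ Set.range w ∧ col a = i) {n : ℕ} {m : V →₀ ℕ}
    {C σ : Finset V} (h : IsMinVertexCover H C ∧ σ ⊆ whiskerFree w C ∧ σ.card = n + 1)
    {v : V} (hv : v ∈ σ) :
    whiskerD k H w W (n + 1) (whiskerHomotopy k H w v (n + 1) (whiskerCell k H w (n + 1) m C σ)) +
      whiskerHomotopy k H w v n (whiskerD k H w W n (whiskerCell k H w (n + 1) m C σ)) =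
      whiskerCell k H w (n + 1) m C σ := by
  rw [whiskerHomotopy_cell_eq_zero (by tauto), map_zero, zero_add, whiskerD_cell hW _ h, map_sum,
    Finset.sum_eq_single_of_mem v hv]
  · rw [LinearMap.map_smul, map_sub, whiskerHomotopy_cell_eq_zero (by simp [swapCover]), zero_sub,
      whiskerHomotopy_cell, neg_smul, neg_neg, Finset.insert_erase hv, add_tsub_cancel_right,
      upperSign_erase_self, smul_smul, upperSign_mul_self, one_smul]
    refine ⟨?_, by simp, by simp⟩
    exact ((IsWhiskered.mem_whiskerFree w).1 (h.2.1 hv)).2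
  · intro a _ hav
    have : v ∈ σ.erase a := Finset.mem_erase.2 ⟨hav.symm, hv⟩
    rw [LinearMap.map_smul, map_sub, whiskerHomotopy_cell_eq_zero (by tauto),
      whiskerHomotopy_cell_eq_zero (by tauto), sub_zero, smul_zero]

/-- The differential changes covers and exponents only at `a ≠ v` and at whiskers, so no summand
makes `v` active. -/
theorem whiskerHomotopy_formula_inactive
    (hW : ∀ i a, a ∈ W i ↔ a ∉ Set.range w ∧ col a = i) {n : ℕ} {m : V →₀ ℕ}
    {C σ : Finset V} (h : IsMinVertexCover H C ∧ σ ⊆ whiskerFree w C ∧ σ.card = n + 1)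
    {v : V} (hv : v ∉ Set.range w) (hσ : v ∉ σ) (hv' : v ∈ C ∨ m v = 0) :
    whiskerD k H w W (n + 1) (whiskerHomotopy k H w v (n + 1) (whiskerCell k H w (n + 1) m C σ)) +
      whiskerHomotopy k H w v n (whiskerD k H w W n (whiskerCell k H w (n + 1) m C σ)) = 0 := by
  rw [whiskerHomotopy_cell_eq_zero (by tauto), map_zero, zero_add, whiskerD_cell hW _ h, map_sum]
  refine Finset.sum_eq_zero fun a ha => ?_
  have hav : v ≠ a := fun e => hσ (e ▸ ha)
  have hwv : w (col a) ≠ v := fun e => hv ⟨_, e⟩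
  rw [LinearMap.map_smul, map_sub, whiskerHomotopy_cell_eq_zero, whiskerHomotopy_cell_eq_zero,
      sub_zero, smul_zero]
  · simp only [Finsupp.add_apply, Finsupp.single_apply, if_neg hav.symm, add_zero]
    tauto
  · rw [mem_swapCover_of_ne hv hav]
    simp only [Finsupp.add_apply, Finsupp.single_apply, if_neg hwv, add_zero]
    tauto

/-! ### Reduced chains -/

/-- `x^m f(C; σ)` is not moved by the homotopies for the vertices in `T`. -/
def IsReducedAt (w : ι → V) (T : Finset V) (m : V →₀ ℕ) (C σ : Finset V) : Prop :=
  ∀ u ∈ T, u ∉ Set.range w → u ∈ C ∨ (u ∉ σ ∧ m u = 0)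

variable (k H w) in
/-- The span of the elements `x^m f(C; σ)` that are reduced at `T`. -/
noncomputable def reducedSpan (T : Finset V) (n : ℕ) :
    Submodule k (WhiskerBasis H w n →₀ MvPolynomial V k) :=
  Submodule.span k {x | ∃ m C σ, (IsMinVertexCover H C ∧ σ ⊆ whiskerFree w C ∧ σ.card = n) ∧
    IsReducedAt w T m C σ ∧ x = whiskerCell k H w n m C σ}

theorem reducedSpan_empty (n : ℕ) : reducedSpan k H w ∅ n = ⊤ := by
  rw [eq_top_iff]
  rintro x -
  induction x using Finsupp.induction_linear with
  | zero => exact zero_mem _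
  | add f g hf hg => exact add_mem hf hg
  | single q f =>
    induction f using MvPolynomial.induction_on' with
    | monomial m c =>
      have : Finsupp.single q (monomial m c) = c • whiskerCell k H w n m q.cover q.face := by
        rw [whiskerCell, ← single_eq_smul_whiskerSymbol, Finsupp.smul_single, smul_monomial,
          smul_eq_mul, mul_one]
      rw [this]
      exact Submodule.smul_mem _ _ (Submodule.subset_span
        ⟨m, _, _, q.admissible, fun u hu => absurd hu (by simp), rfl⟩)
    | add f g hf hg => rw [Finsupp.single_add]; exact add_mem hf hg

/-- After the exchange `v` lies in the cover, and for every other non-whisker the exponent and the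
membership are unchanged. Reductions already made are therefore kept. -/
theorem IsReducedAt.swap {T : Finset V} {m : V →₀ ℕ} {C σ : Finset V}
    (h : IsReducedAt w T m C σ) {v : V} :
    IsReducedAt w (insert v T) (m - Finsupp.single v 1 + Finsupp.single (w (col v)) 1)
      (swapCover w col v C) σ := by
  intro u hu huw
  by_cases huv : u = v
  · left; simp [huv, swapCover]
  · rw [mem_swapCover_of_ne huw huv]
    have hwu : w (col v) ≠ u := fun e => huw ⟨_, e⟩
    have := h u (Finset.mem_of_mem_insert_of_ne hu huv) huw
    simpa [Finsupp.single_apply, hwu, Ne.symm huv] using this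

theorem IsReducedAt.insert {T : Finset V} {m : V →₀ ℕ} {C σ : Finset V}
    (h : IsReducedAt w T m C σ) {v : V} (hv : v ∈ C ∨ (v ∉ σ ∧ m v = 0)) :
    IsReducedAt w (insert v T) m C σ := by
  intro u hu huw
  rcases Finset.mem_insert.1 hu with rfl | hu
  · exact hv
  · exact h u hu huw

/-- For empty `σ`, the correction $dh_v$ replaces an active cell by its exchanged companion and
leaves the other cells alone. -/
theorem reduce_zero (hw : IsWhiskered H w col)
    (hW : ∀ i a, a ∈ W i ↔ a ∉ Set.range w ∧ col a = i) (T : Finset V) {v : V}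
    (hv : v ∉ Set.range w) {z : WhiskerBasis H w 0 →₀ MvPolynomial V k}
    (hz : z ∈ reducedSpan k H w T 0) :
    z - whiskerD k H w W 0 (whiskerHomotopy k H w v 0 z) ∈ reducedSpan k H w (insert v T) 0 := by
  refine Submodule.span_induction ?_ (by simp) ?_ ?_ hz
  · rintro _ ⟨m, C, σ, h, hr, rfl⟩
    have hσ : σ = ∅ := Finset.card_eq_zero.1 h.2.2
    subst hσ
    by_cases hv' : v ∉ C ∧ v ∉ (∅ : Finset V) ∧ m v ≠ 0
    · rw [whiskerD_homotopy_cell hW h hv hv', Finset.sum_empty, sub_zero, sub_sub_cancel]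
      refine Submodule.subset_span ⟨_, _, _, ⟨hw.swap h.1 hv'.1 hv, by simp, rfl⟩, hr.swap, rfl⟩
    · rw [whiskerHomotopy_cell_eq_zero hv', map_zero, sub_zero]
      refine Submodule.subset_span ⟨_, _, _, h, hr.insert ?_, rfl⟩
      simp only [Finset.notMem_empty, not_false_eq_true, true_and] at hv' ⊢
      tauto
  · intro x y _ _ hx hy
    rw [map_add, map_add, add_sub_add_comm]
    exact add_mem hx hy
  · intro c x _ hx
    rw [map_smul, LinearMap.map_smul_of_tower, ← smul_sub]
    exact Submodule.smul_mem _ _ hx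

/-- By the three homotopy formulas, a cell containing `v` disappears, an inactive cell stays, and an
active one becomes its exchanged companion; what is left is reduced at `v` as well. -/
theorem reduce_succ (hw : IsWhiskered H w col)
    (hW : ∀ i a, a ∈ W i ↔ a ∉ Set.range w ∧ col a = i) (T : Finset V) {v : V}
    (hv : v ∉ Set.range w) {n : ℕ} {z : WhiskerBasis H w (n + 1) →₀ MvPolynomial V k}
    (hz : z ∈ reducedSpan k H w T (n + 1)) :
    z - (whiskerD k H w W (n + 1) (whiskerHomotopy k H w v (n + 1) z) +
      whiskerHomotopy k H w v n (whiskerD k H w W n z)) ∈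
      reducedSpan k H w (insert v T) (n + 1) := by
  refine Submodule.span_induction ?_ (by simp) ?_ ?_ hz
  · rintro _ ⟨m, C, σ, h, hr, rfl⟩
    by_cases hvσ : v ∈ σ
    · rw [whiskerHomotopy_formula_mem hW h hvσ, sub_self]
      exact zero_mem _
    by_cases hv' : v ∈ C ∨ m v = 0
    · rw [whiskerHomotopy_formula_inactive hW h hv hvσ hv', sub_zero]
      refine Submodule.subset_span ⟨_, _, _, h, hr.insert ?_, rfl⟩
      tauto
    · push Not at hv'
      rw [whiskerHomotopy_formula_active hW h hv ⟨hv'.1, hvσ, hv'.2⟩, sub_sub_cancel]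
      refine Submodule.subset_span ⟨_, _, _, ⟨hw.swap h.1 hv'.1 hv, ?_, h.2.2⟩, hr.swap, rfl⟩
      rw [IsWhiskered.whiskerFree_swap]
      exact fun a ha => Finset.mem_erase.2 ⟨fun e => hvσ (e ▸ ha), h.2.1 ha⟩
  · intro x y _ _ hx hy
    convert add_mem hx hy using 1
    simp only [map_add]
    abel
  · intro c x _ hx
    convert Submodule.smul_mem _ c hx using 1
    simp only [map_smul, LinearMap.map_smul_of_tower, smul_sub, smul_add]

/-- A vertex of `σ` is a non-whisker outside the cover, which is exactly what a reduced cell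
excludes. -/
theorem reducedSpan_univ_succ (n : ℕ) : reducedSpan k H w Finset.univ (n + 1) = ⊥ := by
  rw [reducedSpan, Submodule.span_eq_bot]
  rintro _ ⟨m, C, σ, h, hr, rfl⟩
  obtain ⟨a, ha⟩ : σ.Nonempty := by rw [← Finset.card_pos, h.2.2]; omega
  have haw := (IsWhiskered.mem_whiskerFree w).1 (h.2.1 ha)
  rcases hr a (Finset.mem_univ _) haw.1 with h' | h'
  · exact absurd h' haw.2
  · exact absurd ha h'.1

theorem IsReducedAt.of_insert_range {T : Finset V} {m : V →₀ ℕ} {C σ : Finset V} {v : V}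
    (hv : v ∈ Set.range w) (h : IsReducedAt w T m C σ) : IsReducedAt w (Insert.insert v T) m C σ := by
  intro u hu huw
  rcases Finset.mem_insert.1 hu with rfl | hu
  · exact absurd hv huw
  · exact h u hu huw

theorem reducedSpan_insert_range {T : Finset V} {n : ℕ} {v : V} (hv : v ∈ Set.range w) :
    reducedSpan k H w T n ≤ reducedSpan k H w (insert v T) n := by
  refine Submodule.span_mono ?_
  rintro _ ⟨m, C, σ, h, hr, rfl⟩
  exact ⟨m, C, σ, h, hr.of_insert_range hv, rfl⟩

/-- On cycles the term $h_vd$ vanishes, so reducing at one vertex after another changes a cycle by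
boundaries only, and a completely reduced chain of positive degree is zero. -/
theorem whiskerD_range_succ (hw : IsWhiskered H w col)
    (hW : ∀ i a, a ∈ W i ↔ a ∉ Set.range w ∧ col a = i) (n : ℕ) :
    LinearMap.ker (whiskerD k H w W n) = LinearMap.range (whiskerD k H w W (n + 1)) := by
  refine le_antisymm ?_ (LinearMap.range_le_ker_iff.2 (whiskerD_comp_whiskerD hw hW n))
  intro z hz
  have key : ∀ T : Finset V, ∃ y, z - whiskerD k H w W (n + 1) y ∈ reducedSpan k H w T (n + 1) := by
    intro T
    induction T using Finset.induction_on with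
    | empty => exact ⟨0, by rw [reducedSpan_empty]; trivial⟩
    | insert v T _ ih =>
      obtain ⟨y, hy⟩ := ih
      by_cases hv : v ∈ Set.range w
      · exact ⟨y, reducedSpan_insert_range hv hy⟩
      · have hd : whiskerD k H w W n (z - whiskerD k H w W (n + 1) y) = 0 := by
          rw [map_sub, LinearMap.mem_ker.1 hz, zero_sub, neg_eq_zero]
          exact LinearMap.congr_fun (whiskerD_comp_whiskerD hw hW n) y
        have := reduce_succ hw hW T hv hy
        rw [hd, map_zero, add_zero, sub_sub, ← map_add] at this
        exact ⟨_, this⟩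
  obtain ⟨y, hy⟩ := key Finset.univ
  rw [reducedSpan_univ_succ, Submodule.mem_bot, sub_eq_zero] at hy
  exact ⟨y, hy.symm⟩

/-- In the monomial $x^m z_C$ of a reduced cell, a non-whisker occurs exactly when it lies in `C`,
so the two covers agree on non-whiskers. -/
theorem cover_eq_of_monomial_eq (hw : IsWhiskered H w col) {m m' : V →₀ ℕ} {C C' : Finset V}
    (hC : IsMinVertexCover H C) (hC' : IsMinVertexCover H C')
    (hr : IsReducedAt w Finset.univ m C ∅) (hr' : IsReducedAt w Finset.univ m' C' ∅)
    (h : m + ∑ a ∈ C, Finsupp.single a 1 = m' + ∑ a ∈ C', Finsupp.single a 1) : C = C' := by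
  have sum_apply : ∀ (D : Finset V) (a : V), (∑ b ∈ D, Finsupp.single b 1 : V →₀ ℕ) a =
      if a ∈ D then 1 else 0 := by
    intro D a
    rw [Finsupp.finsetSum_apply]
    simp [Finsupp.single_apply]
  have key : ∀ a, a ∉ Set.range w → (a ∈ C ↔ a ∈ C') := by
    intro a ha
    have e := DFunLike.congr_fun h a
    rw [Finsupp.add_apply, Finsupp.add_apply, sum_apply, sum_apply] at e
    have h1 := hr a (Finset.mem_univ _) ha
    have h2 := hr' a (Finset.mem_univ _) ha
    constructor
    · intro haC
      by_contra haC'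
      rw [if_pos haC, if_neg haC'] at e
      have := h2.resolve_left haC'
      omega
    · intro haC
      by_contra haC'
      rw [if_pos haC, if_neg haC'] at e
      have := h1.resolve_left haC'
      omega
  -- The non-whisker part determines a minimal cover: the whisker of a colour is covered exactly
  -- when the uncovered vertex of that colour is not a whisker.
  have key2 : ∀ {C C' : Finset V}, IsMinVertexCover H C → IsMinVertexCover H C' →
      (∀ a, a ∉ Set.range w → (a ∈ C ↔ a ∈ C')) → ∀ a, a ∈ C → a ∈ C' := by
    intro C C' hC hC' key a ha
    by_cases haw : a ∈ Set.range w
    · obtain ⟨i, rfl⟩ := haw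
      obtain ⟨b, hb, rfl⟩ := hw.exists_notMem hC i
      have hbw : b ∉ Set.range w := fun hbw => hb (by rw [hw.eq_w hbw]; exact ha)
      exact hw.w_mem hC' (fun h => hb ((key b hbw).2 h)) hbw
    · exact (key a haw).1 ha
  ext a
  exact ⟨key2 hC hC' key a, key2 hC' hC (fun a ha => (key a ha).symm) a⟩

theorem whiskerAug_single (q : WhiskerBasis H w 0) (f : MvPolynomial V k) :
    whiskerAug k H w W (Finsupp.single q f) =
      f * monomial (∑ a ∈ q.cover, Finsupp.single a 1) 1 := by
  have hq : q.face = ∅ := Finset.card_eq_zero.1 q.admissible.2.2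
  rw [single_eq_smul_whiskerSymbol, map_smul, hq, whiskerAug_symbol q.admissible.1, smul_eq_mul,
    monomial_sum_one]
  rfl

/-- The generators of the span belong to the monomial basis over `k`, so every basis element
occurring in a combination is itself reduced. -/
theorem isReducedAt_of_mem_reducedSpan {T : Finset V} {n : ℕ}
    {z : WhiskerBasis H w n →₀ MvPolynomial V k} (hz : z ∈ reducedSpan k H w T n)
    (q : WhiskerBasis H w n) (m : V →₀ ℕ) (hm : coeff m (z q) ≠ 0) :
    IsReducedAt w T m q.cover q.face := by
  classical
  induction hz using Submodule.span_induction with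
  | mem x hx =>
    obtain ⟨m', C, σ, h, hr, rfl⟩ := hx
    rw [whiskerCell, whiskerSymbol_mk h, Finsupp.smul_single_one] at hm
    by_cases hq : WhiskerBasis.mk h = q
    · subst hq
      rw [Finsupp.single_eq_same] at hm
      rw [coeff_monomial] at hm
      split_ifs at hm with hmm
      · exact hmm ▸ hr
      · exact absurd rfl hm
    · rw [Finsupp.single_apply, if_neg hq] at hm
      exact absurd (coeff_zero m) hm
  | zero => exact absurd (coeff_zero m) hm
  | add x y _ _ hx hy =>
    rw [Finsupp.add_apply, coeff_add] at hm
    by_cases h0 : coeff m (x q) = 0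
    · exact hy (by simpa [h0] using hm)
    · exact hx h0
  | smul c x _ hx =>
    rw [Finsupp.smul_apply, coeff_smul] at hm
    exact hx fun h => hm (by simp [h])

/-- Distinct reduced cells have distinct monomials as augmentations, so nothing can cancel. -/
theorem eq_zero_of_mem_reducedSpan (hw : IsWhiskered H w col)
    {z : WhiskerBasis H w 0 →₀ MvPolynomial V k} (hz : z ∈ reducedSpan k H w Finset.univ 0)
    (hε : whiskerAug k H w W z = 0) : z = 0 := by
  by_contra hne
  obtain ⟨q, hq⟩ := Finsupp.ne_iff.1 hne
  obtain ⟨m, hm⟩ := MvPolynomial.ne_zero_iff.1 hq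
  have face0 : ∀ q : WhiskerBasis H w 0, q.face = ∅ := fun q =>
    Finset.card_eq_zero.1 q.admissible.2.2
  have e : whiskerAug k H w W z = z.sum fun q f =>
      f * monomial (∑ a ∈ q.cover, Finsupp.single a 1) (1 : k) := by
    conv_lhs => rw [← Finsupp.sum_single z]
    rw [Finsupp.sum, map_sum]
    exact Finset.sum_congr rfl fun q _ => whiskerAug_single q _
  have hc := congrArg (coeff (m + ∑ a ∈ q.cover, Finsupp.single a 1)) (e.symm.trans hε)
  rw [Finsupp.sum, coeff_sum, Finset.sum_eq_single q] at hc
  · rw [coeff_mul_monomial, mul_one, coeff_zero] at hc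
    exact hm hc
  · intro q' _ hqq'
    by_contra hne'
    rw [coeff_mul_monomial'] at hne'
    split_ifs at hne' with hle
    · rw [mul_one] at hne'
      have h1 := isReducedAt_of_mem_reducedSpan hz q m hm
      have h2 := isReducedAt_of_mem_reducedSpan hz q' _ hne'
      rw [face0] at h1 h2
      have := cover_eq_of_monomial_eq hw q.admissible.1 q'.admissible.1 h1 h2
        (tsub_add_cancel_of_le hle).symm
      exact hqq' (WhiskerBasis.ext' this.symm (by rw [face0, face0]))
    · exact hne' rfl
  · intro hq'
    rw [Finsupp.notMem_support_iff.1 hq', zero_mul, coeff_zero]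

theorem whiskerAug_ker (hw : IsWhiskered H w col)
    (hW : ∀ i a, a ∈ W i ↔ a ∉ Set.range w ∧ col a = i) :
    LinearMap.ker (whiskerAug k H w W) = LinearMap.range (whiskerD k H w W 0) := by
  refine le_antisymm ?_ (LinearMap.range_le_ker_iff.2 (whiskerAug_comp_whiskerD hw hW))
  intro z hz
  have key : ∀ T : Finset V, ∃ y, z - whiskerD k H w W 0 y ∈ reducedSpan k H w T 0 := by
    intro T
    induction T using Finset.induction_on with
    | empty => exact ⟨0, by rw [reducedSpan_empty]; trivial⟩
    | insert v T _ ih =>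
      obtain ⟨y, hy⟩ := ih
      by_cases hv : v ∈ Set.range w
      · exact ⟨y, reducedSpan_insert_range hv hy⟩
      · have := reduce_zero hw hW T hv hy
        rw [sub_sub, ← map_add] at this
        exact ⟨_, this⟩
  obtain ⟨y, hy⟩ := key Finset.univ
  have := eq_zero_of_mem_reducedSpan (W := W) hw hy (by
    rw [map_sub, LinearMap.mem_ker.1 hz, zero_sub, neg_eq_zero]
    exact LinearMap.congr_fun (whiskerAug_comp_whiskerD hw hW) y)
  exact ⟨y, (sub_eq_zero.1 this).symm⟩

/-- The monomial of any vertex cover is a multiple of the monomial of a minimal cover contained in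
it. -/
theorem whiskerAug_range :
    LinearMap.range (whiskerAug k H w W) = coverIdeal k H := by
  apply le_antisymm
  · rintro _ ⟨z, rfl⟩
    induction z using Finsupp.induction_linear with
    | zero => rw [map_zero]; exact zero_mem _
    | add f g hf hg => rw [map_add]; exact add_mem hf hg
    | single q f =>
      rw [whiskerAug_single, monomial_sum_one]
      exact Ideal.mul_mem_left _ _ (Ideal.subset_span ⟨q.cover, q.admissible.1.prop, rfl⟩)
  · rw [coverIdeal, Ideal.span_le]
    rintro _ ⟨C, hC, rfl⟩
    obtain ⟨D, hDC, hD⟩ := exists_isMinVertexCover_subset H hC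
    refine ⟨(∏ a ∈ C \ D, X a : MvPolynomial V k) • whiskerSymbol k H w 0 D ∅, ?_⟩
    rw [map_smul, whiskerAug_symbol hD, smul_eq_mul, Finset.prod_sdiff hDC]

theorem weight_single_one (e : V →₀ ℕ) :
    Finsupp.weight (fun a => (Finsupp.single a 1 : V →₀ ℕ)) e = e := by
  rw [Finsupp.weight_apply]
  simp [Finsupp.sum_single]

/-- In each term the coefficient is the variable that the symbol has lost: `a` disappears from `σ`,
and in the exchanged term it reappears in the cover in place of `w (col a)`. -/
theorem whiskerTerm_degree (hw : IsWhiskered H w col) {n : ℕ}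
    {C σ : Finset V} (h : IsMinVertexCover H C ∧ σ ⊆ whiskerFree w C ∧ σ.card = n + 1)
    {a : V} (ha : a ∈ σ) (q : WhiskerBasis H w n) (e : V →₀ ℕ)
    (he : coeff e (whiskerTerm k H w col n C σ a q) ≠ 0) :
    e + (∑ b ∈ q.cover, Finsupp.single b 1 + ∑ b ∈ q.face, Finsupp.single b 1) =
      ∑ b ∈ C, Finsupp.single b 1 + ∑ b ∈ σ, Finsupp.single b 1 := by
  have haw := (IsWhiskered.mem_whiskerFree w).1 (h.2.1 ha)
  rw [whiskerTerm, whiskerSymbol_mk (erase_admissible h ha),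
    whiskerSymbol_mk (swapCover_admissible hw h ha), Finsupp.sub_apply, Finsupp.smul_single_one,
    Finsupp.smul_single_one, coeff_sub] at he
  classical
  rw [← Finset.add_sum_erase σ _ ha]
  by_cases h1 : coeff e (Finsupp.single (WhiskerBasis.mk (erase_admissible h ha)) (X a) q :
      MvPolynomial V k) = 0
  · rw [h1, sub_zero] at he
    by_cases hq : WhiskerBasis.mk (swapCover_admissible hw h ha) = q
    · subst hq
      rw [Finsupp.single_eq_same, coeff_X] at he
      split_ifs at he with hx
      · subst hx
        rw [WhiskerBasis.cover_mk, WhiskerBasis.face_mk, swapCover,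
          Finset.sum_insert (by simp [haw.2]),
          ← Finset.add_sum_erase C _ (hw.w_mem h.1 haw.2 haw.1)]
        abel
      · exact absurd rfl he
    · rw [Finsupp.single_apply, if_neg hq] at he
      exact absurd (coeff_zero _) he
  · by_cases hq : WhiskerBasis.mk (erase_admissible h ha) = q
    · subst hq
      rw [Finsupp.single_eq_same, coeff_X] at h1
      split_ifs at h1 with hx
      · subst hx
        rw [WhiskerBasis.cover_mk, WhiskerBasis.face_mk]
        abel
      · exact absurd rfl h1
    · rw [Finsupp.single_apply, if_neg hq] at h1
      exact absurd (coeff_zero _) h1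

theorem whiskerAug_degree (q : WhiskerBasis H w 0) (e : V →₀ ℕ)
    (he : e ∈ (whiskerAug k H w W (Finsupp.single q 1)).support) :
    e = ∑ b ∈ q.cover, Finsupp.single b 1 + ∑ b ∈ q.face, Finsupp.single b 1 := by
  classical
  rw [whiskerAug_single, one_mul, mem_support_iff, coeff_monomial] at he
  rw [Finset.card_eq_zero.1 q.admissible.2.2, Finset.sum_empty, add_zero]
  by_contra hne
  exact he (if_neg (Ne.symm hne))

theorem whiskerD_degree (hw : IsWhiskered H w col)
    (hW : ∀ i a, a ∈ W i ↔ a ∉ Set.range w ∧ col a = i) (n : ℕ) (q : WhiskerBasis H w (n + 1))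
    (q' : WhiskerBasis H w n) (e : V →₀ ℕ)
    (he : e ∈ (whiskerD k H w W n (Finsupp.single q 1) q').support) :
    e + (∑ b ∈ q'.cover, Finsupp.single b 1 + ∑ b ∈ q'.face, Finsupp.single b 1) =
      ∑ b ∈ q.cover, Finsupp.single b 1 + ∑ b ∈ q.face, Finsupp.single b 1 := by
  rw [single_eq_smul_whiskerSymbol, one_smul, whiskerD_symbol hW q.admissible,
    Finsupp.finsetSum_apply, mem_support_iff, coeff_sum] at he
  obtain ⟨a, ha, hne⟩ := Finset.exists_ne_zero_of_sum_ne_zero he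
  rw [upperSign_smul, Finsupp.smul_apply, coeff_smul] at hne
  exact whiskerTerm_degree hw q.admissible ha q' e (right_ne_zero_of_smul hne)

theorem whiskerD_range_le (hW : ∀ i a, a ∈ W i ↔ a ∉ Set.range w ∧ col a = i) (n : ℕ) :
    LinearMap.range (whiskerD k H w W n) ≤
      Ideal.span (Set.range (X : V → MvPolynomial V k)) •
        (⊤ : Submodule (MvPolynomial V k) (WhiskerBasis H w n →₀ MvPolynomial V k)) := by
  rintro _ ⟨z, rfl⟩
  induction z using Finsupp.induction_linear with
  | zero => rw [map_zero]; exact zero_mem _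
  | add f g hf hg => rw [map_add]; exact add_mem hf hg
  | single q f =>
    rw [single_eq_smul_whiskerSymbol, map_smul, whiskerD_symbol hW q.admissible]
    refine Submodule.smul_mem _ _ (sum_mem fun a _ => Submodule.smul_mem _ _ (sub_mem ?_ ?_))
    · exact Submodule.smul_mem_smul (Ideal.subset_span ⟨_, rfl⟩) trivial
    · exact Submodule.smul_mem_smul (Ideal.subset_span ⟨_, rfl⟩) trivial

theorem whiskerComplex_isMinimalFreeResolution (hw : IsWhiskered H w col)
    (hW : ∀ i a, a ∈ W i ↔ a ∉ Set.range w ∧ col a = i) :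
    (whiskerComplex k H w W).IsMinimalFreeResolution
      (fun a => Finsupp.single a 1) (coverIdeal k H) where
  homogeneous_ε q e he := (weight_single_one e).trans (whiskerAug_degree (W := W) q e he)
  homogeneous_d i q q' e he := by
    rw [weight_single_one]
    exact whiskerD_degree hw hW i q q' e he
  range_ε := whiskerAug_range
  exact_zero := whiskerAug_ker hw hW
  exact_succ := whiskerD_range_succ hw hW
  minimal := whiskerD_range_le hW

end WhiskerExact

/-! ## Uniqueness of graded Betti numbers -/

section GradedPart

variable {k : Type u} [Field k] {V : Type u} {B B' B₀ B₀' : Type*}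

theorem linearMap_congr_single {N : Type*} [AddCommMonoid N] [Module k N]
    {f g : (B →₀ MvPolynomial V k) →ₗ[k] N}
    (h : ∀ q m, f (Finsupp.single q (monomial m 1)) = g (Finsupp.single q (monomial m 1)))
    (x : B →₀ MvPolynomial V k) : f x = g x := by
  refine LinearMap.congr_fun (Finsupp.lhom_ext' fun q => (basisMonomials V k).ext fun m => ?_) x
  simpa using h q m

/-- The degree `j` part of an element of a free module whose basis has degrees `deg`. -/
noncomputable def gradedPart (deg : B → ℤ) (j : ℤ) :
    (B →₀ MvPolynomial V k) →ₗ[k] (B →₀ MvPolynomial V k) :=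
  Finsupp.lsum k fun q => (Finsupp.lsingle q : MvPolynomial V k →ₗ[k] _) ∘ₗ
    weightedHomogeneousComponent (fun _ : V => (1 : ℤ)) (j - deg q)

theorem gradedPart_single (deg : B → ℤ) (j : ℤ) (q : B) (f : MvPolynomial V k) :
    gradedPart deg j (Finsupp.single q f) =
      Finsupp.single q (weightedHomogeneousComponent (fun _ : V => (1 : ℤ)) (j - deg q) f) := by
  rw [gradedPart, Finsupp.lsum_single]
  rfl

theorem gradedPart_single_monomial (deg : B → ℤ) (j : ℤ) (q : B) (m : V →₀ ℕ) (c : k) :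
    gradedPart deg j (Finsupp.single q (monomial m c)) =
      if Finsupp.weight (fun _ : V => (1 : ℤ)) m + deg q = j then
        Finsupp.single q (monomial m c) else 0 := by
  have hm := isWeightedHomogeneous_monomial (fun _ : V => (1 : ℤ)) m c (m := _) rfl
  rw [gradedPart_single]
  split_ifs with h
  · rw [← h, add_sub_cancel_right, hm.weightedHomogeneousComponent_same]
  · rw [hm.weightedHomogeneousComponent_ne, Finsupp.single_zero]
    intro e
    exact h (by rw [← e]; ring)

theorem gradedPart_apply (deg : B → ℤ) (j : ℤ) (x : B →₀ MvPolynomial V k) (q : B) :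
    gradedPart deg j x q =
      weightedHomogeneousComponent (fun _ : V => (1 : ℤ)) (j - deg q) (x q) := by
  classical
  induction x using Finsupp.induction_linear with
  | zero => simp
  | add f g hf hg => rw [map_add, Finsupp.add_apply, hf, hg, Finsupp.add_apply, map_add]
  | single q' f =>
    rw [gradedPart_single]
    by_cases h : q' = q
    · subst h; simp
    · rw [Finsupp.single_apply, if_neg h, Finsupp.single_apply, if_neg h, map_zero]

theorem gradedPart_eq_self_iff (deg : B → ℤ) (j : ℤ) (x : B →₀ MvPolynomial V k) :
    gradedPart deg j x = x ↔ ∀ q, ∀ e ∈ (x q).support,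
      Finsupp.weight (fun _ : V => (1 : ℤ)) e + deg q = j := by
  classical
  constructor
  · intro h q e he
    rw [← h, gradedPart_apply, mem_support_iff, coeff_weightedHomogeneousComponent] at he
    by_contra hne
    exact he (if_neg fun h' => hne (by rw [h']; ring))
  · intro h
    ext q e
    rw [gradedPart_apply, coeff_weightedHomogeneousComponent]
    split_ifs with h'
    · rfl
    · by_contra hne
      exact h' (by rw [← h q e (mem_support_iff.2 (Ne.symm hne))]; ring)

theorem gradedPart_gradedPart (deg : B → ℤ) (j j' : ℤ) (x : B →₀ MvPolynomial V k) :
    gradedPart deg j (gradedPart deg j' x) = if j = j' then gradedPart deg j x else 0 := by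
  split_ifs with h
  · subst h
    refine linearMap_congr_single (f := gradedPart deg j ∘ₗ gradedPart deg j) (fun q m => ?_) x
    rw [LinearMap.comp_apply, gradedPart_single_monomial]
    split_ifs with h
    · rw [gradedPart_single_monomial, if_pos h]
    · exact map_zero _
  · refine linearMap_congr_single (f := gradedPart deg j ∘ₗ gradedPart deg j') (g := 0)
      (fun q m => ?_) x
    rw [LinearMap.comp_apply, gradedPart_single_monomial]
    split_ifs with h'
    · rw [gradedPart_single_monomial, if_neg (fun e => h (e.symm.trans h'))]; rfl
    · exact map_zero _

theorem gradedPart_monomial_smul (deg : B → ℤ) (j : ℤ) (m : V →₀ ℕ) (c : k)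
    (x : B →₀ MvPolynomial V k) :
    gradedPart deg j (monomial m c • x) =
      monomial m c • gradedPart deg (j - Finsupp.weight (fun _ : V => (1 : ℤ)) m) x := by
  induction x using Finsupp.induction_linear with
  | zero => simp only [smul_zero, map_zero]
  | add f g hf hg => rw [smul_add, map_add, hf, hg, map_add, smul_add]
  | single q f =>
    induction f using MvPolynomial.induction_on' with
    | add f g hf hg => rw [Finsupp.single_add, smul_add, map_add, hf, hg, map_add, smul_add]
    | monomial m' c' =>
      rw [Finsupp.smul_single, smul_eq_mul, monomial_mul, gradedPart_single_monomial,
        gradedPart_single_monomial, map_add]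
      split_ifs with h1 h2 h2
      · rw [Finsupp.smul_single, smul_eq_mul, monomial_mul]
      · exact absurd (by rw [← h1]; ring) h2
      · exact absurd (by rw [add_assoc, h2]; ring) h1
      · rw [smul_zero]

theorem gradedPart_single_one (deg : B → ℤ) (q : B) :
    gradedPart deg (deg q) (Finsupp.single q (1 : MvPolynomial V k)) = Finsupp.single q 1 := by
  have : (1 : MvPolynomial V k) = monomial 0 1 := rfl
  rw [this, gradedPart_single_monomial, if_pos (by simp)]

/-- A linear map that preserves degrees. -/
def IsGradedMap (deg : B → ℤ) (deg' : B' → ℤ)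
    (φ : (B →₀ MvPolynomial V k) →ₗ[MvPolynomial V k] (B' →₀ MvPolynomial V k)) : Prop :=
  ∀ j x, φ (gradedPart deg j x) = gradedPart deg' j (φ x)

/-- Multiplication by a monomial shifts all degrees equally, so homogeneity of the images of basis
vectors is enough. -/
theorem isGradedMap_of_single {deg : B → ℤ} {deg' : B' → ℤ}
    {φ : (B →₀ MvPolynomial V k) →ₗ[MvPolynomial V k] (B' →₀ MvPolynomial V k)}
    (h : ∀ q, gradedPart deg' (deg q) (φ (Finsupp.single q 1)) = φ (Finsupp.single q 1)) :
    IsGradedMap deg deg' φ := by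
  intro j x
  refine linearMap_congr_single (f := φ.restrictScalars k ∘ₗ gradedPart deg j)
    (g := gradedPart deg' j ∘ₗ φ.restrictScalars k) (fun q m => ?_) x
  have e : Finsupp.single q (monomial m (1 : k)) =
      monomial m (1 : k) • Finsupp.single q (1 : MvPolynomial V k) := by
    rw [Finsupp.smul_single_one]
  simp only [LinearMap.comp_apply, LinearMap.coe_restrictScalars]
  rw [gradedPart_single_monomial, e, map_smul, gradedPart_monomial_smul, ← h q,
    gradedPart_gradedPart]
  split_ifs with h1 h2 h2
  · rw [map_smul, h2, h q]
  · exact absurd (by rw [← h1]; ring) h2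
  · exact absurd (by rw [← h2]; ring) h1
  · rw [smul_zero, map_zero]

theorem IsGradedMap.comp {deg : B → ℤ} {deg' : B' → ℤ} {deg₀ : B₀ → ℤ}
    {φ : (B →₀ MvPolynomial V k) →ₗ[MvPolynomial V k] (B' →₀ MvPolynomial V k)}
    {ψ : (B' →₀ MvPolynomial V k) →ₗ[MvPolynomial V k] (B₀ →₀ MvPolynomial V k)}
    (hψ : IsGradedMap deg' deg₀ ψ) (hφ : IsGradedMap deg deg' φ) :
    IsGradedMap deg deg₀ (ψ ∘ₗ φ) := fun j x => by
  rw [LinearMap.comp_apply, hφ, hψ]; rfl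

theorem IsGradedMap.symm {deg : B → ℤ} {deg' : B' → ℤ}
    {φ : (B →₀ MvPolynomial V k) ≃ₗ[MvPolynomial V k] (B' →₀ MvPolynomial V k)}
    (hφ : IsGradedMap deg deg' φ.toLinearMap) : IsGradedMap deg' deg φ.symm.toLinearMap :=
  fun j x => by
    have := hφ j (φ.symm x)
    simp only [LinearEquiv.coe_coe, LinearEquiv.apply_symm_apply] at this
    simp only [LinearEquiv.coe_coe, ← this, LinearEquiv.symm_apply_apply]

theorem weight_one_pos {e : V →₀ ℕ} (he : e ≠ 0) :
    0 < Finsupp.weight (fun _ : V => (1 : ℤ)) e := by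
  rw [Finsupp.weight_apply, Finsupp.sum]
  refine Finset.sum_pos (fun i hi => ?_) (Finsupp.support_nonempty_iff.2 he)
  have := Finsupp.mem_support_iff.1 hi
  simp only [nsmul_eq_mul, mul_one]
  omega

variable (k V) in
/-- The ideal generated by the variables. -/
noncomputable abbrev variableIdeal : Ideal (MvPolynomial V k) :=
  Ideal.span (Set.range (X : V → MvPolynomial V k))

theorem constantCoeff_of_mem_variableIdeal {f : MvPolynomial V k} (hf : f ∈ variableIdeal k V) :
    constantCoeff f = 0 := by
  have : variableIdeal k V ≤ RingHom.ker (constantCoeff (R := k) (σ := V)) := by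
    rw [variableIdeal, Ideal.span_le]
    rintro _ ⟨a, rfl⟩
    simp [RingHom.mem_ker]
  exact this hf

theorem constantCoeff_apply_of_mem_smul_top {x : B →₀ MvPolynomial V k}
    (hx : x ∈ variableIdeal k V • (⊤ : Submodule (MvPolynomial V k) (B →₀ MvPolynomial V k)))
    (q : B) : constantCoeff (x q) = 0 := by
  induction hx using Submodule.smul_induction_on' with
  | smul r hr n _ =>
    rw [Finsupp.smul_apply, smul_eq_mul, map_mul, constantCoeff_of_mem_variableIdeal hr, zero_mul]
  | add x _ y _ hx hy => rw [Finsupp.add_apply, map_add, hx, hy, add_zero]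

/-- A graded endomorphism that is the identity modulo the variables is bijective. -/
theorem IsGradedMap.bijective [Finite B] {deg : B → ℤ}
    {φ : (B →₀ MvPolynomial V k) →ₗ[MvPolynomial V k] (B →₀ MvPolynomial V k)}
    (hφ : IsGradedMap deg deg φ)
    (h : ∀ x, φ x - x ∈ variableIdeal k V •
      (⊤ : Submodule (MvPolynomial V k) (B →₀ MvPolynomial V k))) : Function.Bijective φ := by
  have hs : Function.Surjective φ := by
    rw [← LinearMap.range_eq_top, eq_top_iff]
    have key : ∀ q, Finsupp.single q 1 ∈ LinearMap.range φ := by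
      have wf : WellFounded fun q q' : B => deg q < deg q' := by
        have : IsStrictOrder B (fun q q' : B => deg q < deg q') :=
          { irrefl := fun _ => lt_irrefl _
            trans := fun _ _ _ => lt_trans }
        exact Finite.wellFounded_of_trans_of_irrefl _
      intro q
      induction q using wf.induction with
      | _ q ih =>
      -- The error $\varphi(e_q)-e_q$ is homogeneous of degree `deg q` with coefficients without
      -- constant term, so only basis vectors of smaller degree occur in it.
      have e1 : gradedPart deg (deg q) (φ (Finsupp.single q 1) - Finsupp.single q 1) =
          φ (Finsupp.single q 1) - Finsupp.single q 1 := by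
        rw [map_sub, gradedPart_single_one, ← hφ, gradedPart_single_one]
      rw [gradedPart_eq_self_iff] at e1
      have hm := h (Finsupp.single q 1)
      generalize hy : φ (Finsupp.single q 1) - Finsupp.single q 1 = y at e1 hm
      have e2 : Finsupp.single q 1 = φ (Finsupp.single q 1) - y := by rw [← hy]; abel
      rw [e2]
      refine sub_mem ⟨_, rfl⟩ ?_
      rw [← Finsupp.sum_single y]
      refine sum_mem fun q' hq' => ?_
      rw [← Finsupp.smul_single_one]
      refine Submodule.smul_mem _ _ (ih q' ?_)
      obtain ⟨e, he⟩ := MvPolynomial.ne_zero_iff.1 (Finsupp.mem_support_iff.1 hq')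
      have h1 := e1 q' e (mem_support_iff.2 he)
      have h2 : e ≠ 0 := by
        rintro rfl
        exact he (constantCoeff_apply_of_mem_smul_top hm q')
      have := weight_one_pos h2
      omega
    rintro x -
    rw [← Finsupp.sum_single x]
    refine sum_mem fun q _ => ?_
    rw [← Finsupp.smul_single_one]
    exact Submodule.smul_mem _ _ (key q)
  exact ⟨OrzechProperty.injective_of_surjective_endomorphism φ hs, hs⟩

/-- Lifting of graded maps from a free module. -/
theorem IsGradedMap.exists_lift {deg : B → ℤ} {deg' : B' → ℤ} {deg₀ : B₀ → ℤ}
    {φ : (B →₀ MvPolynomial V k) →ₗ[MvPolynomial V k] (B₀ →₀ MvPolynomial V k)}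
    {d : (B' →₀ MvPolynomial V k) →ₗ[MvPolynomial V k] (B₀ →₀ MvPolynomial V k)}
    (hφ : IsGradedMap deg deg₀ φ) (hd : IsGradedMap deg' deg₀ d)
    (h : LinearMap.range φ ≤ LinearMap.range d) :
    ∃ ψ : (B →₀ MvPolynomial V k) →ₗ[MvPolynomial V k] (B' →₀ MvPolynomial V k),
      IsGradedMap deg deg' ψ ∧ d ∘ₗ ψ = φ := by
  have : ∀ q, ∃ y, gradedPart deg' (deg q) y = y ∧ d y = φ (Finsupp.single q 1) := by
    intro q
    obtain ⟨y, hy⟩ := h ⟨Finsupp.single q 1, rfl⟩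
    -- Any preimage may be replaced by its homogeneous part of the required degree.
    refine ⟨gradedPart deg' (deg q) y, ?_, ?_⟩
    · rw [gradedPart_gradedPart, if_pos rfl]
    · rw [hd, hy, ← hφ, gradedPart_single_one]
  choose y hy hdy using this
  refine ⟨Finsupp.linearCombination _ y, isGradedMap_of_single fun q => ?_, ?_⟩
  · rw [Finsupp.linearCombination_single, one_smul, hy]
  · refine Finsupp.lhom_ext fun q f => ?_
    rw [LinearMap.comp_apply, Finsupp.linearCombination_single, map_smul, hdy, ← map_smul,
      Finsupp.smul_single_one]

/-- Lift `θ` and its inverse to `φ` and `ψ`. The composites differ from the identity by maps into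
the kernels, hence into the variables times the free module, so they are bijective. That `φ` matches
the kernels lets the comparison continue one step further along a resolution. -/
theorem exists_gradedEquiv [Finite B] [Finite B'] {deg : B → ℤ} {deg' : B' → ℤ} {deg₀ : B₀ → ℤ}
    {deg₀' : B₀' → ℤ}
    {d : (B →₀ MvPolynomial V k) →ₗ[MvPolynomial V k] (B₀ →₀ MvPolynomial V k)}
    {d' : (B' →₀ MvPolynomial V k) →ₗ[MvPolynomial V k] (B₀' →₀ MvPolynomial V k)}
    (hd : IsGradedMap deg deg₀ d) (hd' : IsGradedMap deg' deg₀' d')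
    (hm : LinearMap.ker d ≤ variableIdeal k V • ⊤) (hm' : LinearMap.ker d' ≤ variableIdeal k V • ⊤)
    (θ : (B₀ →₀ MvPolynomial V k) ≃ₗ[MvPolynomial V k] (B₀' →₀ MvPolynomial V k))
    (hθ : IsGradedMap deg₀ deg₀' θ.toLinearMap)
    (h : (LinearMap.range d).map θ.toLinearMap = LinearMap.range d') :
    ∃ φ : (B →₀ MvPolynomial V k) ≃ₗ[MvPolynomial V k] (B' →₀ MvPolynomial V k),
      IsGradedMap deg deg' φ.toLinearMap ∧
        (LinearMap.ker d).map φ.toLinearMap = LinearMap.ker d' := by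
  obtain ⟨φ, hφ, hφd⟩ := (hθ.comp hd).exists_lift hd' (by rw [LinearMap.range_comp, h])
  obtain ⟨ψ, hψ, hψd⟩ := (hθ.symm.comp hd').exists_lift hd (by
    rw [LinearMap.range_comp, ← h, ← Submodule.map_comp]
    simp)
  have h1 : ∀ x, d' (φ x) = θ (d x) := LinearMap.congr_fun hφd
  have h2 : ∀ x, d (ψ x) = θ.symm (d' x) := LinearMap.congr_fun hψd
  have b1 := (hψ.comp hφ).bijective (fun x => hm (by
    simp [LinearMap.mem_ker, h1, h2]))
  have b2 := (hφ.comp hψ).bijective (fun x => hm' (by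
    simp [LinearMap.mem_ker, h1, h2]))
  have b : Function.Bijective φ := by
    rw [LinearMap.coe_comp] at b1 b2
    exact ⟨b1.1.of_comp, b2.2.of_comp⟩
  refine ⟨LinearEquiv.ofBijective φ b, hφ, ?_⟩
  ext y
  constructor
  · rintro ⟨x, hx, rfl⟩
    change d' (φ x) = 0
    rw [h1, LinearMap.mem_ker.1 hx, map_zero]
  · intro hy
    obtain ⟨x, rfl⟩ := b.2 y
    refine ⟨x, ?_, rfl⟩
    have := h1 x
    rw [LinearMap.mem_ker.1 hy] at this
    exact (LinearEquiv.map_eq_zero_iff θ).1 this.symm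

/-- The map of vector spaces obtained by setting the variables to zero. -/
noncomputable def reductionMap
    (φ : (B →₀ MvPolynomial V k) →ₗ[MvPolynomial V k] (B' →₀ MvPolynomial V k)) :
    (B →₀ k) →ₗ[k] (B' →₀ k) :=
  Finsupp.linearCombination k fun q =>
    (φ (Finsupp.single q 1)).mapRange constantCoeff (map_zero _)

theorem reductionMap_mapRange
    (φ : (B →₀ MvPolynomial V k) →ₗ[MvPolynomial V k] (B' →₀ MvPolynomial V k))
    (x : B →₀ MvPolynomial V k) :
    reductionMap φ (x.mapRange constantCoeff (map_zero _)) =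
      (φ x).mapRange constantCoeff (map_zero _) := by
  induction x using Finsupp.induction_linear with
  | zero => simp
  | add f g hf hg =>
    rw [Finsupp.mapRange_add (map_add _), map_add, hf, hg, map_add, Finsupp.mapRange_add (map_add _)]
  | single q f =>
    rw [Finsupp.mapRange_single, reductionMap, Finsupp.linearCombination_single,
      ← Finsupp.smul_single_one q f, map_smul]
    ext q'
    simp

/-- With the variables set to zero the map stays injective, since its inverse reduces as well; and a
nonzero constant coefficient joins only basis vectors of the same degree. -/
theorem card_degree_le_of_gradedEquiv [Finite B] [Finite B'] {deg : B → ℤ} {deg' : B' → ℤ}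
    (φ : (B →₀ MvPolynomial V k) ≃ₗ[MvPolynomial V k] (B' →₀ MvPolynomial V k))
    (hφ : IsGradedMap deg deg' φ.toLinearMap) (j : ℤ) :
    Nat.card {q // deg q = j} ≤ Nat.card {q // deg' q = j} := by
  have hinj : Function.Injective (reductionMap φ.toLinearMap) := by
    refine Function.LeftInverse.injective (g := reductionMap φ.symm.toLinearMap) fun x => ?_
    have e : x = (x.mapRange C (map_zero _) : B →₀ MvPolynomial V k).mapRange constantCoeff
        (map_zero _) := by
      ext q; simp
    rw [e, reductionMap_mapRange, reductionMap_mapRange]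
    simp
  have hmap : ∀ x ∈ Finsupp.supported k k {q | deg q = j},
      reductionMap φ.toLinearMap x ∈ Finsupp.supported k k {q | deg' q = j} := by
    intro x hx
    rw [reductionMap, Finsupp.linearCombination_apply]
    refine sum_mem fun q hq => Submodule.smul_mem _ _ ?_
    have hq' : deg q = j := hx hq
    rw [Finsupp.mem_supported']
    intro q' hq''
    rw [Finsupp.mapRange_apply]
    by_contra hne
    have := hφ (deg q) (Finsupp.single q 1)
    rw [gradedPart_single_one] at this
    have := (gradedPart_eq_self_iff _ _ _).1 this.symm q' 0 (mem_support_iff.2 hne)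
    rw [map_zero, zero_add, hq'] at this
    exact hq'' this
  have : Fintype B := Fintype.ofFinite B
  have : Fintype B' := Fintype.ofFinite B'
  have hle := LinearMap.finrank_le_finrank_of_injective
    (f := (reductionMap φ.toLinearMap).restrict hmap) (fun x y hxy => by
      exact Subtype.ext (hinj (congrArg Subtype.val hxy)))
  rw [(Finsupp.supportedEquivFinsupp _).finrank_eq, (Finsupp.supportedEquivFinsupp _).finrank_eq,
    Module.finrank_finsupp_self, Module.finrank_finsupp_self, ← Nat.card_eq_fintype_card,
    ← Nat.card_eq_fintype_card] at hle
  exact hle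

theorem card_degree_eq_of_gradedEquiv [Finite B] [Finite B'] {deg : B → ℤ} {deg' : B' → ℤ}
    (φ : (B →₀ MvPolynomial V k) ≃ₗ[MvPolynomial V k] (B' →₀ MvPolynomial V k))
    (hφ : IsGradedMap deg deg' φ.toLinearMap) (j : ℤ) :
    Nat.card {q // deg q = j} = Nat.card {q // deg' q = j} :=
  (card_degree_le_of_gradedEquiv φ hφ j).antisymm
    (card_degree_le_of_gradedEquiv φ.symm hφ.symm j)

end GradedPart

namespace GradedFreeComplex.IsMinimalFreeResolution

variable {k : Type u} [Field k] {V : Type u} {J : Ideal (MvPolynomial V k)}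
  {F F' : GradedFreeComplex k V ℤ}

theorem isGradedMap_d (hF : F.IsMinimalFreeResolution (fun _ => 1) J) (i : ℕ) :
    IsGradedMap (F.deg (i + 1)) (F.deg i) (F.d i) :=
  isGradedMap_of_single fun q => (gradedPart_eq_self_iff _ _ _).2 fun q' e he =>
    hF.homogeneous_d i q q' e he

/-- The augmentation with values in a free module of rank one. -/
noncomputable def augmentation (F : GradedFreeComplex k V ℤ) :
    (F.B 0 →₀ MvPolynomial V k) →ₗ[MvPolynomial V k] (PUnit.{u + 1} →₀ MvPolynomial V k) :=
  Finsupp.lsingle PUnit.unit ∘ₗ F.ε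

theorem ker_augmentation : LinearMap.ker (augmentation F) = LinearMap.ker F.ε := by
  rw [augmentation, LinearMap.ker_comp_of_ker_eq_bot _ (Finsupp.ker_lsingle _)]

theorem isGradedMap_augmentation (hF : F.IsMinimalFreeResolution (fun _ => 1) J) :
    IsGradedMap (F.deg 0) (fun _ => 0) (augmentation F) :=
  isGradedMap_of_single fun q => (gradedPart_eq_self_iff _ _ _).2 fun q' e he => by
    rw [add_zero]
    refine hF.homogeneous_ε q e ?_
    simpa [augmentation] using he

/-- Induction along the resolution. The start compares the two augmentations, which have the same
range `J`, regarded inside a free module of rank one. -/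
theorem exists_gradedEquiv (hF : F.IsMinimalFreeResolution (fun _ => 1) J)
    (hF' : F'.IsMinimalFreeResolution (fun _ => 1) J) (i : ℕ) :
    ∃ φ : (F.B i →₀ MvPolynomial V k) ≃ₗ[MvPolynomial V k] (F'.B i →₀ MvPolynomial V k),
      IsGradedMap (F.deg i) (F'.deg i) φ.toLinearMap ∧
        (LinearMap.range (F.d i)).map φ.toLinearMap = LinearMap.range (F'.d i) := by
  have := F.finite
  have := F'.finite
  induction i with
  | zero =>
    rw [← hF.exact_zero, ← hF'.exact_zero, ← ker_augmentation, ← ker_augmentation]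
    refine _root_.exists_gradedEquiv (isGradedMap_augmentation hF) (isGradedMap_augmentation hF')
      ?_ ?_ (LinearEquiv.refl _ _) (fun _ _ => rfl) ?_
    · rw [ker_augmentation, hF.exact_zero]; exact hF.minimal 0
    · rw [ker_augmentation, hF'.exact_zero]; exact hF'.minimal 0
    · rw [augmentation, augmentation, LinearMap.range_comp, LinearMap.range_comp, hF.range_ε,
        hF'.range_ε]
      exact Submodule.map_id _
  | succ i ih =>
    obtain ⟨θ, hθ, hr⟩ := ih
    rw [← hF.exact_succ, ← hF'.exact_succ]
    refine _root_.exists_gradedEquiv (hF.isGradedMap_d i) (hF'.isGradedMap_d i) ?_ ?_ θ hθ hr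
    · rw [hF.exact_succ]; exact hF.minimal _
    · rw [hF'.exact_succ]; exact hF'.minimal _

/-- The definition counts in a chosen resolution; the comparison of minimal resolutions makes the
choice immaterial. -/
theorem gradedBettiNumber_eq (hF : F.IsMinimalFreeResolution (fun _ => 1) J) (i : ℕ) (j : ℤ) :
    gradedBettiNumber J i j = Nat.card {q // F.deg i q = j} := by
  have hex : ∃ F : GradedFreeComplex k V ℤ, F.IsMinimalFreeResolution (fun _ => 1) J := ⟨F, hF⟩
  rw [gradedBettiNumber, dif_pos hex]
  have := F.finite i
  have := hex.choose.finite i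
  obtain ⟨φ, hφ, -⟩ := exists_gradedEquiv hex.choose_spec hF i
  exact card_degree_eq_of_gradedEquiv φ hφ j

/-- Coarsening of the grading. -/
theorem map_degree {Γ Γ' : Type*} [AddCommMonoid Γ] [AddCommMonoid Γ']
    {F : GradedFreeComplex k V Γ} {wt : V → Γ} (hF : F.IsMinimalFreeResolution wt J)
    (g : Γ →+ Γ') : (GradedFreeComplex.mk F.B F.finite (fun i q => g (F.deg i q)) F.ε
      F.d).IsMinimalFreeResolution (fun a => g (wt a)) J := by
  have hg : ∀ e : V →₀ ℕ, Finsupp.weight (fun a => g (wt a)) e = g (Finsupp.weight wt e) := by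
    intro e
    rw [Finsupp.weight_apply, Finsupp.weight_apply, map_finsuppSum]
    simp
  exact
  { homogeneous_ε := fun q e he => by rw [hg, hF.homogeneous_ε q e he]
    homogeneous_d := fun i q q' e he => by
      rw [hg, ← map_add, hF.homogeneous_d i q q' e he]
    range_ε := hF.range_ε
    exact_zero := hF.exact_zero
    exact_succ := hF.exact_succ
    minimal := hF.minimal }

end GradedFreeComplex.IsMinimalFreeResolution

/-! ## Projective dimension -/

namespace GradedFreeComplex.IsMinimalFreeResolution

open CategoryTheory

variable {k : Type u} [Field k] {V : Type u} {J : Ideal (MvPolynomial V k)} {Γ : Type v}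
  [AddCommMonoid Γ] {F : GradedFreeComplex k V Γ} {wt : V → Γ}

/-- Dimension shifting along $0\to\ker f\to M\to\operatorname{range} f\to 0$. Kernel and range are
passed as separate submodules so that the exactness of a resolution can be plugged in. -/
theorem hasProjectiveDimensionLT_range_iff {R M N : Type u} [CommRing R] [AddCommGroup M]
    [Module R M] [AddCommGroup N] [Module R N] [Module.Free R M] (f : M →ₗ[R] N)
    {K : Submodule R M} (hK : LinearMap.ker f = K) {L : Submodule R N}
    (hL : LinearMap.range f = L) (n : ℕ) :
    HasProjectiveDimensionLT (ModuleCat.of R L) (n + 2) ↔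
      HasProjectiveDimensionLT (ModuleCat.of R K) (n + 1) := by
  subst hK hL
  have hS := LinearMap.shortExact_shortComplexKer (f := f.rangeRestrict) f.surjective_rangeRestrict
  have hp : Projective (ModuleCat.of R M) := ModuleCat.projective_of_free (Module.Free.chooseBasis R M)
  have e := hS.hasProjectiveDimensionLT_X₃_iff n hp
  rw [← LinearMap.ker_rangeRestrict f]
  exact e

theorem hasProjectiveDimensionLT_one_iff {R L : Type u} [CommRing R] [AddCommGroup L]
    [Module R L] : HasProjectiveDimensionLT (ModuleCat.of R L) 1 ↔ Module.Projective R L := by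
  rw [← projective_iff_hasProjectiveDimensionLT_one, ← IsProjective.iff_projective]

theorem projective_range_of_ker_eq_bot {R M N : Type*} [CommRing R] [AddCommGroup M]
    [Module R M] [AddCommGroup N] [Module R N] [Module.Projective R M] (f : M →ₗ[R] N)
    (hK : LinearMap.ker f = ⊥) {L : Submodule R N} (hL : LinearMap.range f = L) :
    Module.Projective R L := by
  subst hL
  exact Module.Projective.of_equiv (LinearEquiv.ofInjective f (LinearMap.ker_eq_bot.1 hK))

/-- A splitting yields a projection onto $K=\ker f$. Applied to $K\subseteq\mathfrak mF$ it gives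
$K\subseteq\mathfrak mK$, so $K$ is killed by some $r\equiv 1$ modulo $\mathfrak m$. Since $r\ne 0$
and $F$ is torsion-free, $K=0$. -/
theorem ker_eq_bot_of_projective_range [Finite V] {B N : Type*} [Finite B] [AddCommGroup N]
    [Module (MvPolynomial V k) N]
    (f : (B →₀ MvPolynomial V k) →ₗ[MvPolynomial V k] N)
    (hK : LinearMap.ker f ≤ variableIdeal k V • ⊤) {L : Submodule (MvPolynomial V k) N}
    (hL : LinearMap.range f = L) (hP : Module.Projective (MvPolynomial V k) L) :
    LinearMap.ker f = ⊥ := by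
  subst hL
  obtain ⟨s, hs⟩ := Module.projective_lifting_property f.rangeRestrict LinearMap.id
    f.surjective_rangeRestrict
  have hs' : ∀ y, f (s y) = y := fun y => congrArg Subtype.val (LinearMap.congr_fun hs y)
  let p : (B →₀ MvPolynomial V k) →ₗ[MvPolynomial V k] (B →₀ MvPolynomial V k) :=
    LinearMap.id - s ∘ₗ f.rangeRestrict
  have hp : ∀ x, p x ∈ LinearMap.ker f := fun x => by
    simp only [p, LinearMap.mem_ker, LinearMap.sub_apply, LinearMap.id_apply, LinearMap.comp_apply,
      map_sub, hs']
    exact sub_self _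
  have hpk : ∀ x ∈ LinearMap.ker f, p x = x := fun x hx => by
    have : f.rangeRestrict x = 0 := Subtype.ext hx
    simp [p, this]
  have hle : LinearMap.ker f ≤ variableIdeal k V • LinearMap.ker f := by
    intro x hx
    have h1 : p x ∈ (variableIdeal k V • (⊤ : Submodule _ (B →₀ MvPolynomial V k))).map p :=
      ⟨x, hK hx, rfl⟩
    rw [hpk x hx, Submodule.map_smul''] at h1
    refine Submodule.smul_mono le_rfl ?_ h1
    rintro _ ⟨y, -, rfl⟩
    exact hp y
  obtain ⟨r, hr, hr'⟩ := Submodule.exists_sub_one_mem_and_smul_eq_zero_of_fg_of_le_smul _ _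
    (IsNoetherian.noetherian (LinearMap.ker f)) hle
  have hr0 : r ≠ 0 := by
    rintro rfl
    have := constantCoeff_of_mem_variableIdeal hr
    simp at this
  rw [eq_bot_iff]
  intro x hx
  exact (smul_eq_zero.1 (hr' x hx)).resolve_left hr0

/-- If `f` vanishes, every basis vector lies in the kernel, but none lies in the variables times the
free module. -/
theorem isEmpty_of_ker_eq_top {B N : Type*} [AddCommGroup N]
    [Module (MvPolynomial V k) N] {f : (B →₀ MvPolynomial V k) →ₗ[MvPolynomial V k] N}
    (hK : LinearMap.ker f ≤ variableIdeal k V • ⊤) (hf : LinearMap.range f = ⊥) : IsEmpty B := by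
  refine ⟨fun q => ?_⟩
  have h : Finsupp.single q 1 ∈ LinearMap.ker f := by
    rw [LinearMap.range_eq_bot.1 hf]; rfl
  have := constantCoeff_apply_of_mem_smul_top (hK h) q
  simp at this

theorem hasProjectiveDimensionLT_iff_range (hF : F.IsMinimalFreeResolution wt J) (i n : ℕ) :
    HasProjectiveDimensionLT (ModuleCat.of (MvPolynomial V k) J) (n + i + 2) ↔
      HasProjectiveDimensionLT (ModuleCat.of (MvPolynomial V k) (LinearMap.range (F.d i)))
        (n + 1) := by
  induction i generalizing n with
  | zero => exact hasProjectiveDimensionLT_range_iff F.ε hF.exact_zero hF.range_ε n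
  | succ i ih =>
    rw [← hasProjectiveDimensionLT_range_iff (F.d i) (hF.exact_succ i) rfl n, ← ih (n + 1),
      show n + (i + 1) + 2 = n + 1 + i + 2 by ring]

theorem hasProjectiveDimensionLT_succ (hF : F.IsMinimalFreeResolution wt J) {n : ℕ}
    (hn : IsEmpty (F.B (n + 1))) :
    HasProjectiveDimensionLT (ModuleCat.of (MvPolynomial V k) J) (n + 1) := by
  have hd : LinearMap.range (F.d n) = ⊥ := by
    rw [LinearMap.range_eq_bot]
    exact Subsingleton.elim _ _
  cases n with
  | zero =>
    rw [hasProjectiveDimensionLT_one_iff]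
    exact projective_range_of_ker_eq_bot F.ε (hF.exact_zero.trans hd) hF.range_ε
  | succ i =>
    have := (hF.hasProjectiveDimensionLT_iff_range i 0).2 (hasProjectiveDimensionLT_one_iff.2
      (projective_range_of_ker_eq_bot (F.d i) ((hF.exact_succ i).trans hd) rfl))
    rwa [zero_add] at this

/-- Otherwise the image of $d_{n-2}$ would be projective, so by minimality its kernel, the image of
$d_{n-1}$, would be zero and $F_n$ would have an empty basis. For $n\le 1$ the same argument runs
with `J` and the augmentation. -/
theorem not_hasProjectiveDimensionLT [Finite V] (hF : F.IsMinimalFreeResolution wt J) {n : ℕ}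
    (hn : Nonempty (F.B n)) :
    ¬ HasProjectiveDimensionLT (ModuleCat.of (MvPolynomial V k) J) n := by
  intro h
  have := F.finite
  have hd : ∀ i, LinearMap.range (F.d i) = ⊥ → IsEmpty (F.B (i + 1)) := fun i hi =>
    isEmpty_of_ker_eq_top (by rw [hF.exact_succ]; exact hF.minimal (i + 1)) hi
  match n with
  | 0 =>
    have h0 := (hasProjectiveDimensionLT_zero_iff_isZero _).1 h
    rw [ModuleCat.isZero_of_iff_subsingleton] at h0
    have : LinearMap.range F.ε = ⊥ := by
      rw [hF.range_ε]
      exact Submodule.eq_bot_of_subsingleton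
    exact (isEmpty_of_ker_eq_top (by rw [hF.exact_zero]; exact hF.minimal 0) this).false hn.some
  | 1 =>
    rw [hasProjectiveDimensionLT_one_iff] at h
    have := ker_eq_bot_of_projective_range F.ε (by rw [hF.exact_zero]; exact hF.minimal 0)
      hF.range_ε h
    rw [hF.exact_zero] at this
    exact (hd 0 this).false hn.some
  | i + 2 =>
    have h' := (hF.hasProjectiveDimensionLT_iff_range i 0).1 (by rwa [zero_add])
    rw [hasProjectiveDimensionLT_one_iff] at h'
    have := ker_eq_bot_of_projective_range (F.d i) (by rw [hF.exact_succ]; exact hF.minimal _)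
      rfl h'
    rw [hF.exact_succ] at this
    exact (hd _ this).false hn.some

theorem projectiveDimension_eq [Finite V] (hF : F.IsMinimalFreeResolution wt J) {n : ℕ}
    (hn : Nonempty (F.B n)) (hn' : IsEmpty (F.B (n + 1))) :
    projectiveDimension (ModuleCat.of (MvPolynomial V k) J) = (n : WithBot ℕ∞) :=
  le_antisymm ((projectiveDimension_le_iff _ _).2 (hF.hasProjectiveDimensionLT_succ hn'))
    ((projectiveDimension_ge_iff _ _).2 (hF.not_hasProjectiveDimensionLT hn))

end GradedFreeComplex.IsMinimalFreeResolution

/-! ### Betti numbers and projective dimension of the cover ideal. -/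

section WhiskerBetti

variable {k : Type u} [Field k] {V : Type u} [Fintype V] [LinearOrder V] {ι : Type v} [Fintype ι]
  {H : SimpleGraph V} {w : ι → V} {col : V → ι} {W : ι → Set V}

theorem card_whiskerBasis (n : ℕ) : Nat.card (WhiskerBasis H w n) =
    ∑ C ∈ minVertexCovers H, (whiskerFree w C).card.choose n := by
  classical
  have e : WhiskerBasis H w n ≃
      ((minVertexCovers H).sigma fun C => (whiskerFree w C).powersetCard n) :=
    { toFun := fun q => ⟨⟨q.cover, q.face⟩, Finset.mem_sigma.2
        ⟨mem_minVertexCovers.2 q.admissible.1, Finset.mem_powersetCard.2 q.admissible.2⟩⟩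
      invFun := fun s => WhiskerBasis.mk (C := s.1.1) (σ := s.1.2)
        ⟨mem_minVertexCovers.1 (Finset.mem_sigma.1 s.2).1,
          Finset.mem_powersetCard.1 (Finset.mem_sigma.1 s.2).2⟩
      left_inv := fun q => rfl
      right_inv := fun s => rfl }
  rw [Nat.card_congr e, Nat.card_eq_fintype_card, Fintype.card_coe, Finset.card_sigma]
  exact Finset.sum_congr rfl fun C _ => Finset.card_powersetCard _ _

/-- All minimal covers have $|V|-r$ elements, which is why the resolution is linear. -/
theorem whiskerBasis_degree (hw : IsWhiskered H w col) {n : ℕ} (q : WhiskerBasis H w n) :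
    Finsupp.weight (fun _ : V => (1 : ℤ))
      (∑ a ∈ q.cover, Finsupp.single a 1 + ∑ a ∈ q.face, Finsupp.single a 1) =
      n + ((Fintype.card V : ℤ) - Fintype.card ι) := by
  have h := hw.card_add q.admissible.1
  have h' := q.admissible.2.2
  rw [map_add, map_sum, map_sum]
  simp only [Finsupp.weight_single, one_smul, Finset.sum_const, nsmul_eq_mul, mul_one]
  push_cast [← h, h']
  ring

/-- Coarsening the multigrading to total degree turns the whisker complex into a resolution of the
kind that graded Betti numbers count. -/
theorem gradedBettiNumber_coverIdeal (hw : IsWhiskered H w col)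
    (hW : ∀ i a, a ∈ W i ↔ a ∉ Set.range w ∧ col a = i) (i : ℕ) (j : ℤ) :
    gradedBettiNumber (coverIdeal k H) i j =
      if j = i + ((Fintype.card V : ℤ) - Fintype.card ι) then
        ∑ C ∈ minVertexCovers H, (whiskerFree w C).card.choose i
      else 0 := by
  have hF := (whiskerComplex_isMinimalFreeResolution (k := k) hw hW).map_degree
    (Finsupp.weight (fun _ : V => (1 : ℤ)))
  simp only [Finsupp.weight_single, one_smul] at hF
  rw [hF.gradedBettiNumber_eq]
  change Nat.card {q : WhiskerBasis H w i // Finsupp.weight (fun _ : V => (1 : ℤ))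
      (∑ a ∈ q.cover, Finsupp.single a 1 + ∑ a ∈ q.face, Finsupp.single a 1) = j} = _
  simp only [whiskerBasis_degree hw]
  split_ifs with h
  · rw [← card_whiskerBasis]
    exact Nat.card_congr (Equiv.subtypeUnivEquiv fun _ => h.symm)
  · rw [Nat.card_eq_zero]
    exact Or.inl ⟨fun q => h q.2.symm⟩

theorem bettiNumber_coverIdeal (hw : IsWhiskered H w col)
    (hW : ∀ i a, a ∈ W i ↔ a ∉ Set.range w ∧ col a = i) (i : ℕ) :
    bettiNumber (coverIdeal k H) i =
      ∑ C ∈ minVertexCovers H, (whiskerFree w C).card.choose i := by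
  rw [bettiNumber, finsum_eq_single _ (i + ((Fintype.card V : ℤ) - Fintype.card ι))]
  · rw [gradedBettiNumber_coverIdeal hw hW, if_pos rfl]
  · intro j hj
    rw [gradedBettiNumber_coverIdeal hw hW, if_neg hj]

theorem sum_choose_ne_zero_iff (hw : IsWhiskered H w col) (i : ℕ) :
    ∑ C ∈ minVertexCovers H, (whiskerFree w C).card.choose i ≠ 0 ↔
      i ≤ (minVertexCovers H).sup fun C => (whiskerFree w C).card := by
  have hne : (minVertexCovers H).Nonempty :=
    ⟨_, mem_minVertexCovers.2 hw.isMinVertexCover_compl_range⟩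
  rw [Ne, Finset.sum_eq_zero_iff]
  push Not
  simp only [ne_eq, Nat.choose_eq_zero_iff, not_lt]
  constructor
  · rintro ⟨C, hC, h⟩
    exact h.trans (Finset.le_sup (f := fun C => (whiskerFree w C).card) hC)
  · intro h
    obtain ⟨C, hC, h'⟩ := Finset.exists_mem_eq_sup _ hne fun C => (whiskerFree w C).card
    exact ⟨C, hC, h' ▸ h⟩

theorem isGreatest_gradedBettiNumber (hw : IsWhiskered H w col)
    (hW : ∀ i a, a ∈ W i ↔ a ∉ Set.range w ∧ col a = i) :
    IsGreatest {i | ∃ j, gradedBettiNumber (coverIdeal k H) i j ≠ 0}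
      ((minVertexCovers H).sup fun C => (whiskerFree w C).card) := by
  constructor
  · refine ⟨((minVertexCovers H).sup fun C => (whiskerFree w C).card : ℕ) +
      ((Fintype.card V : ℤ) - Fintype.card ι), ?_⟩
    rw [gradedBettiNumber_coverIdeal hw hW, if_pos rfl]
    exact (sum_choose_ne_zero_iff hw _).2 le_rfl
  · rintro i ⟨j, hj⟩
    rw [gradedBettiNumber_coverIdeal hw hW] at hj
    exact (sum_choose_ne_zero_iff hw i).1 fun h => hj (by rw [h, ite_self])

theorem projectiveDimension_coverIdeal (hw : IsWhiskered H w col)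
    (hW : ∀ i a, a ∈ W i ↔ a ∉ Set.range w ∧ col a = i) :
    CategoryTheory.projectiveDimension (ModuleCat.of (MvPolynomial V k) (coverIdeal k H)) =
      (((minVertexCovers H).sup fun C => (whiskerFree w C).card : ℕ) : WithBot ℕ∞) := by
  have hfin : ∀ n, Finite (WhiskerBasis H w n) := (whiskerComplex k H w W).finite
  refine (whiskerComplex_isMinimalFreeResolution (k := k) hw hW).projectiveDimension_eq ?_ ?_
  · change Nonempty (WhiskerBasis H w _)
    rw [← Finite.card_pos_iff, Nat.pos_iff_ne_zero, card_whiskerBasis, sum_choose_ne_zero_iff hw]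
  · change IsEmpty (WhiskerBasis H w _)
    rw [← Finite.card_eq_zero_iff, card_whiskerBasis]
    by_contra h
    have := (sum_choose_ne_zero_iff hw _).1 h
    omega

end WhiskerBetti

/-! ## Regular sequences and associated primes -/

section Depth

open Pointwise

/-- The length of a regular sequence is at most the dimension of every associated prime. -/
theorem length_le_coheight_of_isWeaklyRegular {R : Type*} [CommRing R] [IsNoetherianRing R]
    (rs : List R) {M : Type*} [AddCommGroup M] [Module R M] [Module.Finite R M]
    (hrs : ∀ r ∈ rs, r ∈ Ring.jacobson R) (h : RingTheory.Sequence.IsWeaklyRegular M rs)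
    (p : PrimeSpectrum R) (hp : IsAssociatedPrime p.asIdeal M) :
    (rs.length : ℕ∞) ≤ Order.coheight p := by
  induction rs generalizing M p with
  | nil => simp
  | cons r rs ih =>
    rw [RingTheory.Sequence.isWeaklyRegular_cons_iff] at h
    obtain ⟨hreg, hrs'⟩ := h
    rw [isAssociatedPrime_iff] at hp
    obtain ⟨hprime, m, hm⟩ := hp
    have hkill : ∀ b, b ∈ p.asIdeal ↔ b • m = 0 := fun b => by
      rw [hm, Submodule.mem_colon_singleton, Submodule.mem_bot]
    have hm0 : m ≠ 0 := by
      rintro rfl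
      exact hprime.ne_top ((Ideal.eq_top_iff_one _).2 ((hkill 1).2 (smul_zero _)))
    -- the submodule of elements killed by `p`
    let N : Submodule R M :=
      { carrier := {x | ∀ b ∈ p.asIdeal, b • x = 0}
        add_mem' := fun hx hy b hb => by rw [smul_add, hx b hb, hy b hb, add_zero]
        zero_mem' := fun b _ => smul_zero b
        smul_mem' := fun c x hx b hb => by rw [smul_comm, hx b hb, smul_zero] }
    have hmN : m ∈ N := fun b hb => (hkill b).1 hb
    -- If `r • y` is killed by `p`, so is `y`, because `r` is a nonzerodivisor. Were all of `N`
    -- divisible by `r`, then `N` would be contained in `r N` and vanish by Nakayama.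
    have hN : ¬ N ≤ r • (⊤ : Submodule R M) := by
      intro hle
      have hle' : N ≤ Ideal.span {r} • N := by
        intro x hx
        obtain ⟨y, -, rfl⟩ := hle hx
        refine Submodule.smul_mem_smul (Ideal.mem_span_singleton_self r) fun b hb => ?_
        refine hreg ?_
        change r • b • y = r • (0 : M)
        rw [smul_comm, smul_zero]
        exact hx b hb
      have := Submodule.eq_bot_of_le_smul_of_le_jacobson_bot _ _ (IsNoetherian.noetherian N) hle'
        (by
          rw [Ideal.span_singleton_le_iff_mem]
          rw [Ideal.jacobson_bot]
          exact hrs r (by simp))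
      rw [this] at hmN
      exact hm0 hmN
    obtain ⟨x, hxN, hx⟩ := Set.not_subset.1 hN
    have hx0 : (Submodule.Quotient.mk x : QuotSMulTop r M) ≠ 0 := by
      rw [Ne, Submodule.Quotient.mk_eq_zero]
      exact hx
    -- The class of `x` in `M / rM` is nonzero and killed by `p` and by `r`. An associated prime
    -- above its annihilator contains `p` strictly, as `r ∉ p`.
    obtain ⟨Q, hQ, hle⟩ := exists_le_isAssociatedPrime_of_isNoetherianRing R _ hx0
    have hpQ : p.asIdeal ≤ Q := fun b hb => hle (by
      rw [Submodule.mem_colon_singleton, Submodule.mem_bot, ← Submodule.Quotient.mk_smul, hxN b hb]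
      rfl)
    have hrQ : r ∈ Q := hle (by
      rw [Submodule.mem_colon_singleton, Submodule.mem_bot, ← Submodule.Quotient.mk_smul,
        Submodule.Quotient.mk_eq_zero]
      exact Submodule.smul_mem_pointwise_smul _ _ _ trivial)
    have hrp : r ∉ p.asIdeal := fun hr => hm0 (hreg (by
      change r • m = r • (0 : M)
      rw [(hkill r).1 hr, smul_zero]))
    have hlt : p < ⟨Q, hQ.isPrime⟩ :=
      lt_of_le_of_ne hpQ fun e => hrp (by rw [e]; exact hrQ)
    have := ih (fun s hs => hrs s (List.mem_cons_of_mem _ hs)) hrs' ⟨Q, hQ.isPrime⟩ hQ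
    rw [List.length_cons, Nat.cast_succ]
    exact (add_le_add_left this 1).trans (Order.coheight_add_one_le hlt)

end Depth

/-! ## Primes over the edge ideal -/

section EdgeIdeal

variable (k : Type u) [Field k] {V : Type u}

/-- Setting the variables from `D` to zero. -/
noncomputable def killVariables (D : Finset V) :
    MvPolynomial V k →ₐ[k] MvPolynomial {a // a ∉ D} k :=
  killCompl (Subtype.val_injective (p := fun a => a ∉ D))

variable {k}

theorem killVariables_X_of_mem {D : Finset V} {a : V} (ha : a ∈ D) :
    killVariables k D (X a) = 0 := by
  rw [killVariables, killCompl, aeval_X, dif_neg]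
  rintro ⟨⟨b, hb⟩, rfl⟩
  exact hb ha

theorem killVariables_rename {D : Finset V} (f : MvPolynomial {a // a ∉ D} k) :
    killVariables k D (rename Subtype.val f) = f := killCompl_rename_app _ f

theorem killVariables_X_of_notMem {D : Finset V} {a : V} (ha : a ∉ D) :
    killVariables k D (X a) = X ⟨a, ha⟩ := by
  rw [← killVariables_rename (k := k) (X ⟨a, ha⟩), rename_X]

theorem killVariables_surjective (D : Finset V) : Function.Surjective (killVariables k D) :=
  fun f => ⟨_, killVariables_rename f⟩

theorem X_mem_ker_killVariables {D : Finset V} {a : V} :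
    X a ∈ RingHom.ker (killVariables k D) ↔ a ∈ D := by
  rw [RingHom.mem_ker]
  by_cases ha : a ∈ D
  · simp [killVariables_X_of_mem ha, ha]
  · simp [killVariables_X_of_notMem ha, ha]

/-- Modulo `q`, setting the variables from `D` to zero changes nothing. -/
theorem ker_killVariables_le {D : Finset V} {q : Ideal (MvPolynomial V k)}
    (h : ∀ a ∈ D, X a ∈ q) : RingHom.ker (killVariables k D) ≤ q := by
  intro f hf
  have e : (Ideal.Quotient.mkₐ k q).comp ((rename Subtype.val).comp (killVariables k D)) =
      Ideal.Quotient.mkₐ k q := by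
    ext a
    simp only [AlgHom.comp_apply]
    by_cases ha : a ∈ D
    · rw [killVariables_X_of_mem ha, map_zero, map_zero]
      exact (Ideal.Quotient.eq_zero_iff_mem.2 (h a ha)).symm
    · rw [killVariables_X_of_notMem ha, rename_X]
  have := AlgHom.congr_fun e f
  simp only [AlgHom.comp_apply] at this
  rw [RingHom.mem_ker.1 hf, map_zero, map_zero] at this
  exact Ideal.Quotient.eq_zero_iff_mem.1 this.symm

theorem constantCoeff_killVariables (D : Finset V) (f : MvPolynomial V k) :
    constantCoeff (killVariables k D f) = constantCoeff f := by
  have e : (aeval (fun _ => (0 : k))).comp (killVariables k D) = aeval (fun _ : V => (0 : k)) := by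
    ext a
    simp only [AlgHom.comp_apply]
    by_cases ha : a ∈ D
    · rw [killVariables_X_of_mem ha]; simp
    · rw [killVariables_X_of_notMem ha]; simp
  have := AlgHom.congr_fun e f
  simpa [aeval_zero'] using this

theorem edgeIdeal_le_ker_killVariables {H : SimpleGraph V} {D : Finset V}
    (hD : H.IsVertexCover (D : Set V)) : edgeIdeal k H ≤ RingHom.ker (killVariables k D) := by
  rw [edgeIdeal, Ideal.span_le]
  rintro _ ⟨a, b, hab, rfl⟩
  rcases hD hab with h | h
  · exact Ideal.mul_mem_right _ _ (X_mem_ker_killVariables.2 h)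
  · exact Ideal.mul_mem_left _ _ (X_mem_ker_killVariables.2 h)

/-- Since `q` is prime, the variables it contains form a vertex cover; a minimal cover is chosen
inside it. -/
theorem exists_ker_killVariables_le [Finite V] {H : SimpleGraph V} {q : Ideal (MvPolynomial V k)}
    [q.IsPrime] (h : edgeIdeal k H ≤ q) :
    ∃ C, IsMinVertexCover H C ∧ (∀ a ∈ C, X a ∈ q) := by
  classical
  have : Fintype V := Fintype.ofFinite V
  obtain ⟨C, hC, hCm⟩ := exists_isMinVertexCover_subset H
    (C := Finset.univ.filter fun a => X a ∈ q) (by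
      intro a b hab
      have : X a * X b ∈ q := h (Ideal.subset_span ⟨a, b, hab, rfl⟩)
      simpa using Ideal.IsPrime.mem_or_mem ‹_› this)
  exact ⟨C, hCm, fun a ha => by simpa using hC ha⟩

variable (k) in
/-- The prime ideal of `S` generated by the variables from `D`. -/
noncomputable def variablePrime (D : Finset V) : PrimeSpectrum (MvPolynomial V k) :=
  ⟨RingHom.ker (killVariables k D), RingHom.ker_isPrime _⟩

/-- The primes above it are those of the quotient, a polynomial ring in the variables outside `D`.
-/
theorem coheight_variablePrime [Finite V] (D : Finset V) :
    Order.coheight (variablePrime k D) = Nat.card {a // a ∉ D} := by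
  have e := Order.coheight_eq_krullDim_Ici (variablePrime k D)
  have h1 : Set.Ici (variablePrime k D) =
      PrimeSpectrum.zeroLocus (RingHom.ker (killVariables k D) : Set (MvPolynomial V k)) := by
    ext p; rfl
  have h2 := ringKrullDim_eq_of_ringEquiv (Ideal.quotientKerAlgEquivOfSurjective
    (killVariables_surjective (k := k) D)).toRingEquiv
  rw [h1, ← ringKrullDim_quotient, h2,
    MvPolynomial.ringKrullDim_of_isNoetherianRing, ringKrullDim_eq_zero_of_field, zero_add] at e
  exact WithBot.coe_injective e

theorem natCard_notMem [Fintype V] [DecidableEq V] (D : Finset V) :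
    Nat.card {a // a ∉ D} = Dᶜ.card := by
  rw [Nat.card_eq_fintype_card, Fintype.card_subtype]
  congr 1
  ext; simp

/-- The ring homomorphism on `S ⧸ I(H)` that sets the variables of a vertex cover to zero. -/
noncomputable def quotientKill {H : SimpleGraph V} {D : Finset V}
    (hD : H.IsVertexCover (D : Set V)) :
    MvPolynomial V k ⧸ edgeIdeal k H →+* MvPolynomial {a // a ∉ D} k :=
  Ideal.Quotient.lift _ (killVariables k D : MvPolynomial V k →+* _)
    fun _ hf => RingHom.mem_ker.1 (edgeIdeal_le_ker_killVariables hD hf)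

theorem quotientKill_mk {H : SimpleGraph V} {D : Finset V}
    (hD : H.IsVertexCover (D : Set V)) (f : MvPolynomial V k) :
    quotientKill hD (Ideal.Quotient.mk (edgeIdeal k H) f) = killVariables k D f := rfl

theorem quotientKill_surjective {H : SimpleGraph V} {D : Finset V}
    (hD : H.IsVertexCover (D : Set V)) : Function.Surjective (quotientKill (k := k) hD) := by
  intro f
  obtain ⟨g, rfl⟩ := killVariables_surjective D f
  exact ⟨Ideal.Quotient.mk _ g, rfl⟩

theorem comap_mk_strictMono (I : Ideal (MvPolynomial V k)) :
    StrictMono (PrimeSpectrum.comap (Ideal.Quotient.mk I)) := by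
  refine Monotone.strictMono_of_injective ?_ ?_
  · intro p q h
    exact Ideal.comap_mono h
  · exact PrimeSpectrum.comap_injective_of_surjective _ Ideal.Quotient.mk_surjective

theorem comap_mk_le_iff (I : Ideal (MvPolynomial V k))
    {p q : PrimeSpectrum (MvPolynomial V k ⧸ I)} :
    PrimeSpectrum.comap (Ideal.Quotient.mk I) p ≤ PrimeSpectrum.comap (Ideal.Quotient.mk I) q ↔
      p ≤ q :=
  Ideal.comap_le_comap_iff_of_surjective _ Ideal.Quotient.mk_surjective _ _

theorem coheight_le_of_edgeIdeal [Finite V] {H : SimpleGraph V}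
    (p : PrimeSpectrum (MvPolynomial V k ⧸ edgeIdeal k H)) :
    ∃ C, IsMinVertexCover H C ∧ Order.coheight p ≤ Nat.card {a // a ∉ C} := by
  have hle : edgeIdeal k H ≤ (PrimeSpectrum.comap (Ideal.Quotient.mk (edgeIdeal k H)) p).asIdeal := by
    intro f hf
    change Ideal.Quotient.mk _ f ∈ p.asIdeal
    rw [Ideal.Quotient.eq_zero_iff_mem.2 hf]
    exact zero_mem _
  have := (PrimeSpectrum.comap (Ideal.Quotient.mk (edgeIdeal k H)) p).isPrime
  obtain ⟨C, hC, hCq⟩ := exists_ker_killVariables_le hle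
  refine ⟨C, hC, (Order.coheight_le_coheight_apply_of_strictMono _ (comap_mk_strictMono _) p).trans ?_⟩
  rw [← coheight_variablePrime (k := k)]
  exact Order.coheight_anti (ker_killVariables_le hCq)

/-- Above: every prime over $I(H)$ contains the prime of a minimal cover, which has coheight `r`.
Below: the quotient maps onto a polynomial ring in the `r` variables outside a minimal cover. -/
theorem ringKrullDim_edgeIdeal [Finite V] {H : SimpleGraph V} {r : ℕ}
    (h : ∀ C, IsMinVertexCover H C → Nat.card {a // a ∉ C} = r) :
    ringKrullDim (MvPolynomial V k ⧸ edgeIdeal k H) = r := by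
  classical
  have : Fintype V := Fintype.ofFinite V
  apply le_antisymm
  · rw [ringKrullDim, Order.krullDim_eq_iSup_coheight]
    refine iSup_le fun p => ?_
    obtain ⟨C, hC, hle⟩ := coheight_le_of_edgeIdeal p
    rw [h C hC] at hle
    exact WithBot.coe_le_coe.2 hle
  · obtain ⟨C, -, hC⟩ := exists_isMinVertexCover_subset H (C := Finset.univ)
      (fun a b _ => by simp)
    have := ringKrullDim_le_of_surjective _ (quotientKill_surjective (k := k) hC.prop)
    rwa [MvPolynomial.ringKrullDim_of_isNoetherianRing, ringKrullDim_eq_zero_of_field, zero_add,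
      h C hC] at this

/-! ## Cohen–Macaulay graphs are unmixed -/

/-- The prime ideal of `S ⧸ I(H)` generated by the variables of a vertex cover. -/
noncomputable def quotientPrime {H : SimpleGraph V} {D : Finset V}
    (hD : H.IsVertexCover (D : Set V)) : PrimeSpectrum (MvPolynomial V k ⧸ edgeIdeal k H) :=
  ⟨RingHom.ker (quotientKill hD), RingHom.ker_isPrime _⟩

theorem comap_quotientPrime {H : SimpleGraph V} {D : Finset V}
    (hD : H.IsVertexCover (D : Set V)) :
    PrimeSpectrum.comap (Ideal.Quotient.mk (edgeIdeal k H)) (quotientPrime hD) =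
      variablePrime k D := rfl

theorem quotientPrime_lt {H : SimpleGraph V} {D D' : Finset V}
    (hD : H.IsVertexCover (D : Set V)) (hD' : H.IsVertexCover (D' : Set V)) (h : D ⊂ D') :
    quotientPrime (k := k) hD < quotientPrime hD' := by
  rw [lt_iff_le_not_ge, ← comap_mk_le_iff, ← comap_mk_le_iff, ← lt_iff_le_not_ge,
    comap_quotientPrime, comap_quotientPrime]
  refine lt_of_le_of_ne (ker_killVariables_le fun a ha => X_mem_ker_killVariables.2 (h.1 ha)) ?_
  intro e
  obtain ⟨a, ha, ha'⟩ := Set.not_subset.1 h.2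
  refine ha' (X_mem_ker_killVariables (k := k).1 ?_)
  have : X a ∈ (variablePrime k D').asIdeal := X_mem_ker_killVariables.2 ha
  rwa [← e] at this

/-- Adding the variables of `T` one at a time to the prime of `C` gives a strict chain of primes. -/
theorem card_le_height_quotientPrime [DecidableEq V] {H : SimpleGraph V} {C : Finset V}
    (hC : H.IsVertexCover (C : Set V)) (T : Finset V) (hT : Disjoint T C)
    (hTC : H.IsVertexCover ((T ∪ C : Finset V) : Set V)) :
    (T.card : ℕ∞) ≤ Order.height (quotientPrime (k := k) hTC) := by
  induction T using Finset.induction_on with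
  | empty => simp
  | insert a T ha ih =>
    rw [Finset.disjoint_insert_left] at hT
    have hTC' : H.IsVertexCover ((T ∪ C : Finset V) : Set V) :=
      hC.subset (by simp)
    rw [Finset.card_insert_of_notMem ha, Nat.cast_succ]
    refine (add_le_add_left (ih hT.2 hTC') 1).trans (Order.height_add_one_le
      (quotientPrime_lt hTC' hTC ?_))
    rw [Finset.insert_union]
    exact Finset.ssubset_insert (by simp [ha, hT.1])

/-- In the localization `A` at the ideal of all variables there is a regular sequence of length
$\dim A$. A chain starting at the prime of `C'` gives $\dim A\ge|V\setminus C'|$. The prime of `C`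
is minimal, hence associated, so the length is at most its coheight, which is at most $|V\setminus
C|$. -/
theorem IsCohenMacaulayGraph.card_compl_le [Finite V] {H : SimpleGraph V}
    (h : IsCohenMacaulayGraph k H) {C C' : Finset V} (hC : IsMinVertexCover H C)
    (hC' : IsMinVertexCover H C') : Nat.card {a // a ∉ C'} ≤ Nat.card {a // a ∉ C} := by
  classical
  have : Fintype V := Fintype.ofFinite V
  -- The constant term on the quotient; going through `quotientKill` makes it well defined, and the
  -- choice of the cover does not affect it.
  let c : MvPolynomial V k ⧸ edgeIdeal k H →+* k :=
    (constantCoeff (R := k)).comp (quotientKill hC.prop)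
  have hc : Function.Surjective c := fun a =>
    ⟨Ideal.Quotient.mk _ (MvPolynomial.C a), by
      simp only [c, RingHom.comp_apply, quotientKill_mk, constantCoeff_killVariables,
        constantCoeff_C]⟩
  have hcD : ∀ {D : Finset V} (hD : H.IsVertexCover (D : Set V)) x,
      constantCoeff (quotientKill hD x) = c x := by
    intro D hD x
    obtain ⟨f, rfl⟩ := Ideal.Quotient.mk_surjective x
    simp only [c, RingHom.comp_apply, quotientKill_mk, constantCoeff_killVariables]
  have hmax : (RingHom.ker c).IsMaximal := RingHom.ker_isMaximal_of_surjective c hc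
  have hle : ∀ {D : Finset V} (hD : H.IsVertexCover (D : Set V)),
      (quotientPrime (k := k) hD).asIdeal ≤ RingHom.ker c := by
    intro D hD x hx
    rw [RingHom.mem_ker, ← hcD hD, RingHom.mem_ker.1 hx, map_zero]
  let A := Localization.AtPrime (RingHom.ker c)
  obtain ⟨rs, hrs, hreg, hlen⟩ : ∃ rs : List A, (∀ r ∈ rs, r ∈ IsLocalRing.maximalIdeal A) ∧
    RingTheory.Sequence.IsRegular A rs ∧ (rs.length : WithBot ℕ∞) = ringKrullDim A :=
    h.regularSequence (RingHom.ker c)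
  have hnoeth := h.noetherian
  have : IsNoetherianRing A := IsLocalization.isNoetherianRing (RingHom.ker c).primeCompl A hnoeth
  -- lower bound for the dimension
  have h1 : (Nat.card {a // a ∉ C'} : ℕ∞) ≤ rs.length := by
    rw [IsLocalization.AtPrime.ringKrullDim_eq_height (RingHom.ker c) A] at hlen
    have hlen' : (rs.length : ℕ∞) = (RingHom.ker c).height := WithBot.coe_injective hlen
    rw [hlen', natCard_notMem]
    refine (card_le_height_quotientPrime (k := k) hC'.prop C'ᶜ disjoint_compl_left
      (hC'.prop.subset (by simp))).trans ?_
    rw [← PrimeSpectrum.height_eq_orderHeight]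
    exact Ideal.height_mono (hle _)
  -- the prime of `C` is associated
  let e := IsLocalization.AtPrime.orderIsoOfPrime A (RingHom.ker c)
  let P : {p : Ideal A // p.IsPrime} := e.symm ⟨(quotientPrime hC.prop).asIdeal,
    (quotientPrime hC.prop).isPrime, hle _⟩
  have hP : P.1.comap (algebraMap _ A) = (quotientPrime hC.prop).asIdeal :=
    congrArg Subtype.val (e.apply_symm_apply ⟨(quotientPrime hC.prop).asIdeal,
      (quotientPrime hC.prop).isPrime, hle _⟩)
  -- A prime below that of `C` contains the variables of some minimal cover `C₁ ⊆ C`, and minimality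
  -- of `C` gives `C₁ = C`.
  have hmin : ∀ q : PrimeSpectrum (MvPolynomial V k ⧸ edgeIdeal k H),
      q ≤ quotientPrime hC.prop → quotientPrime hC.prop ≤ q := by
    intro q hq
    have hI : edgeIdeal k H ≤
        (PrimeSpectrum.comap (Ideal.Quotient.mk (edgeIdeal k H)) q).asIdeal := by
      intro f hf
      change Ideal.Quotient.mk _ f ∈ q.asIdeal
      rw [Ideal.Quotient.eq_zero_iff_mem.2 hf]
      exact zero_mem _
    have := (PrimeSpectrum.comap (Ideal.Quotient.mk (edgeIdeal k H)) q).isPrime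
    obtain ⟨C₁, hC₁, hC₁q⟩ := exists_ker_killVariables_le hI
    have hsub : C₁ ≤ C := fun a ha => X_mem_ker_killVariables (k := k).1 (by
      have := hq (hC₁q a ha)
      exact this)
    have hCC : C ≤ C₁ := hC.le_of_le hC₁.prop hsub
    rw [← comap_mk_le_iff, comap_quotientPrime]
    exact ker_killVariables_le fun a ha => hC₁q a (hCC ha)
  have hPmin : P.1 ∈ (Module.annihilator A A).minimalPrimes := by
    have hann : Module.annihilator A A = ⊥ := by
      refine eq_bot_iff.2 fun a ha => ?_
      have := Module.mem_annihilator.1 ha 1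
      rwa [smul_eq_mul, mul_one] at this
    rw [hann]
    refine ⟨⟨P.2, bot_le⟩, ?_⟩
    rintro Q ⟨hQ, -⟩ hQP
    have h2 : e ⟨Q, hQ⟩ ≤ e P := e.monotone hQP
    have h3 : (e P).1 ≤ (e ⟨Q, hQ⟩).1 := by
      have h4 := hmin ⟨(e ⟨Q, hQ⟩).1, (e ⟨Q, hQ⟩).2.1⟩ (by
        change (e ⟨Q, hQ⟩).1 ≤ (quotientPrime hC.prop).asIdeal
        rw [← hP]
        exact h2)
      rw [show (e P).1 = _ from hP]
      exact h4
    exact e.le_iff_le.1 (show e P ≤ e ⟨Q, hQ⟩ from h3)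
  have hass : IsAssociatedPrime P.1 A :=
    Module.associatedPrimes.minimalPrimes_annihilator_subset_associatedPrimes A A hPmin
  have h2 := length_le_coheight_of_isWeaklyRegular (M := A) rs (fun r hr => by
    rw [IsLocalRing.ringJacobson_eq_maximalIdeal]
    exact hrs r hr) hreg.toIsWeaklyRegular ⟨P.1, P.2⟩ hass
  have h3 : Order.coheight (⟨P.1, P.2⟩ : PrimeSpectrum A) ≤ Nat.card {a // a ∉ C} := by
    have hmono : StrictMono (PrimeSpectrum.comap (algebraMap
        (MvPolynomial V k ⧸ edgeIdeal k H) A)) := by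
      refine Monotone.strictMono_of_injective (fun p q h => Ideal.comap_mono h) ?_
      exact PrimeSpectrum.localization_comap_injective A (RingHom.ker c).primeCompl
    refine (Order.coheight_le_coheight_apply_of_strictMono _ hmono _).trans ?_
    have : PrimeSpectrum.comap (algebraMap (MvPolynomial V k ⧸ edgeIdeal k H) A)
        ⟨P.1, P.2⟩ = quotientPrime hC.prop := PrimeSpectrum.ext hP
    rw [this]
    refine (Order.coheight_le_coheight_apply_of_strictMono _ (comap_mk_strictMono _) _).trans ?_
    rw [comap_quotientPrime, coheight_variablePrime]
  exact_mod_cast h1.trans (h2.trans h3)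

/-- In a Cohen–Macaulay graph all maximal independent sets have the same cardinality. -/
theorem IsCohenMacaulayGraph.card_eq [Fintype V] {H : SimpleGraph V}
    (h : IsCohenMacaulayGraph k H) {C C' : Finset V} (hC : IsMinVertexCover H C)
    (hC' : IsMinVertexCover H C') : C.card = C'.card := by
  classical
  have h1 := (h.card_compl_le hC hC').antisymm (h.card_compl_le hC' hC)
  rw [natCard_notMem, natCard_notMem] at h1
  have h2 := Finset.card_add_card_compl C
  have h3 := Finset.card_add_card_compl C'
  omega

end EdgeIdeal

/-! ## The rings of the Čech complex of an edge ideal -/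

section UnitZPow

variable {R : Type*} [CommRing R]

open scoped Classical in
/-- The integral powers of a unit. -/
noncomputable def unitZPow (x : R) (n : ℤ) : R := if h : IsUnit x then (h.unit ^ n : Rˣ) else 0

theorem unitZPow_eq {x : R} (h : IsUnit x) (n : ℤ) : unitZPow x n = (h.unit ^ n : Rˣ) := dif_pos h

theorem unitZPow_zero {x : R} (h : IsUnit x) : unitZPow x 0 = 1 := by
  rw [unitZPow_eq h, zpow_zero, Units.val_one]

theorem unitZPow_add {x : R} (h : IsUnit x) (m n : ℤ) :
    unitZPow x (m + n) = unitZPow x m * unitZPow x n := by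
  rw [unitZPow_eq h, unitZPow_eq h, unitZPow_eq h, zpow_add, Units.val_mul]

theorem unitZPow_natCast {x : R} (h : IsUnit x) (n : ℕ) : unitZPow x n = x ^ n := by
  rw [unitZPow_eq h, zpow_natCast, Units.val_pow_eq_pow_val, IsUnit.unit_spec]

theorem map_unitZPow {S : Type*} [CommRing S] (f : R →+* S) {x : R} (h : IsUnit x) (n : ℤ) :
    f (unitZPow x n) = unitZPow (f x) n := by
  have e : Units.map (f : R →* S) h.unit = (h.map f).unit := by
    ext
    rfl
  rw [unitZPow_eq h, unitZPow_eq (h.map f), ← e, ← map_zpow]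
  rfl

end UnitZPow

/-! ### Laurent monomials in the localizations of $S/I$. -/

section CechRing

variable {k : Type u} [Field k] {V : Type u}

/-- The map from the polynomial ring to the localization. -/
noncomputable def cechMk (I : Ideal (MvPolynomial V k)) (U : Finset V) :
    MvPolynomial V k →ₐ[k] CechRing I U :=
  (IsScalarTower.toAlgHom k (MvPolynomial V k ⧸ I) (CechRing I U)).comp (Ideal.Quotient.mkₐ k I)

theorem cechMk_apply (I : Ideal (MvPolynomial V k)) (U : Finset V) (f : MvPolynomial V k) :
    cechMk I U f = algebraMap (MvPolynomial V k ⧸ I) (CechRing I U) (Ideal.Quotient.mk I f) := rfl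

theorem cechRestrict_cechMk (I : Ideal (MvPolynomial V k)) {U U' : Finset V} (h : U ⊆ U')
    (f : MvPolynomial V k) : cechRestrict I h (cechMk I U f) = cechMk I U' f := by
  exact IsLocalization.lift_eq (fun y => IsLocalization.map_units (CechRing I U')
    (⟨y.1, variableMonoid_mono I h y.2⟩ : variableMonoid I U')) (Ideal.Quotient.mk I f)

theorem isUnit_cechMk_X (I : Ideal (MvPolynomial V k)) {U : Finset V} {a : V} (ha : a ∈ U) :
    IsUnit (cechMk I U (X a)) :=
  IsLocalization.map_units (CechRing I U)
    (⟨Ideal.Quotient.mk I (X a), Submonoid.subset_closure ⟨a, ha, rfl⟩⟩ : variableMonoid I U)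

/-- The elements of the localization are fractions with monomials as denominators. -/
theorem exists_mul_cechMk_monomial (I : Ideal (MvPolynomial V k)) {U : Finset V}
    (y : CechRing I U) : ∃ (f : MvPolynomial V k) (m : V →₀ ℕ), (∀ a ∉ U, m a = 0) ∧
      y * cechMk I U (monomial m 1) = cechMk I U f := by
  obtain ⟨⟨f, s, hs⟩, h⟩ := IsLocalization.surj (variableMonoid I U) y
  obtain ⟨f, rfl⟩ := Ideal.Quotient.mk_surjective f
  have key : ∃ m : V →₀ ℕ, (∀ a ∉ U, m a = 0) ∧ s = Ideal.Quotient.mk I (monomial m 1) := by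
    clear h
    induction hs using Submonoid.closure_induction with
    | mem s hs =>
      obtain ⟨a, ha, rfl⟩ := hs
      refine ⟨Finsupp.single a 1, fun b hb => ?_, rfl⟩
      rw [Finsupp.single_eq_of_ne]
      rintro rfl
      exact hb ha
    | one => exact ⟨0, fun _ _ => rfl, rfl⟩
    | mul s t _ _ ihs iht =>
      obtain ⟨m, hm, rfl⟩ := ihs
      obtain ⟨n, hn, rfl⟩ := iht
      refine ⟨m + n, fun a ha => ?_, ?_⟩
      · rw [Finsupp.add_apply, hm a ha, hn a ha]
      · rw [← map_mul, monomial_mul, one_mul]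
  obtain ⟨m, hm, rfl⟩ := key
  exact ⟨f, m, hm, h⟩

/-- The Laurent monomial with exponents `b a`, `a ∈ U`. -/
noncomputable def cechMonomial (I : Ideal (MvPolynomial V k)) (U : Finset V) (b : V → ℤ) :
    CechRing I U :=
  ∏ a ∈ U, unitZPow (cechMk I U (X a)) (b a)

theorem cechMonomial_add (I : Ideal (MvPolynomial V k)) (U : Finset V) (b c : V → ℤ) :
    cechMonomial I U (b + c) = cechMonomial I U b * cechMonomial I U c := by
  rw [cechMonomial, cechMonomial, cechMonomial, ← Finset.prod_mul_distrib]
  exact Finset.prod_congr rfl fun a ha => unitZPow_add (isUnit_cechMk_X I ha) _ _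

theorem cechMonomial_natCast (I : Ideal (MvPolynomial V k)) (U : Finset V) (m : V → ℕ) :
    cechMonomial I U (fun a => (m a : ℤ)) = cechMk I U (∏ a ∈ U, X a ^ m a) := by
  rw [cechMonomial, map_prod]
  refine Finset.prod_congr rfl fun a ha => ?_
  rw [unitZPow_natCast (isUnit_cechMk_X I ha), map_pow]

theorem cechMonomial_congr (I : Ideal (MvPolynomial V k)) {U : Finset V} {b c : V → ℤ}
    (h : ∀ a ∈ U, b a = c a) : cechMonomial I U b = cechMonomial I U c := by
  rw [cechMonomial, cechMonomial, Finset.prod_congr rfl fun a ha => congrArg _ (h a ha)]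

theorem cechMonomial_zero (I : Ideal (MvPolynomial V k)) (U : Finset V) :
    cechMonomial I U 0 = 1 :=
  Finset.prod_eq_one fun _ ha => unitZPow_zero (isUnit_cechMk_X I ha)

theorem cechRestrict_cechMonomial (I : Ideal (MvPolynomial V k)) {U U' : Finset V} (h : U ⊆ U')
    {b : V → ℤ} (hb : ∀ a ∈ U', a ∉ U → b a = 0) :
    cechRestrict I h (cechMonomial I U b) = cechMonomial I U' b := by
  rw [cechMonomial, cechMonomial, map_prod, ← Finset.prod_subset h fun a ha ha' => by
    rw [hb a ha ha', unitZPow_zero (isUnit_cechMk_X I ha)]]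
  refine Finset.prod_congr rfl fun a ha => ?_
  rw [← cechRestrict_cechMk I h]
  exact map_unitZPow (R := CechRing I U) (S := CechRing I U') (cechRestrict I h).toRingHom
    (isUnit_cechMk_X I ha) _

theorem mem_cechDegree (I : Ideal (MvPolynomial V k)) {U : Finset V} {l : ℤ} {c : CechRing I U}
    {f s : MvPolynomial V k} {p q : ℕ} (hf : f.IsHomogeneous p) (hs : s.IsHomogeneous q)
    (hsU : s ∈ Submonoid.closure (X '' (U : Set V) : Set (MvPolynomial V k)))
    (hl : (p : ℤ) - q = l) (h : c * cechMk I U s = cechMk I U f) : c ∈ cechDegree I U l :=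
  Submodule.subset_span (s := {c | ∃ (f s : MvPolynomial V k) (p q : ℕ),
    f.IsHomogeneous p ∧ s.IsHomogeneous q ∧
    s ∈ Submonoid.closure (X '' (U : Set V) : Set (MvPolynomial V k)) ∧
    (p : ℤ) - q = l ∧ c * algebraMap (MvPolynomial V k ⧸ I) (CechRing I U) (Ideal.Quotient.mk I s) =
      algebraMap (MvPolynomial V k ⧸ I) (CechRing I U) (Ideal.Quotient.mk I f)})
    ⟨f, s, p, q, hf, hs, hsU, hl, h⟩

theorem cechMonomial_mem_cechDegree (I : Ideal (MvPolynomial V k)) (U : Finset V) (b : V → ℤ) :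
    cechMonomial I U b ∈ cechDegree I U (∑ a ∈ U, b a) := by
  -- The positive parts of the exponents form the numerator, the negative parts the denominator.
  refine mem_cechDegree I (f := ∏ a ∈ U, X a ^ (b a).toNat) (s := ∏ a ∈ U, X a ^ (-b a).toNat)
    (p := ∑ a ∈ U, (b a).toNat) (q := ∑ a ∈ U, (-b a).toNat) ?_ ?_ ?_ ?_ ?_
  · exact IsHomogeneous.prod _ _ _ fun a _ => by simpa using (isHomogeneous_X k a).pow (b a).toNat
  · exact IsHomogeneous.prod _ _ _ fun a _ => by simpa using (isHomogeneous_X k a).pow (-b a).toNat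
  · exact Submonoid.prod_mem _ fun a ha =>
      Submonoid.pow_mem _ (Submonoid.subset_closure (Set.mem_image_of_mem _ ha)) _
  · push_cast
    rw [← Finset.sum_sub_distrib]
    refine Finset.sum_congr rfl fun a _ => ?_
    omega
  · rw [← cechMonomial_natCast, ← cechMonomial_natCast,
      ← cechMonomial_add]
    refine cechMonomial_congr I fun a _ => ?_
    rw [Pi.add_apply]
    omega

variable {H : SimpleGraph V}

theorem X_mul_X_mem_edgeIdeal {a b : V} (hab : H.Adj a b) :
    X a * X b ∈ edgeIdeal k H := by
  rw [edgeIdeal]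
  exact Ideal.subset_span ⟨a, b, hab, rfl⟩

/-- The relation $x_ax_b=0$ with $x_b$ inverted. -/
theorem cechMk_X_eq_zero {U : Finset V} {a b : V} (hab : H.Adj a b) (hb : b ∈ U) :
    cechMk (edgeIdeal k H) U (X a) = 0 := by
  have h : cechMk (edgeIdeal k H) U (X a * X b) = 0 := by
    rw [cechMk_apply, Ideal.Quotient.eq_zero_iff_mem.2 (X_mul_X_mem_edgeIdeal hab),
      map_zero]
  rw [map_mul] at h
  exact (isUnit_cechMk_X _ hb).mul_left_eq_zero.1 h

theorem subsingleton_cechRing {U : Finset V} {a b : V} (hab : H.Adj a b) (ha : a ∈ U)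
    (hb : b ∈ U) : Subsingleton (CechRing (edgeIdeal k H) U) := by
  have := isUnit_cechMk_X (edgeIdeal k H) ha
  rw [cechMk_X_eq_zero hab hb, isUnit_zero_iff] at this
  exact subsingleton_of_zero_eq_one this

/-- If `U` is a maximal independent set, then the degree `l` part is spanned by Laurent
monomials. -/
theorem cechDegree_le_span {U : Finset V} (hU : ∀ a ∉ U, ∃ b ∈ U, H.Adj a b) (l : ℤ) :
    cechDegree (edgeIdeal k H) U l ≤ Submodule.span k
      {c | ∃ b : V → ℤ, (∀ a ∉ U, b a = 0) ∧ ∑ a ∈ U, b a = l ∧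
        c = cechMonomial (edgeIdeal k H) U b} := by
  classical
  refine Submodule.span_le.2 ?_
  rintro y ⟨f, s, p, q, hf, hs, hsU, hl, e⟩
  -- the denominator is a monomial
  have key : ∃ m : V → ℕ, s = ∏ a ∈ U, X a ^ m a := by
    clear e hs
    induction hsU using Submonoid.closure_induction with
    | mem s hs =>
      obtain ⟨a, ha, rfl⟩ := hs
      refine ⟨Pi.single a 1, ?_⟩
      rw [Finset.prod_eq_single a]
      · simp
      · intro b _ hb
        simp [hb]
      · exact fun h => absurd ha h
    | one => exact ⟨0, by simp⟩
    | mul s t _ _ ihs iht =>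
      obtain ⟨m, rfl⟩ := ihs
      obtain ⟨n, rfl⟩ := iht
      exact ⟨m + n, by simp [pow_add, Finset.prod_mul_distrib]⟩
  obtain ⟨m, rfl⟩ := key
  have hq : q = ∑ a ∈ U, m a := by
    refine hs.inj_right ?_ (Finset.prod_ne_zero_iff.2 fun a _ => pow_ne_zero _ (X_ne_zero a))
    exact IsHomogeneous.prod _ _ _ fun a _ => by simpa using (isHomogeneous_X k a).pow (m a)
  rw [← cechMk_apply, ← cechMk_apply, ← cechMonomial_natCast] at e
  have hy : y = cechMk (edgeIdeal k H) U f *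
      cechMonomial (edgeIdeal k H) U (fun a => -(m a : ℤ)) := by
    rw [← e, mul_assoc, ← cechMonomial_add]
    have : cechMonomial (edgeIdeal k H) U ((fun a => (m a : ℤ)) + fun a => -(m a : ℤ)) = 1 := by
      rw [← cechMonomial_zero]
      congr 1
      ext a
      simp
    rw [this, mul_one]
  rw [SetLike.mem_coe, hy, f.as_sum, map_sum, Finset.sum_mul]
  refine Submodule.sum_mem _ fun d hd => ?_
  -- A term of the numerator supported on `U` gives a Laurent monomial; any other contains a
  -- variable adjacent to `U`, which is zero in the localization.
  by_cases hdU : ∀ a ∉ U, d a = 0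
  · have hmon : monomial d (coeff d f) = coeff d f • ∏ a ∈ U, (X a : MvPolynomial V k) ^ d a := by
      rw [monomial_eq, smul_eq_C_mul, Finsupp.prod_of_support_subset _ _ _ (by simp)]
      intro a ha
      by_contra haU
      exact (Finsupp.mem_support_iff.1 ha) (hdU a haU)
    rw [hmon, map_smul, smul_mul_assoc, ← cechMonomial_natCast, ← cechMonomial_add]
    refine Submodule.smul_mem _ _ (Submodule.subset_span
      ⟨fun a => if a ∈ U then (d a : ℤ) - m a else 0, fun a ha => if_neg ha, ?_, ?_⟩)
    · rw [Finset.sum_congr rfl fun a ha => if_pos ha, Finset.sum_sub_distrib, ← hl, hq]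
      have : d.degree = p := by
        have := hf (mem_support_iff.1 hd)
        rwa [show Finsupp.weight 1 d = d.degree from
          (DFunLike.congr_fun Finsupp.degree_eq_weight_one d).symm] at this
      have hd' : ∑ a ∈ U, d a = p := by
        rw [← this, Finsupp.degree_apply]
        refine (Finset.sum_subset (fun a ha => ?_) fun a _ ha => Finsupp.notMem_support_iff.1 ha).symm
        by_contra haU
        exact (Finsupp.mem_support_iff.1 ha) (hdU a haU)
      rw [← hd']
      push_cast
      rfl
    · refine cechMonomial_congr _ fun a ha => ?_
      rw [if_pos ha, Pi.add_apply, sub_eq_add_neg]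
  · push Not at hdU
    obtain ⟨a, ha, hda⟩ := hdU
    obtain ⟨b, hb, hab⟩ := hU a ha
    have : cechMk (edgeIdeal k H) U (monomial d (coeff d f)) = 0 := by
      have hd' : d = Finsupp.single a 1 + (d - Finsupp.single a 1) := by
        rw [add_tsub_cancel_of_le]
        rw [Finsupp.single_le_iff]
        omega
      rw [hd', ← one_mul (coeff _ f), ← monomial_mul, map_mul]
      rw [show (monomial (Finsupp.single a 1) (1 : k)) = X a from rfl, cechMk_X_eq_zero hab hb,
        zero_mul]
    rw [this, zero_mul]
    exact zero_mem _

end CechRing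

/-! ## Coefficients of elements of the Čech rings -/

section Laurent

variable {k : Type u} [Field k] {V : Type u} [DecidableEq V]

variable (k) in
/-- The map to the Laurent polynomial ring that sets the variables outside `U` to zero. -/
noncomputable def laurentHom (U : Finset V) : MvPolynomial V k →ₐ[k] AddMonoidAlgebra k (V → ℤ) :=
  aeval fun a => if a ∈ U then AddMonoidAlgebra.single (Pi.single a 1) 1 else 0

theorem laurentHom_monomial {U : Finset V} {e : V →₀ ℕ} (he : ∀ a ∉ U, e a = 0) (c : k) :
    laurentHom k U (monomial e c) = AddMonoidAlgebra.single (fun a => (e a : ℤ)) c := by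
  rw [laurentHom, aeval_monomial, Finsupp.prod_of_support_subset (s := U) _ _ _ (by simp)]
  · have h : ∀ a ∈ U, (if a ∈ U then AddMonoidAlgebra.single (Pi.single a 1) 1 else 0 :
        AddMonoidAlgebra k (V → ℤ)) ^ e a =
        AddMonoidAlgebra.single (e a • (Pi.single a 1 : V → ℤ)) 1 := fun a ha => by
      rw [if_pos ha, AddMonoidAlgebra.single_pow, one_pow]
    rw [Finset.prod_congr rfl h, AddMonoidAlgebra.prod_single, Finset.prod_const_one,
      AddMonoidAlgebra.coe_algebraMap, Function.comp_apply, AddMonoidAlgebra.single_mul_single,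
      zero_add, mul_one]
    congr 1
    ext a
    rw [Finset.sum_apply]
    by_cases ha : a ∈ U
    · rw [Finset.sum_eq_single a]
      · simp
      · intro b _ hb
        simp [hb.symm]
      · exact fun h => absurd ha h
    · rw [he a ha]
      refine Finset.sum_eq_zero fun b hb => ?_
      have : a ≠ b := fun h => ha (h ▸ hb)
      simp [this]
  · intro a ha
    by_contra haU
    exact (Finsupp.mem_support_iff.1 ha) (he a haU)

theorem laurentHom_X_of_notMem {U : Finset V} {a : V} (ha : a ∉ U) : laurentHom k U (X a) = 0 := by
  rw [laurentHom, aeval_X, if_neg ha]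

theorem laurentHom_monomial_eq_zero {U : Finset V} {e : V →₀ ℕ} {a : V} (ha : a ∉ U)
    (hea : e a ≠ 0) (c : k) : laurentHom k U (monomial e c) = 0 := by
  have he : e = Finsupp.single a 1 + (e - Finsupp.single a 1) := by
    rw [add_tsub_cancel_of_le]
    rw [Finsupp.single_le_iff]
    omega
  rw [he, ← one_mul c, ← monomial_mul, map_mul,
    show (monomial (Finsupp.single a 1) (1 : k)) = X a from rfl, laurentHom_X_of_notMem ha, zero_mul]

/-- Only the monomial of `f` with exponents `b` contributes, and it involves no variable outside `U`
or outside `U'`, so neither map kills it. -/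
theorem coeff_laurentHom_congr {U U' : Finset V} {b : V → ℤ} (hb : ∀ a ∉ U, b a = 0)
    (hb' : ∀ a ∉ U', b a = 0) (f : MvPolynomial V k) :
    (laurentHom k U f).coeff b = (laurentHom k U' f).coeff b := by
  have key : ∀ {U : Finset V}, (∀ a ∉ U, b a = 0) → ∀ (e : V →₀ ℕ) (c : k),
      (laurentHom k U (monomial e c)).coeff b =
        (AddMonoidAlgebra.single (fun a => (e a : ℤ)) c : AddMonoidAlgebra k (V → ℤ)).coeff b := by
    intro U hb e c
    by_cases he : ∀ a ∉ U, e a = 0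
    · rw [laurentHom_monomial he]
    · push Not at he
      obtain ⟨a, ha, hea⟩ := he
      rw [laurentHom_monomial_eq_zero ha hea, AddMonoidAlgebra.coeff_single,
        Finsupp.single_eq_of_ne, AddMonoidAlgebra.coeff_zero, Finsupp.zero_apply]
      rintro rfl
      exact hea (Int.natCast_eq_zero.1 (hb a ha))
  induction f using MvPolynomial.induction_on' with
  | monomial e c => rw [key hb, key hb']
  | add f g hf hg =>
    rw [map_add, map_add, AddMonoidAlgebra.coeff_add, AddMonoidAlgebra.coeff_add,
      Finsupp.add_apply, Finsupp.add_apply, hf, hg]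

theorem coeff_laurentHom_eq_zero {U : Finset V} {b : V → ℤ} {a : V} (ha : b a < 0)
    (f : MvPolynomial V k) : (laurentHom k U f).coeff b = 0 := by
  induction f using MvPolynomial.induction_on' with
  | monomial e c =>
    by_cases he : ∀ a ∉ U, e a = 0
    · rw [laurentHom_monomial he, AddMonoidAlgebra.coeff_single, Finsupp.single_eq_of_ne]
      rintro rfl
      exact absurd ha (by simp)
    · push Not at he
      obtain ⟨a, ha, hea⟩ := he
      rw [laurentHom_monomial_eq_zero ha hea, AddMonoidAlgebra.coeff_zero, Finsupp.zero_apply]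
  | add f g hf hg => rw [map_add, AddMonoidAlgebra.coeff_add, Finsupp.add_apply, hf, hg, add_zero]

theorem coeff_mul_single_add {V : Type u} (x : AddMonoidAlgebra k (V → ℤ)) (b m : V → ℤ) :
    (x * AddMonoidAlgebra.single m 1).coeff (b + m) = x.coeff b := by
  rw [AddMonoidAlgebra.coeff_mul_single_eq_coeff_mul b (fun _ _ => add_left_inj m), mul_one]

variable {H : SimpleGraph V}

/-- The extension of `laurentHom` to the localization, for an independent set `U`. -/
noncomputable def laurentLift {U : Finset V} (hU : ∀ a ∈ U, ∀ b ∈ U, ¬ H.Adj a b) :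
    CechRing (edgeIdeal k H) U →ₐ[k] AddMonoidAlgebra k (V → ℤ) :=
  IsLocalization.liftAlgHom (A := k) (R := MvPolynomial V k ⧸ edgeIdeal k H)
    (M := variableMonoid (edgeIdeal k H) U) (S := CechRing (edgeIdeal k H) U)
    (P := AddMonoidAlgebra k (V → ℤ))
    (f := Ideal.Quotient.liftₐ (edgeIdeal k H) (laurentHom k U) (by
      have : edgeIdeal k H ≤ RingHom.ker (laurentHom k U) := by
        rw [edgeIdeal, Ideal.span_le]
        rintro _ ⟨a, b, hab, rfl⟩
        rw [SetLike.mem_coe, RingHom.mem_ker, map_mul]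
        by_cases ha : a ∈ U
        · rw [laurentHom_X_of_notMem (a := b) fun hb => hU a ha b hb hab, mul_zero]
        · rw [laurentHom_X_of_notMem ha, zero_mul]
      exact fun f hf => this hf))
    (by
      rintro ⟨y, hy⟩
      induction hy using Submonoid.closure_induction with
      | mem y hy =>
        obtain ⟨a, ha, rfl⟩ := hy
        change IsUnit (laurentHom k U (X a))
        rw [laurentHom, aeval_X, if_pos (Finset.mem_coe.1 ha)]
        refine IsUnit.of_mul_eq_one (AddMonoidAlgebra.single (-Pi.single a 1) 1) ?_
        rw [AddMonoidAlgebra.single_mul_single, add_neg_cancel, one_mul,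
          AddMonoidAlgebra.one_def]
      | one => simp
      | mul y z _ _ hy hz =>
        rw [map_mul]
        exact hy.mul hz)

theorem laurentLift_cechMk {U : Finset V} (hU : ∀ a ∈ U, ∀ b ∈ U, ¬ H.Adj a b)
    (f : MvPolynomial V k) : laurentLift hU (cechMk (edgeIdeal k H) U f) = laurentHom k U f :=
  IsLocalization.lift_eq (M := variableMonoid (edgeIdeal k H) U) (S := CechRing (edgeIdeal k H) U)
    _ (Ideal.Quotient.mk (edgeIdeal k H) f)

/-- The coefficient of the Laurent monomial with exponents `b` (zero if `U` is not independent). -/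
noncomputable def laurentCoeff (k : Type u) [Field k] (H : SimpleGraph V) (b : V → ℤ)
    (U : Finset V) : CechRing (edgeIdeal k H) U →ₗ[k] k :=
  open scoped Classical in
  if hU : ∀ a ∈ U, ∀ b ∈ U, ¬ H.Adj a b then
    { toFun := fun y => (laurentLift hU y).coeff b
      map_add' := fun x y => by
        rw [map_add, AddMonoidAlgebra.coeff_add, Finsupp.add_apply]
      map_smul' := fun c x => by
        rw [map_smul, AddMonoidAlgebra.coeff_smul, Finsupp.smul_apply]; rfl }
  else 0

theorem laurentCoeff_apply (b : V → ℤ) {U : Finset V} (hU : ∀ a ∈ U, ∀ b ∈ U, ¬ H.Adj a b)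
    (y : CechRing (edgeIdeal k H) U) :
    laurentCoeff k H b U y = (laurentLift hU y).coeff b := by
  rw [laurentCoeff, dif_pos hU]; rfl

/-- Writing `y` as a fraction with a monomial denominator fixes a numerator and a shift that work
for every larger set, so statements about restrictions become statements about coefficients of one
polynomial. -/
theorem exists_laurentCoeff_cechRestrict (τ : Finset V) (y : CechRing (edgeIdeal k H) τ) :
    ∃ (f : MvPolynomial V k) (m : V → ℤ), (∀ a ∉ τ, m a = 0) ∧
      ∀ {U : Finset V} (h : τ ⊆ U) (_ : ∀ a ∈ U, ∀ b ∈ U, ¬ H.Adj a b) (b : V → ℤ),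
        laurentCoeff k H b U (cechRestrict _ h y) = (laurentHom k U f).coeff (b + m) := by
  obtain ⟨f, m, hm, e⟩ := exists_mul_cechMk_monomial _ y
  refine ⟨f, fun a => m a, fun a ha => by simp [hm a ha], fun {U} h hU b => ?_⟩
  have e' := congrArg (fun x => laurentLift hU (cechRestrict _ h x)) e
  simp only [map_mul, cechRestrict_cechMk, laurentLift_cechMk] at e'
  rw [laurentHom_monomial fun a ha => hm a fun h' => ha (h h')] at e'
  rw [laurentCoeff_apply b hU, ← e', coeff_mul_single_add]

theorem laurentCoeff_cechRestrict_congr {τ U U' : Finset V} (h : τ ⊆ U) (h' : τ ⊆ U')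
    (hU : ∀ a ∈ U, ∀ b ∈ U, ¬ H.Adj a b) (hU' : ∀ a ∈ U', ∀ b ∈ U', ¬ H.Adj a b) {b : V → ℤ}
    (hb : ∀ a ∉ τ, b a = 0) (y : CechRing (edgeIdeal k H) τ) :
    laurentCoeff k H b U (cechRestrict _ h y) = laurentCoeff k H b U' (cechRestrict _ h' y) := by
  obtain ⟨f, m, hm, e⟩ := exists_laurentCoeff_cechRestrict τ y
  rw [e h hU, e h' hU']
  refine coeff_laurentHom_congr (fun a ha => ?_) (fun a ha => ?_) f
  · rw [Pi.add_apply, hb a fun h'' => ha (h h''), hm a fun h'' => ha (h h''), add_zero]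
  · rw [Pi.add_apply, hb a fun h'' => ha (h' h''), hm a fun h'' => ha (h' h''), add_zero]

/-- Denominators over `τ` do not involve `a`, so a negative exponent at `a` cannot occur. -/
theorem laurentCoeff_cechRestrict_eq_zero {τ U : Finset V} (h : τ ⊆ U)
    (hU : ∀ a ∈ U, ∀ b ∈ U, ¬ H.Adj a b) {b : V → ℤ} {a : V} (ha : a ∉ τ) (hb : b a < 0)
    (y : CechRing (edgeIdeal k H) τ) : laurentCoeff k H b U (cechRestrict _ h y) = 0 := by
  obtain ⟨f, m, hm, e⟩ := exists_laurentCoeff_cechRestrict τ y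
  rw [e h hU]
  exact coeff_laurentHom_eq_zero (a := a) (by rwa [Pi.add_apply, hm a ha, add_zero]) f

-- Multiplying by the monomial formed from the negative parts of `c` leads to a genuine monomial,
-- whose image in the Laurent ring is known.
open scoped Classical in
theorem laurentCoeff_cechMonomial {U : Finset V} (hU : ∀ a ∈ U, ∀ b ∈ U, ¬ H.Adj a b)
    {b c : V → ℤ} (hc : ∀ a ∉ U, c a = 0) :
    laurentCoeff k H b U (cechMonomial _ U c) = if b = c then 1 else 0 := by
  have hmon : ∀ m : V → ℕ, (∀ a ∉ U, m a = 0) →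
      laurentLift hU (cechMonomial (edgeIdeal k H) U fun a => (m a : ℤ)) =
        AddMonoidAlgebra.single (fun a => (m a : ℤ)) 1 := by
    intro m hm
    have hsup : m.support ⊆ U := fun a ha => by
      by_contra haU
      exact ha (hm a haU)
    let e : V →₀ ℕ := Finsupp.ofSupportFinite m (U.finite_toSet.subset hsup)
    rw [cechMonomial_natCast, laurentLift_cechMk]
    rw [show (fun a => (m a : ℤ)) = fun a => (e a : ℤ) from rfl, ← laurentHom_monomial (U := U) hm,
      monomial_eq, C_1, one_mul, Finsupp.prod_of_support_subset (s := U) _ _ _ (by simp)]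
    · rfl
    · intro a ha
      exact hsup (Finsupp.mem_support_iff.1 ha)
  have e : cechMonomial (edgeIdeal k H) U c *
      cechMonomial (edgeIdeal k H) U (fun a => ((-c a).toNat : ℤ)) =
        cechMonomial (edgeIdeal k H) U (fun a => ((c a).toNat : ℤ)) := by
    rw [← cechMonomial_add]
    refine cechMonomial_congr _ fun a _ => ?_
    rw [Pi.add_apply]
    omega
  have e' := congrArg (laurentLift hU) e
  rw [map_mul, hmon _ fun a ha => by simp [hc a ha], hmon _ fun a ha => by simp [hc a ha]] at e'
  rw [laurentCoeff_apply b hU, ← coeff_mul_single_add _ b, e', AddMonoidAlgebra.coeff_single,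
    Finsupp.single_apply]
  congr 1
  rw [eq_iff_iff, funext_iff, funext_iff]
  refine forall_congr' fun a => ?_
  rw [Pi.add_apply]
  omega

end Laurent

/-! ## The top local cohomology of a clique-whiskered graph -/

section Differential

variable {k : Type u} [Field k] {V : Type u} [LinearOrder V] (I : Ideal (MvPolynomial V k))

theorem cechDifferential_apply (c : ∀ U : Finset V, CechRing I U) (U : Finset V) :
    cechDifferential I c U = ∑ a ∈ U, (-1 : k) ^ (U.filter (fun b => b < a)).card •
      cechRestrict I (U.erase_subset a) (c (U.erase a)) := by
  simp [cechDifferential]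

theorem cechRestrict_congr {V : Type u} (I : Ideal (MvPolynomial V k)) (c : ∀ U : Finset V, CechRing I U) {τ τ' U : Finset V} (e : τ = τ')
    (h : τ ⊆ U) (h' : τ' ⊆ U) : cechRestrict I h (c τ) = cechRestrict I h' (c τ') := by
  subst e; rfl

theorem filter_lt_insert (τ : Finset V) (u : V) :
    (insert u τ).filter (fun b => b < u) = τ.filter (fun b => b < u) := by
  rw [Finset.filter_insert, if_neg (lt_irrefl u)]

theorem cechDifferential_single [Fintype V] (τ : Finset V) (y : CechRing I τ) :
    cechDifferential I (Pi.single τ y) = ∑ u ∈ τᶜ, (-1 : k) ^ (τ.filter (fun b => b < u)).card •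
      Pi.single (insert u τ) (cechRestrict I (Finset.subset_insert u τ) y) := by
  funext U
  rw [cechDifferential_apply, Finset.sum_apply]
  by_cases hU : ∃ u ∉ τ, insert u τ = U
  · obtain ⟨u, hu, rfl⟩ := hU
    rw [Finset.sum_eq_single u, Finset.sum_eq_single u]
    · rw [filter_lt_insert, Pi.smul_apply, Pi.single_eq_same,
        cechRestrict_congr I _ (Finset.erase_insert hu) _ (Finset.subset_insert u τ),
        Pi.single_eq_same]
    · intro u' hu' hne
      rw [Pi.smul_apply, Pi.single_eq_of_ne, smul_zero]
      intro e
      have : u ∈ insert u' τ := e ▸ Finset.mem_insert_self u τ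
      rcases Finset.mem_insert.1 this with h | h
      · exact hne h.symm
      · exact hu h
    · intro h
      exact absurd (Finset.mem_compl.2 hu) h
    · intro a _ hne
      rw [Pi.single_eq_of_ne, map_zero, smul_zero]
      intro e
      exact hu (e ▸ Finset.mem_erase.2 ⟨hne.symm, Finset.mem_insert_self u τ⟩)
    · exact fun h => absurd (Finset.mem_insert_self u τ) h
  · push Not at hU
    rw [Finset.sum_eq_zero, Finset.sum_eq_zero]
    · intro u hu
      rw [Pi.smul_apply, Pi.single_eq_of_ne, smul_zero]
      exact fun e => hU u (Finset.mem_compl.1 hu) e.symm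
    · intro a ha
      rw [Pi.single_eq_of_ne, map_zero, smul_zero]
      intro e
      exact hU a (e ▸ Finset.notMem_erase a U) (e ▸ Finset.insert_erase ha)

theorem cechMk_mul_mem_cechDegree {V : Type u} (I : Ideal (MvPolynomial V k)) {U : Finset V}
    {g : MvPolynomial V k} {n : ℕ} (hg : g.IsHomogeneous n) {l : ℤ} {y : CechRing I U}
    (hy : y ∈ cechDegree I U l) : cechMk I U g * y ∈ cechDegree I U (n + l) := by
  induction hy using Submodule.span_induction with
  | mem y hy =>
    obtain ⟨f, s, p, q, hf, hs, hsU, hl, e⟩ := hy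
    refine mem_cechDegree I (hg.mul hf) hs hsU (by push_cast; omega) ?_
    rw [← cechMk_apply, ← cechMk_apply] at e
    rw [mul_assoc, e, map_mul]
  | zero => rw [mul_zero]; exact zero_mem _
  | add x y _ _ ihx ihy => rw [mul_add]; exact add_mem ihx ihy
  | smul c x _ ih => rw [mul_smul_comm]; exact Submodule.smul_mem _ c ih

theorem single_mem_cechCochains {U : Finset V} {l : ℤ} {y : CechRing I U}
    (hy : y ∈ cechDegree I U l) : Pi.single U y ∈ cechCochains I U.card l := by
  intro U'
  by_cases e : U' = U
  · subst e
    rw [Pi.single_eq_same]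
    exact ⟨hy, fun h => absurd rfl h⟩
  · rw [Pi.single_eq_of_ne e]
    exact ⟨zero_mem _, fun _ => rfl⟩

theorem cechDifferential_mem_cechCoboundaries {n : ℕ} {l : ℤ} {τ : Finset V} (hτ : τ.card + 1 = n)
    {y : CechRing I τ} (hy : y ∈ cechDegree I τ l) :
    cechDifferential I (Pi.single τ y) ∈ cechCoboundaries I n l := by
  subst hτ
  exact Submodule.mem_map_of_mem (single_mem_cechCochains I hy)

end Differential

/-! ### Independent sets with one vertex of every colour, and generators of the top local
cohomology. -/

namespace IsWhiskered

variable {k : Type u} [Field k] {V : Type u} {ι : Type v} {H : SimpleGraph V} {w : ι → V}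
  {col : V → ι}

theorem eq_of_col_eq (h : IsWhiskered H w col) {F : Finset V}
    (hF : ∀ a ∈ F, ∀ b ∈ F, ¬ H.Adj a b) {a b : V} (ha : a ∈ F) (hb : b ∈ F)
    (hab : col a = col b) : a = b := by
  by_contra hne
  exact hF a ha b hb (h.adj_of_col hne hab)

theorem card_le_of_independent [Fintype ι] (h : IsWhiskered H w col) {F : Finset V}
    (hF : ∀ a ∈ F, ∀ b ∈ F, ¬ H.Adj a b) : F.card ≤ Fintype.card ι := by
  rw [← Finset.card_univ]
  exact Finset.card_le_card_of_injOn col (fun _ _ => Finset.mem_univ _)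
    fun a ha b hb hab => h.eq_of_col_eq hF ha hb hab

theorem exists_mem_col_eq [Fintype ι] (h : IsWhiskered H w col) {F : Finset V}
    (hF : ∀ a ∈ F, ∀ b ∈ F, ¬ H.Adj a b) (hr : F.card = Fintype.card ι) (i : ι) :
    ∃ a ∈ F, col a = i := by
  classical
  have : F.image col = Finset.univ := by
    rw [← Finset.card_eq_iff_eq_univ, Finset.card_image_of_injOn, hr]
    exact fun a ha b hb hab => h.eq_of_col_eq hF ha hb hab
  have hi : i ∈ F.image col := this ▸ Finset.mem_univ i
  simpa using hi

/-- `F` meets the colour class of `a`, and colour classes are cliques. -/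
theorem exists_adj_of_notMem [Fintype ι] (h : IsWhiskered H w col) {F : Finset V}
    (hF : ∀ a ∈ F, ∀ b ∈ F, ¬ H.Adj a b) (hr : F.card = Fintype.card ι) :
    ∀ a ∉ F, ∃ b ∈ F, H.Adj a b := by
  intro a ha
  obtain ⟨b, hb, hab⟩ := h.exists_mem_col_eq hF hr (col a)
  exact ⟨b, hb, h.adj_of_col (fun e => ha (e ▸ hb)) hab.symm⟩

theorem independent_compl [Fintype V] [DecidableEq V] {C : Finset V} (hC : IsMinVertexCover H C) :
    ∀ a ∈ Cᶜ, ∀ b ∈ Cᶜ, ¬ H.Adj a b := by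
  intro a ha b hb hab
  rw [Finset.mem_compl] at ha hb
  exact (hC.prop hab).elim ha hb

theorem isMinVertexCover_compl [Fintype V] [DecidableEq V] [Fintype ι] (h : IsWhiskered H w col)
    {F : Finset V} (hF : ∀ a ∈ F, ∀ b ∈ F, ¬ H.Adj a b) (hr : F.card = Fintype.card ι) :
    IsMinVertexCover H Fᶜ := by
  rw [h.isMinVertexCover_iff]
  refine ⟨fun a b hab => ?_, fun i => ?_⟩
  · by_contra! hn
    simp only [Finset.mem_coe, Finset.mem_compl, not_not] at hn
    exact hF a hn.1 b hn.2 hab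
  · obtain ⟨a, ha, hi⟩ := h.exists_mem_col_eq hF hr i
    exact ⟨a, by simpa using ha, hi⟩

/-- The exponents of the monomials that form a basis of the top local cohomology. -/
structure IsBasicExponent [Fintype ι] (H : SimpleGraph V) (w : ι → V) (l : ℤ) (F : Finset V)
    (b : V → ℤ) : Prop where
  independent : ∀ u ∈ F, ∀ v ∈ F, ¬ H.Adj u v
  card : F.card = Fintype.card ι
  eq_zero : ∀ u ∉ F, b u = 0
  nonpos : ∀ u ∈ F, b u ≤ 0
  neg : ∀ i, w i ∈ F → b (w i) < 0
  sum : ∑ u ∈ F, b u = l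

section Span

theorem cechRing_eq_zero {F : Finset V} (hF : ¬ ∀ a ∈ F, ∀ b ∈ F, ¬ H.Adj a b)
    (y : CechRing (edgeIdeal k H) F) : y = 0 := by
  push Not at hF
  obtain ⟨a, ha, b, hb, hab⟩ := hF
  have := subsingleton_cechRing (k := k) hab ha hb
  exact Subsingleton.elim _ _

variable [Fintype V] [LinearOrder V] [Fintype ι]

variable (k) in
/-- The span of the basic monomials and of the coboundaries. -/
noncomputable def basicSpan (H : SimpleGraph V) (w : ι → V) (l : ℤ) :
    Submodule k (∀ U : Finset V, CechRing (edgeIdeal k H) U) :=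
  Submodule.span k {z | ∃ F b, IsBasicExponent H w l F b ∧
    z = Pi.single F (cechMonomial (edgeIdeal k H) F b)} ⊔
  cechCoboundaries (edgeIdeal k H) (Fintype.card ι) l

/-- The coboundary of `y` is the signed sum of its restrictions to the sets `τ ∪ {u}`, so when all
restrictions but one lie in the span, the last one does too. -/
theorem mem_basicSpan_of_differential {l : ℤ} {τ : Finset V} (hτ : τ.card + 1 = Fintype.card ι)
    {y : CechRing (edgeIdeal k H) τ} (hy : y ∈ cechDegree (edgeIdeal k H) τ l) {v : V}
    (hv : v ∉ τ) (hne : ∀ u ∉ τ, u ≠ v →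
      Pi.single (insert u τ) (cechRestrict (edgeIdeal k H) (Finset.subset_insert u τ) y) ∈
        basicSpan k H w l) :
    Pi.single (insert v τ) (cechRestrict (edgeIdeal k H) (Finset.subset_insert v τ) y) ∈
      basicSpan k H w l := by
  have hd : cechDifferential (edgeIdeal k H) (Pi.single τ y) ∈ basicSpan k H w l :=
    Submodule.mem_sup_right (cechDifferential_mem_cechCoboundaries _ hτ hy)
  rw [cechDifferential_single, ← Finset.add_sum_erase _ _ (Finset.mem_compl.2 hv),
    Submodule.add_mem_iff_left] at hd
  · exact (Submodule.smul_mem_iff _ (pow_ne_zero _ (neg_ne_zero.2 one_ne_zero))).1 hd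
  · refine Submodule.sum_mem _ fun u hu => Submodule.smul_mem _ _ (hne u ?_ ?_)
    · exact Finset.mem_compl.1 (Finset.mem_of_mem_erase hu)
    · exact Finset.ne_of_mem_erase hu

/-- As the exponent at `v` is positive, the monomial is already defined over `F ∖ {v}`. On every
other independent set of size $r$ obtained by adding a vertex, $x_v$ is zero because `v` has a
neighbour there; so the monomial is a coboundary up to sign. -/
theorem single_cechMonomial_mem_of_pos (h : IsWhiskered H w col) {l : ℤ} {F : Finset V}
    {b : V → ℤ} (hF : ∀ u ∈ F, ∀ v ∈ F, ¬ H.Adj u v) (hr : F.card = Fintype.card ι)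
    (hl : ∑ u ∈ F, b u = l) {v : V} (hv : v ∈ F) (hpos : 0 < b v) :
    Pi.single F (cechMonomial (edgeIdeal k H) F b) ∈ basicSpan k H w l := by
  obtain ⟨τ, hvτ, rfl⟩ : ∃ τ, v ∉ τ ∧ insert v τ = F :=
    ⟨F.erase v, Finset.notMem_erase v F, Finset.insert_erase hv⟩
  rw [Finset.card_insert_of_notMem hvτ] at hr
  rw [Finset.sum_insert hvτ] at hl
  obtain ⟨n, hn⟩ := Int.eq_ofNat_of_zero_le hpos.le
  have hres : ∀ u, cechRestrict (edgeIdeal k H) (Finset.subset_insert u τ)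
      (cechMk _ τ (X v ^ n) * cechMonomial _ τ (fun a => if a ∈ τ then b a else 0)) =
      cechMk _ (insert u τ) (X v ^ n) *
        cechMonomial _ (insert u τ) (fun a => if a ∈ τ then b a else 0) := fun u => by
    rw [map_mul, cechRestrict_cechMk, cechRestrict_cechMonomial]
    exact fun a _ ha => if_neg ha
  have hmem : cechMk (edgeIdeal k H) τ (X v ^ n) *
      cechMonomial _ τ (fun a => if a ∈ τ then b a else 0) ∈ cechDegree _ τ l := by
    have e : l = (n : ℤ) + ∑ a ∈ τ, if a ∈ τ then b a else 0 := by
      rw [← hl, hn, Finset.sum_congr rfl fun a ha => if_pos ha]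
    rw [e]
    exact cechMk_mul_mem_cechDegree _ (by simpa using (isHomogeneous_X k v).pow n)
      (cechMonomial_mem_cechDegree _ _ _)
  have := mem_basicSpan_of_differential (w := w) hr hmem hvτ (fun u hu huv => by
    rw [hres]
    by_cases hU : ∀ a ∈ insert u τ, ∀ b ∈ insert u τ, ¬ H.Adj a b
    · obtain ⟨c, hc, hvc⟩ := h.exists_adj_of_notMem hU
        (by rw [Finset.card_insert_of_notMem hu, hr]) v
        (by rw [Finset.mem_insert, not_or]; exact ⟨huv.symm, hvτ⟩)
      have hn0 : n ≠ 0 := by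
        rintro rfl
        rw [hn] at hpos
        exact lt_irrefl _ hpos
      rw [map_pow, cechMk_X_eq_zero hvc hc, zero_pow hn0, zero_mul, Pi.single_zero]
      exact zero_mem _
    · rw [cechRing_eq_zero hU (cechMk (edgeIdeal k H) (insert u τ) (X v ^ n) * _),
        Pi.single_zero]
      exact zero_mem _)
  rw [hres] at this
  convert this using 2
  have e : (X v ^ n : MvPolynomial V k) =
      ∏ a ∈ insert v τ, X a ^ (if a = v then n else 0) := by
    rw [Finset.prod_insert hvτ, if_pos rfl, Finset.prod_eq_one, mul_one]
    intro a ha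
    rw [if_neg (show a ≠ v from fun e => hvτ (e ▸ ha)), pow_zero]
  rw [e, ← cechMonomial_natCast, ← cechMonomial_add]
  refine cechMonomial_congr _ fun a ha => ?_
  rw [Pi.add_apply]
  rcases Finset.mem_insert.1 ha with rfl | ha
  · rw [if_pos rfl, if_neg hvτ, hn, add_zero]
  · rw [if_neg (show a ≠ v from fun e => hvτ (e ▸ ha)), if_pos ha, Nat.cast_zero, zero_add]

/-- Induction on the number of whiskers in `F`. If the exponent at a whisker `w i` is zero, the
monomial is defined over `F ∖ {w i}`, and a coboundary trades it for the same monomial on sets where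
a non-whisker of colour `i` takes the place of `w i`. -/
theorem single_cechMonomial_mem_basicSpan (h : IsWhiskered H w col) {l : ℤ} (n : ℕ) :
    ∀ (F : Finset V) (b : V → ℤ), (∀ u ∈ F, ∀ v ∈ F, ¬ H.Adj u v) → F.card = Fintype.card ι →
      (∀ u ∉ F, b u = 0) → ∑ u ∈ F, b u = l →
      (Finset.univ.filter fun i => w i ∈ F).card = n →
      Pi.single F (cechMonomial (edgeIdeal k H) F b) ∈ basicSpan k H w l := by
  induction n using Nat.strong_induction_on with
  | _ n ih =>
    intro F b hF hr hb hl hn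
    by_cases hpos : ∃ v ∈ F, 0 < b v
    · obtain ⟨v, hv, hpos⟩ := hpos
      exact h.single_cechMonomial_mem_of_pos hF hr hl hv hpos
    push Not at hpos
    by_cases hz : ∃ i, w i ∈ F ∧ b (w i) = 0
    · obtain ⟨i, hi, hbi⟩ := hz
      obtain ⟨τ, hiτ, rfl⟩ : ∃ τ, w i ∉ τ ∧ insert (w i) τ = F :=
        ⟨F.erase (w i), Finset.notMem_erase _ F, Finset.insert_erase hi⟩
      rw [Finset.card_insert_of_notMem hiτ] at hr
      rw [Finset.sum_insert hiτ, hbi, zero_add] at hl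
      have hbτ : ∀ u ∉ τ, b u = 0 := fun u hu => by
        by_cases e : u = w i
        · rw [e, hbi]
        · exact hb u (by rw [Finset.mem_insert, not_or]; exact ⟨e, hu⟩)
      have hres : ∀ u, cechRestrict (edgeIdeal k H) (Finset.subset_insert u τ)
          (cechMonomial _ τ b) = cechMonomial _ (insert u τ) b := fun u =>
        cechRestrict_cechMonomial _ _ fun a _ ha => hbτ a ha
      have := mem_basicSpan_of_differential (w := w) hr
        (hl ▸ cechMonomial_mem_cechDegree (edgeIdeal k H) τ b) hiτ (fun u hu hui => by
        rw [hres]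
        by_cases hU : ∀ a ∈ insert u τ, ∀ b ∈ insert u τ, ¬ H.Adj a b
        · have hr' : (insert u τ).card = Fintype.card ι := by
            rw [Finset.card_insert_of_notMem hu, hr]
          obtain ⟨c, hc, hci⟩ := h.exists_mem_col_eq hU hr' i
          have hcu : c = u := by
            rcases Finset.mem_insert.1 hc with e | hc
            · exact e
            · refine absurd ?_ hiτ
              rw [← h.eq_of_col_eq hF (Finset.mem_insert_of_mem hc) hi (by rw [hci, h.col_w])]
              exact hc
          subst hcu
          refine ih _ ?_ _ b hU hr' (fun a ha => hbτ a fun h' => ha (Finset.mem_insert_of_mem h'))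
            (by rw [Finset.sum_insert hu, hbτ _ hu, zero_add, hl]) rfl
          rw [← hn]
          refine Finset.card_lt_card ?_
          rw [Finset.ssubset_iff_of_subset]
          · refine ⟨i, by simp, ?_⟩
            simp [hiτ, hui.symm]
          · intro j hj
            simp only [Finset.mem_filter, Finset.mem_univ, true_and, Finset.mem_insert] at hj ⊢
            rcases hj with hj | hj
            · refine absurd ?_ hui
              rw [← hj, h.w_inj, ← hci, ← hj, h.col_w]
            · exact Or.inr hj
        · rw [cechRing_eq_zero hU (cechMonomial (edgeIdeal k H) (insert u τ) b), Pi.single_zero]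
          exact zero_mem _)
      rwa [hres] at this
    · push Not at hz
      refine Submodule.mem_sup_left (Submodule.subset_span ⟨F, b, ⟨hF, hr, hb, hpos, ?_, hl⟩, rfl⟩)
      exact fun i hi => lt_of_le_of_ne (hpos _ hi) (hz i hi)

theorem cechCochains_le_basicSpan (h : IsWhiskered H w col) (l : ℤ) :
    cechCochains (edgeIdeal k H) (Fintype.card ι) l ≤ basicSpan k H w l := by
  intro c hc
  rw [← Finset.univ_sum_single c]
  refine Submodule.sum_mem _ fun F _ => ?_
  by_cases hr : F.card = Fintype.card ι
  · by_cases hF : ∀ a ∈ F, ∀ b ∈ F, ¬ H.Adj a b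
    · have hmem := cechDegree_le_span (h.exists_adj_of_notMem hF hr) l (hc F).1
      generalize c F = y at hmem
      induction hmem using Submodule.span_induction with
      | mem y hy =>
        obtain ⟨b, hb, hl, rfl⟩ := hy
        exact h.single_cechMonomial_mem_basicSpan _ F b hF hr hb hl rfl
      | zero => rw [Pi.single_zero]; exact zero_mem _
      | add x y _ _ hx hy => rw [Pi.single_add]; exact add_mem hx hy
      | smul t x _ hx => rw [Pi.single_smul]; exact Submodule.smul_mem _ t hx
    · rw [cechRing_eq_zero hF (c F), Pi.single_zero]
      exact zero_mem _
  · rw [(hc F).2 hr, Pi.single_zero]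
    exact zero_mem _

end Span

end IsWhiskered

/-! ### Functionals dual to the basic monomials. -/

namespace IsWhiskered

section Functional

variable (k : Type u) [Field k] {V : Type u} [LinearOrder V] {ι : Type v} (H : SimpleGraph V)
  (w : ι → V) (col : V → ι)

/-- The sign of the ordering of `F` relative to the ordering of the colours by `w`. -/
def orderSign (F : Finset V) : k :=
  ∏ a ∈ F, ∏ b ∈ F, if a < b ∧ w (col b) < w (col a) then -1 else 1

/-- The vertices of `T` are replaced by the whisker vertices of the same colours. -/
def toWhisker (T : Finset V) (a : V) : V := if a ∈ T then w (col a) else a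

open scoped Classical in
/-- The functional on cochains that detects the class of a basic monomial. -/
noncomputable def basicFunctional (F : Finset V) (b : V → ℤ) :
    (∀ U : Finset V, CechRing (edgeIdeal k H) U) →ₗ[k] k :=
  ∑ T ∈ (F.filter fun a => b a = 0).powerset,
    ((-1) ^ T.card * orderSign k w col (F.image (toWhisker w col T))) •
      (laurentCoeff k H b (F.image (toWhisker w col T)) ∘ₗ
        LinearMap.proj (F.image (toWhisker w col T)))

variable {k H w col}

theorem orderSign_ne_zero (F : Finset V) : orderSign k w col F ≠ 0 := by
  refine Finset.prod_ne_zero_iff.2 fun a _ => Finset.prod_ne_zero_iff.2 fun b _ => ?_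
  split_ifs
  · exact neg_ne_zero.2 one_ne_zero
  · exact one_ne_zero

/-- The right-hand side depends on `u` only through its colour. Normalised by `orderSign`, the Čech
sign at `τ ∪ {u}` is therefore the same for all `u` of one colour. -/
theorem orderSign_insert {τ : Finset V} {u : V} (hu : u ∉ τ) (hcol : ∀ b ∈ τ, w (col b) ≠ w (col u)) :
    orderSign k w col (insert u τ) * (-1) ^ (τ.filter fun b => b < u).card =
      orderSign k w col τ * ∏ b ∈ τ, if w (col b) < w (col u) then -1 else 1 := by
  have h1 : ((-1 : k)) ^ (τ.filter fun b => b < u).card = ∏ b ∈ τ, if b < u then -1 else 1 := by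
    rw [Finset.prod_ite, Finset.prod_const, Finset.prod_const_one, mul_one]
  rw [h1, orderSign, orderSign, Finset.prod_insert hu, Finset.prod_insert hu,
    if_neg (fun h => lt_irrefl _ h.1), one_mul]
  simp_rw [Finset.prod_insert hu]
  rw [Finset.prod_mul_distrib]
  -- Factor by factor: for each `x ∈ τ` there are four cases, according to the order of `x` and `u`
  -- and to that of their whiskers.
  have key : (∏ b ∈ τ, if w (col b) < w (col u) then (-1 : k) else 1) =
      (∏ x ∈ τ, if u < x ∧ w (col x) < w (col u) then -1 else 1) *
        (∏ x ∈ τ, if x < u ∧ w (col u) < w (col x) then -1 else 1) *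
          ∏ b ∈ τ, if b < u then -1 else 1 := by
    rw [← Finset.prod_mul_distrib, ← Finset.prod_mul_distrib]
    refine Finset.prod_congr rfl fun x hx => ?_
    have hne : x ≠ u := fun e => hu (e ▸ hx)
    rcases lt_or_gt_of_ne hne with h | h <;> rcases lt_or_gt_of_ne (hcol x hx) with h' | h' <;>
      simp [h, h', h.not_gt, h'.not_gt]
  rw [key]
  ring

theorem IsBasicExponent.notMem_range {V : Type u} {H : SimpleGraph V} {w : ι → V} {F : Finset V}
    {b : V → ℤ} {l : ℤ} [Fintype ι] (hb : IsBasicExponent H w l F b) {u : V} (hu : u ∈ F)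
    (hbu : b u = 0) : u ∉ Set.range w := by
  rintro ⟨i, rfl⟩
  exact (hb.neg i hu).ne hbu

variable {F : Finset V} {b : V → ℤ} {l : ℤ} {T : Finset V}

theorem col_toWhisker (h : IsWhiskered H w col) (u : V) : col (toWhisker w col T u) = col u := by
  rw [toWhisker]
  split_ifs
  · exact h.col_w _
  · rfl

theorem injOn_toWhisker (h : IsWhiskered H w col) (hF : ∀ u ∈ F, ∀ v ∈ F, ¬ H.Adj u v) :
    Set.InjOn (toWhisker w col T) F := by
  intro u hu v hv e
  refine h.eq_of_col_eq hF hu hv ?_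
  rw [← col_toWhisker (T := T) h u, ← col_toWhisker (T := T) h v, e]

/-- A whisker is adjacent only to non-whiskers of its colour, while the only vertex of its colour in
the new set is the whisker itself. -/
theorem independent_toWhisker (h : IsWhiskered H w col) (hF : ∀ u ∈ F, ∀ v ∈ F, ¬ H.Adj u v) :
    ∀ u ∈ F.image (toWhisker w col T), ∀ v ∈ F.image (toWhisker w col T), ¬ H.Adj u v := by
  have key : ∀ u v, u ∈ F → v ∈ F → u ∈ T →
      ¬ H.Adj (toWhisker w col T u) (toWhisker w col T v) := by
    intro u v hu hv huT hadj
    rw [toWhisker, if_pos huT, h.adj_w] at hadj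
    have huv := h.eq_of_col_eq hF hv hu (by rw [← h.col_toWhisker (T := T), hadj.2])
    subst huv
    refine hadj.1 ⟨col v, ?_⟩
    rw [toWhisker, if_pos huT]
  intro x hx y hy hxy
  obtain ⟨u, hu, rfl⟩ := Finset.mem_image.1 hx
  obtain ⟨v, hv, rfl⟩ := Finset.mem_image.1 hy
  by_cases huT : u ∈ T
  · exact key u v hu hv huT hxy
  by_cases hvT : v ∈ T
  · exact key v u hv hu hvT hxy.symm
  rw [toWhisker, if_neg huT, toWhisker, if_neg hvT] at hxy
  exact hF u hu v hv hxy

theorem toWhisker_of_notMem {u : V} (hu : u ∉ T) : toWhisker w col T u = u := if_neg hu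

theorem toWhisker_of_mem {u : V} (hu : u ∈ T) : toWhisker w col T u = w (col u) := if_pos hu

/-- The functionals vanish on coboundaries. -/
theorem basicFunctional_cechDifferential [Fintype ι] (h : IsWhiskered H w col)
    (hb : IsBasicExponent H w l F b) (c : ∀ U : Finset V, CechRing (edgeIdeal k H) U) :
    basicFunctional k H w col F b (cechDifferential (edgeIdeal k H) c) = 0 := by
  classical
  set σ := F.filter fun a => b a = 0 with hσ
  let D : Finset V → V → k := fun U u => (-1) ^ (U.filter fun b => b < u).card *
    laurentCoeff k H b U (cechRestrict (edgeIdeal k H) (U.erase_subset u) (c (U.erase u)))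
  let A : Finset V → V → k := fun T u =>
    (-1) ^ T.card * orderSign k w col (F.image (toWhisker w col T)) *
      D (F.image (toWhisker w col T)) (toWhisker w col T u)
  have hD : ∀ U, laurentCoeff k H b U (cechDifferential (edgeIdeal k H) c U) = ∑ u ∈ U, D U u := by
    intro U
    rw [cechDifferential_apply, map_sum]
    exact Finset.sum_congr rfl fun u _ => by rw [map_smul, smul_eq_mul]
  have hA : basicFunctional k H w col F b (cechDifferential (edgeIdeal k H) c) =
      ∑ T ∈ σ.powerset, ∑ u ∈ F, A T u := by
    rw [basicFunctional, LinearMap.sum_apply]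
    refine Finset.sum_congr rfl fun T _ => ?_
    rw [LinearMap.smul_apply, LinearMap.comp_apply, LinearMap.proj_apply, hD, smul_eq_mul,
      Finset.sum_image (h.injOn_toWhisker hb.independent), Finset.mul_sum]
  -- A vertex of `F` outside `σ` has a negative exponent, and the component of `c` at a set without
  -- that vertex contains no negative power of it.
  have hA0 : ∀ T ∈ σ.powerset, ∑ u ∈ F, A T u = ∑ u ∈ σ, A T u := by
    intro T hT
    refine (Finset.sum_subset (Finset.filter_subset _ _) fun u hu huσ => ?_).symm
    have hbu : b u ≠ 0 := fun e => huσ (Finset.mem_filter.2 ⟨hu, e⟩)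
    have huT : u ∉ T := fun hu' => huσ (Finset.mem_powerset.1 hT hu')
    have : D (F.image (toWhisker w col T)) (toWhisker w col T u) = 0 := by
      rw [toWhisker_of_notMem huT]
      simp only [D]
      rw [laurentCoeff_cechRestrict_eq_zero _ (h.independent_toWhisker hb.independent)
        (Finset.notMem_erase u _) (lt_of_le_of_ne (hb.nonpos u hu) hbu), mul_zero]
    simp only [A, this, mul_zero]
  rw [hA, Finset.sum_congr rfl hA0, Finset.sum_comm]
  refine Finset.sum_eq_zero fun x hx => ?_
  have hxF : x ∈ F := (Finset.mem_filter.1 hx).1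
  have hxw : x ∉ Set.range w := hb.notMem_range hxF (Finset.mem_filter.1 hx).2
  -- Pair `T` with `T ∪ {x}`. Removing `x`, respectively its whisker, leads to the same set `τ`, and
  -- the factors $(-1)^{|T|}$ make the two contributions cancel.
  rw [← Finset.insert_erase hx, Finset.sum_powerset_insert (Finset.notMem_erase x σ),
    ← Finset.sum_add_distrib]
  refine Finset.sum_eq_zero fun T hT => ?_
  rw [Finset.mem_powerset] at hT
  have hxT : x ∉ T := fun hx' => Finset.notMem_erase x σ (hT hx')
  set τ := (F.erase x).image (toWhisker w col T) with hτ
  have hcolτ : ∀ v ∈ τ, col v ≠ col x := by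
    intro v hv
    obtain ⟨u, hu, rfl⟩ := Finset.mem_image.1 hv
    rw [h.col_toWhisker]
    exact fun e => (Finset.ne_of_mem_erase hu)
      (h.eq_of_col_eq hb.independent (Finset.mem_of_mem_erase hu) hxF e)
  have e1 : F.image (toWhisker w col T) = insert x τ := by
    conv_lhs => rw [← Finset.insert_erase hxF]
    rw [Finset.image_insert, toWhisker_of_notMem hxT]
  have e2 : F.image (toWhisker w col (insert x T)) = insert (w (col x)) τ := by
    conv_lhs => rw [← Finset.insert_erase hxF]
    rw [Finset.image_insert, toWhisker_of_mem (Finset.mem_insert_self x T)]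
    congr 1
    refine Finset.image_congr fun u hu => ?_
    have : u ≠ x := Finset.ne_of_mem_erase hu
    simp only [toWhisker, Finset.mem_insert, this, false_or]
  have hx1 : x ∉ τ := fun h' => hcolτ x h' rfl
  have hx2 : w (col x) ∉ τ := fun h' => hcolτ _ h' (h.col_w _)
  -- The exponents are supported on `τ`, so the restrictions of `c τ` to the two larger sets have
  -- the same coefficient at `b`.
  have hbτ : ∀ u ∉ τ, b u = 0 := by
    intro u hu
    by_contra hbu
    have huF : u ∈ F := by
      by_contra huF
      exact hbu (hb.eq_zero u huF)
    have huT : u ∉ T := fun h' =>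
      hbu (Finset.mem_filter.1 (Finset.mem_of_mem_erase (hT h'))).2
    refine hu (Finset.mem_image.2 ⟨u, Finset.mem_erase.2 ⟨?_, huF⟩, toWhisker_of_notMem huT⟩)
    rintro rfl
    exact hbu (Finset.mem_filter.1 hx).2
  have hcoef : ∀ u ∉ τ, D (insert u τ) u = (-1) ^ (τ.filter fun b => b < u).card *
      laurentCoeff k H b (insert u τ)
        (cechRestrict (edgeIdeal k H) (Finset.subset_insert u τ) (c τ)) := by
    intro u hu
    simp only [D]
    rw [filter_lt_insert, cechRestrict_congr _ c (Finset.erase_insert hu) _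
      (Finset.subset_insert u τ)]
  have hind1 := e1 ▸ h.independent_toWhisker (T := T) hb.independent
  have hind2 := e2 ▸ h.independent_toWhisker (T := insert x T) hb.independent
  have hs1 := orderSign_insert (k := k) (w := w) (col := col) hx1
    fun v hv e => hcolτ v hv (h.injective e)
  have hs2 := orderSign_insert (k := k) (w := w) (col := col) hx2 fun v hv e => hcolτ v hv (by
    rw [h.injective e, h.col_w])
  rw [h.col_w] at hs2
  simp only [A]
  rw [e1, e2, toWhisker_of_notMem hxT, toWhisker_of_mem (Finset.mem_insert_self x T),
    hcoef x hx1, hcoef _ hx2, laurentCoeff_cechRestrict_congr _ (Finset.subset_insert x τ) hind2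
      hind1 hbτ, Finset.card_insert_of_notMem hxT, ← mul_assoc, ← mul_assoc,
    mul_assoc (_ ^ _) (orderSign _ _ _ _), mul_assoc (_ ^ _) (orderSign _ _ _ _), hs1, hs2, pow_succ]
  ring

/-- The functionals are dual to the basic monomials. -/
theorem basicFunctional_single_eq_zero [Fintype ι] (h : IsWhiskered H w col)
    (hb : IsBasicExponent H w l F b) {F' : Finset V} {b' : V → ℤ}
    (hb' : IsBasicExponent H w l F' b') (hne : ¬ (F = F' ∧ b = b')) :
    basicFunctional k H w col F b (Pi.single F' (cechMonomial (edgeIdeal k H) F' b')) = 0 := by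
  classical
  rw [basicFunctional, LinearMap.sum_apply]
  refine Finset.sum_eq_zero fun T hT => ?_
  rw [LinearMap.smul_apply, LinearMap.comp_apply, LinearMap.proj_apply]
  by_cases e : F.image (toWhisker w col T) = F'
  · subst e
    rw [Pi.single_eq_same, laurentCoeff_cechMonomial hb'.independent hb'.eq_zero, if_neg,
      smul_zero]
    rintro rfl
    refine hne ⟨?_, rfl⟩
    -- For `u ∈ T` the new set contains the whisker of its colour, where `b'` must be negative,
    -- whereas `b` vanishes there. Hence `T` is empty and the two sets agree.
    have hT0 : ∀ u ∈ T, u ∉ T := by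
      intro u hu
      have huF := Finset.mem_filter.1 (Finset.mem_powerset.1 hT hu)
      have h1 := hb'.neg (col u) (Finset.mem_image.2 ⟨u, huF.1, toWhisker_of_mem hu⟩)
      by_cases hw : w (col u) ∈ F
      · have := h.eq_of_col_eq hb.independent hw huF.1 (h.col_w _)
        rw [this, huF.2] at h1
        exact absurd h1 (lt_irrefl _)
      · rw [hb.eq_zero _ hw] at h1
        exact absurd h1 (lt_irrefl _)
    have : ∀ u ∈ F, toWhisker w col T u = id u := fun u _ =>
      toWhisker_of_notMem fun hu => hT0 u hu hu
    rw [Finset.image_congr this, Finset.image_id]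
  · rw [Pi.single_eq_of_ne e, map_zero, smul_zero]

/-- Only `T = ∅` leads back to `F`: otherwise some `u` with exponent zero would be a whisker, where
exponents are negative. -/
theorem basicFunctional_single_ne_zero [Fintype ι] (h : IsWhiskered H w col)
    (hb : IsBasicExponent H w l F b) :
    basicFunctional k H w col F b (Pi.single F (cechMonomial (edgeIdeal k H) F b)) ≠ 0 := by
  classical
  have e0 : F.image (toWhisker w col ∅) = F := by
    have : ∀ u ∈ F, toWhisker w col ∅ u = id u := fun u _ =>
      toWhisker_of_notMem (Finset.notMem_empty u)
    rw [Finset.image_congr this, Finset.image_id]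
  rw [basicFunctional, LinearMap.sum_apply, Finset.sum_eq_single ∅]
  · rw [LinearMap.smul_apply, LinearMap.comp_apply, LinearMap.proj_apply, e0, Pi.single_eq_same,
      laurentCoeff_cechMonomial hb.independent hb.eq_zero, if_pos rfl, smul_eq_mul, mul_one]
    exact mul_ne_zero (pow_ne_zero _ (neg_ne_zero.2 one_ne_zero)) (orderSign_ne_zero F)
  · intro T hT hne
    rw [LinearMap.smul_apply, LinearMap.comp_apply, LinearMap.proj_apply, Pi.single_eq_of_ne,
      map_zero, smul_zero]
    intro e
    obtain ⟨u, hu⟩ := Finset.nonempty_iff_ne_empty.2 hne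
    have huF := Finset.mem_filter.1 (Finset.mem_powerset.1 hT hu)
    have hw : w (col u) ∈ F := e ▸ Finset.mem_image.2 ⟨u, huF.1, toWhisker_of_mem hu⟩
    have := h.eq_of_col_eq hb.independent hw huF.1 (h.col_w _)
    exact hb.notMem_range huF.1 huF.2 ⟨_, this⟩
  · exact fun h' => absurd (Finset.empty_mem_powerset _) h'

end Functional

end IsWhiskered

/-! ## The Hilbert series of the top local cohomology -/

/-- The functionals kill `B` and are dual, up to nonzero scalars, to elements spanning `Z` modulo
`B`; together they identify the quotient with the functions on `Q`. -/
theorem finrank_quotient_of_dual {k E Q : Type*} [Field k] [AddCommGroup E] [Module k E] [Finite Q]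
    (Z B : Submodule k E) (e : Q → E) (φ : Q → E →ₗ[k] k) (he : ∀ q, e q ∈ Z)
    (hZ : Z ≤ Submodule.span k (Set.range e) ⊔ B) (hB : ∀ q, ∀ x ∈ B, φ q x = 0)
    (h0 : ∀ q q', q ≠ q' → φ q (e q') = 0) (h1 : ∀ q, φ q (e q) ≠ 0) :
    Module.Finite k (Z ⧸ B.submoduleOf Z) ∧
      Module.finrank k (Z ⧸ B.submoduleOf Z) = Nat.card Q := by
  classical
  have : Fintype Q := Fintype.ofFinite Q
  have hφ : ∀ (c : Q → k) q, φ q (∑ q', c q' • e q') = c q * φ q (e q) := fun c q => by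
    rw [map_sum, Finset.sum_eq_single q]
    · rw [map_smul, smul_eq_mul]
    · intro q' _ hne
      rw [map_smul, h0 q q' hne.symm, smul_zero]
    · exact fun h => absurd (Finset.mem_univ q) h
  let ψ : (Z ⧸ B.submoduleOf Z) →ₗ[k] (Q → k) :=
    (B.submoduleOf Z).liftQ (LinearMap.pi fun q => φ q ∘ₗ Z.subtype) (by
      intro z hz
      rw [LinearMap.mem_ker]
      ext q
      exact hB q _ hz)
  have hψ : ∀ z : Z, ψ (Submodule.Quotient.mk z) = fun q => φ q z := fun _ => rfl
  have hbij : Function.Bijective ψ := by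
    constructor
    · rw [← LinearMap.ker_eq_bot, LinearMap.ker_eq_bot']
      intro z hz
      obtain ⟨⟨z, hzZ⟩, rfl⟩ := Submodule.Quotient.mk_surjective _ z
      rw [hψ] at hz
      obtain ⟨s, hs, β, hβ, rfl⟩ := Submodule.mem_sup.1 (hZ hzZ)
      obtain ⟨c, rfl⟩ := (Submodule.mem_span_range_iff_exists_fun k).1 hs
      have hc : ∀ q, c q = 0 := fun q => by
        have := congrFun hz q
        simp only [map_add, hφ, hB q β hβ, add_zero, Pi.zero_apply, mul_eq_zero, h1 q,
          or_false] at this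
        exact this
      rw [Submodule.Quotient.mk_eq_zero]
      change (∑ q, c q • e q) + β ∈ B
      simpa [hc] using hβ
    · intro f
      refine ⟨Submodule.Quotient.mk ⟨∑ q, (f q / φ q (e q)) • e q,
        Submodule.sum_mem _ fun q _ => Submodule.smul_mem _ _ (he q)⟩, ?_⟩
      rw [hψ]
      ext q
      rw [hφ, div_mul_cancel₀ _ (h1 q)]
  let Ψ := LinearEquiv.ofBijective ψ hbij
  refine ⟨Module.Finite.equiv Ψ.symm, ?_⟩
  rw [Ψ.finrank_eq, Module.finrank_fintype_fun_eq_card, Nat.card_eq_fintype_card]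

/-! ### Powers of `t⁻¹ / (1 - t⁻¹)` -/

theorem invFraction_eq :
    invFraction = HahnSeries.single (1 : ℤ) (1 : ℚ) *
      HahnSeries.ofPowerSeries ℤ ℚ (PowerSeries.mk 1) := by
  have h : HahnSeries.ofPowerSeries ℤ ℚ (PowerSeries.mk 1) *
      (1 - HahnSeries.single (1 : ℤ) (1 : ℚ)) = 1 := by
    rw [← HahnSeries.ofPowerSeries_X, ← map_one (HahnSeries.ofPowerSeries ℤ ℚ), ← map_sub,
      ← map_mul, PowerSeries.mk_one_mul_one_sub_eq_one]
  rw [invFraction, div_eq_iff (right_ne_zero_of_mul_eq_one h), mul_assoc, h, mul_one]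

theorem coeff_invFraction_pow {α : Type*} [DecidableEq α] (s : Finset α) (n : ℕ) :
    (invFraction ^ s.card).coeff ((n : ℤ) + s.card) = (s.finsuppAntidiag n).card := by
  rw [invFraction_eq, mul_pow, HahnSeries.single_pow, one_pow, ← map_pow,
    show ((s.card • (1 : ℤ)) : ℤ) = s.card by simp, HahnSeries.coeff_single_mul_add, one_mul,
    HahnSeries.ofPowerSeries_apply_coeff, ← Finset.prod_const, PowerSeries.coeff_prod]
  simp

theorem coeff_invFraction_pow_of_lt {m : ℕ} {a : ℤ} (h : a < m) :
    (invFraction ^ m).coeff a = 0 := by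
  rw [invFraction_eq, mul_pow, HahnSeries.single_pow, one_pow, ← map_pow,
    show ((m • (1 : ℤ)) : ℤ) = m by simp, show a = (a - m) + m by ring,
    HahnSeries.coeff_single_mul_add, one_mul]
  exact (PowerSeries.coeff_coe _ (a - m)).trans (if_pos (by omega))

/-- The functions with sum `l` that are negative on `s` and zero elsewhere. -/
def NegativeOn {α : Type*} (s : Finset α) (l : ℤ) (b : α → ℤ) : Prop :=
  (∀ u ∈ s, b u < 0) ∧ (∀ u ∉ s, b u = 0) ∧ ∑ u ∈ s, b u = l

/-- `b ↦ -b - 1` matches these functions with the ways of writing `-l - |s|` as a sum of natural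
numbers indexed by `s`. If `-l < |s|` there are none, and the series has no term that early. -/
theorem card_negativeOn {α : Type*} [DecidableEq α] (s : Finset α) (l : ℤ) :
    Finite {b : α → ℤ // NegativeOn s l b} ∧
      (Nat.card {b : α → ℤ // NegativeOn s l b} : ℚ) = (invFraction ^ s.card).coeff (-l) := by
  by_cases hl : -l < s.card
  · have : IsEmpty {b : α → ℤ // NegativeOn s l b} := by
      refine ⟨fun ⟨b, hb, _, hs⟩ => ?_⟩
      have := Finset.sum_le_sum (s := s) (f := b) (g := fun _ => -1) fun u hu => by
        have := hb u hu
        omega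
      rw [hs, Finset.sum_const] at this
      simp only [nsmul_eq_mul] at this
      omega
    refine ⟨inferInstance, ?_⟩
    rw [coeff_invFraction_pow_of_lt hl, Nat.card_of_isEmpty, Nat.cast_zero]
  · obtain ⟨n, hn⟩ := Int.eq_ofNat_of_zero_le (show 0 ≤ -l - s.card by omega)
    have hn' : -l = (n : ℤ) + s.card := by
      have : (Int.ofNat n) = (n : ℤ) := rfl
      omega
    have e : {b : α → ℤ // NegativeOn s l b} ≃ {f : α →₀ ℕ // f ∈ s.finsuppAntidiag n} :=
      { toFun := fun b => ⟨Finsupp.onFinset s (fun u => if u ∈ s then (-b.1 u - 1).toNat else 0)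
            (fun u hu => by by_contra h; exact hu (if_neg h)), by
          rw [Finset.mem_finsuppAntidiag]
          refine ⟨?_, Finsupp.support_onFinset_subset⟩
          have h1 := b.2.2.2
          zify
          rw [Finset.sum_congr rfl (g := fun u => -b.1 u - 1) fun u hu => by
            have := b.2.1 u hu
            rw [if_pos hu]
            omega]
          rw [Finset.sum_sub_distrib, Finset.sum_neg_distrib, h1, hn', Finset.sum_const]
          simp⟩
        invFun := fun f => ⟨fun u => if u ∈ s then -(f.1 u : ℤ) - 1 else 0,
          fun u hu => by
            dsimp only
            rw [if_pos hu]
            omega,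
          fun u hu => if_neg hu, by
            have h1 := (Finset.mem_finsuppAntidiag.1 f.2).1
            rw [Finset.sum_congr rfl fun u hu => if_pos hu, Finset.sum_sub_distrib,
              Finset.sum_neg_distrib, ← Nat.cast_sum, h1, Finset.sum_const, nsmul_eq_mul, mul_one]
            omega⟩
        left_inv := fun b => by
          ext u
          simp only [Finsupp.onFinset_apply]
          split_ifs with hu
          · have := b.2.1 u hu
            omega
          · exact (b.2.2.1 u hu).symm
        right_inv := fun f => by
          ext u
          simp only [Finsupp.onFinset_apply]
          split_ifs with hu
          · omega
          · by_contra h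
            exact hu ((Finset.mem_finsuppAntidiag.1 f.2).2 (Finsupp.mem_support_iff.2 (Ne.symm h))) }
    refine ⟨Finite.of_equiv _ e.symm, ?_⟩
    rw [hn', coeff_invFraction_pow, Nat.card_congr e, Nat.card_eq_fintype_card,
      Fintype.card_coe]

/-! ### Counting basic exponents. -/

namespace IsWhiskered

variable {k : Type u} [Field k] {V : Type u} [Fintype V] [LinearOrder V] {ι : Type v} [Fintype ι]
  {H : SimpleGraph V} {w : ι → V} {col : V → ι}

/-- The exponents split into their zero set and their negative values. Negativity at the whiskers in
`F` says exactly that the zero set consists of non-whiskers. -/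
theorem isBasicExponent_iff (h : IsWhiskered H w col) {l : ℤ} {F : Finset V} {b : V → ℤ} :
    IsBasicExponent H w l F b ↔ IsMinVertexCover H Fᶜ ∧
      (F.filter fun u => b u = 0) ⊆ whiskerFree w Fᶜ ∧
      NegativeOn (F \ F.filter fun u => b u = 0) l b := by
  have hsum : ∑ u ∈ F \ F.filter fun u => b u = 0, b u = ∑ u ∈ F, b u := by
    refine Finset.sum_subset Finset.sdiff_subset fun u hu hu' => ?_
    by_contra hne
    exact hu' (by simp [hu, hne])
  constructor
  · intro hb
    refine ⟨h.isMinVertexCover_compl hb.independent hb.card, fun u hu => ?_, fun u hu => ?_,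
      fun u hu => ?_, hsum.trans hb.sum⟩
    · rw [Finset.mem_filter] at hu
      exact (mem_whiskerFree w).2 ⟨hb.notMem_range hu.1 hu.2, by simpa using hu.1⟩
    · simp only [Finset.mem_sdiff, Finset.mem_filter, not_and] at hu
      exact lt_of_le_of_ne (hb.nonpos u hu.1) (hu.2 hu.1)
    · by_cases huF : u ∈ F
      · simpa [huF] using hu
      · exact hb.eq_zero u huF
  · rintro ⟨hC, hσ, hneg, hzero, hs⟩
    have hnonpos : ∀ u ∈ F, b u ≤ 0 := fun u hu => by
      by_cases e : b u = 0
      · exact e.le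
      · exact (hneg u (by simp [hu, e])).le
    refine ⟨fun u hu v hv => ?_, ?_, fun u hu => hzero u (by simp [hu]), hnonpos, fun i hi => ?_,
      hsum.symm.trans hs⟩
    · exact independent_compl hC u (by simpa using hu) v (by simpa using hv)
    · rw [← h.card_compl hC, compl_compl]
    · refine lt_of_le_of_ne (hnonpos _ hi) fun e => ?_
      exact ((mem_whiskerFree w).1 (hσ (Finset.mem_filter.2 ⟨hi, e⟩))).1 ⟨i, rfl⟩

/-- The index set of the basis of the top local cohomology. -/
abbrev BasicExponent (H : SimpleGraph V) (w : ι → V) (l : ℤ) : Type u :=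
  {q : Finset V × (V → ℤ) // IsBasicExponent H w l q.1 q.2}

/-- The minimal vertex cover and the set of zeros of a basic exponent. -/
noncomputable def basicExponentFace (h : IsWhiskered H w col) {l : ℤ} (q : BasicExponent H w l) :
    {p : Σ _ : Finset V, Finset V //
      p ∈ (minVertexCovers H).sigma fun C => (whiskerFree w C).powerset} :=
  ⟨⟨q.1.1ᶜ, q.1.1.filter fun u => q.1.2 u = 0⟩, by
    rw [Finset.mem_sigma, Finset.mem_powerset, mem_minVertexCovers]
    have := h.isBasicExponent_iff.1 q.2
    exact ⟨this.1, this.2.1⟩⟩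

theorem filter_compl_eq {l : ℤ} {C σ : Finset V} (hσ : σ ⊆ whiskerFree w C) {b : V → ℤ}
    (hb : NegativeOn (Cᶜ \ σ) l b) : Cᶜ.filter (fun u => b u = 0) = σ := by
  ext u
  simp only [Finset.mem_filter, Finset.mem_compl]
  constructor
  · rintro ⟨hu, e⟩
    by_contra huσ
    exact (hb.1 u (by simp [hu, huσ])).ne e
  · intro hu
    exact ⟨((mem_whiskerFree w).1 (hσ hu)).2, hb.2.1 u (by simp [hu])⟩

/-- The basic exponents with given minimal vertex cover and given set of zeros. -/
noncomputable def basicExponentFiberEquiv (h : IsWhiskered H w col) (l : ℤ)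
    (p : {p : Σ _ : Finset V, Finset V //
      p ∈ (minVertexCovers H).sigma fun C => (whiskerFree w C).powerset}) :
    {q : BasicExponent H w l // h.basicExponentFace q = p} ≃
      {b : V → ℤ // NegativeOn (p.1.1ᶜ \ p.1.2) l b} where
  toFun q := ⟨q.1.1.2, by
    obtain ⟨q, rfl⟩ := q
    change NegativeOn (q.1.1ᶜᶜ \ _) l q.1.2
    rw [compl_compl]
    exact (h.isBasicExponent_iff.1 q.2).2.2⟩
  invFun b := ⟨⟨(p.1.1ᶜ, b.1), by
      have hp := p.2
      rw [Finset.mem_sigma, Finset.mem_powerset, mem_minVertexCovers] at hp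
      rw [h.isBasicExponent_iff, compl_compl]
      dsimp only
      rw [filter_compl_eq hp.2 b.2]
      exact ⟨hp.1, hp.2, b.2⟩⟩, by
    have hp := p.2
    rw [Finset.mem_sigma, Finset.mem_powerset] at hp
    refine Subtype.ext ?_
    simp only [basicExponentFace, compl_compl]
    rw [filter_compl_eq hp.2 b.2]⟩
  left_inv q := by
    obtain ⟨q, rfl⟩ := q
    refine Subtype.ext (Subtype.ext (Prod.ext ?_ rfl))
    exact compl_compl _
  right_inv b := rfl

/-- A basic exponent of degree `l` amounts to a minimal vertex cover, a set of free vertices and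
negative exponents of sum `l` on the remaining vertices off the cover. -/
noncomputable def basicExponentEquiv (h : IsWhiskered H w col) (l : ℤ) :
    BasicExponent H w l ≃ Σ p : {p : Σ _ : Finset V, Finset V //
      p ∈ (minVertexCovers H).sigma fun C => (whiskerFree w C).powerset},
      {b : V → ℤ // NegativeOn (p.1.1ᶜ \ p.1.2) l b} :=
  (Equiv.sigmaFiberEquiv h.basicExponentFace).symm.trans
    (Equiv.sigmaCongrRight (h.basicExponentFiberEquiv l))

theorem card_basicExponent (h : IsWhiskered H w col) (l : ℤ) :
    Finite (BasicExponent H w l) ∧ (Nat.card (BasicExponent H w l) : ℚ) =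
      ∑ C ∈ minVertexCovers H, ∑ σ ∈ (whiskerFree w C).powerset,
        (invFraction ^ (Cᶜ \ σ).card).coeff (-l) := by
  have : ∀ p : {p : Σ _ : Finset V, Finset V //
      p ∈ (minVertexCovers H).sigma fun C => (whiskerFree w C).powerset},
      Finite {b : V → ℤ // NegativeOn (p.1.1ᶜ \ p.1.2) l b} := fun p => (card_negativeOn _ _).1
  refine ⟨Finite.of_equiv _ (h.basicExponentEquiv l).symm, ?_⟩
  have e : ∀ p : {p : Σ _ : Finset V, Finset V //
      p ∈ (minVertexCovers H).sigma fun C => (whiskerFree w C).powerset},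
      (Nat.card {b : V → ℤ // NegativeOn (p.1.1ᶜ \ p.1.2) l b} : ℚ) =
        (invFraction ^ (p.1.1ᶜ \ p.1.2).card).coeff (-l) := fun p =>
    (card_negativeOn (p.1.1ᶜ \ p.1.2) l).2
  rw [Nat.card_congr (h.basicExponentEquiv l), Nat.card_sigma, Nat.cast_sum,
    Finset.sum_congr rfl fun p _ => e p, Finset.sum_sigma']
  exact Finset.sum_coe_sort ((minVertexCovers H).sigma fun C => (whiskerFree w C).powerset)
    fun p => (invFraction ^ (p.1ᶜ \ p.2).card).coeff (-l)

/-- Basic monomials are cocycles because no $r+1$ vertices are independent; they span modulo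
coboundaries, and the functionals separate them. -/
theorem localCohomology (h : IsWhiskered H w col) (l : ℤ) :
    Module.Finite k (LocalCohomologyDegree (edgeIdeal k H) (Fintype.card ι) l) ∧
      Module.finrank k (LocalCohomologyDegree (edgeIdeal k H) (Fintype.card ι) l) =
        Nat.card (BasicExponent H w l) := by
  have := (h.card_basicExponent l).1
  refine finrank_quotient_of_dual _ _
    (fun q : BasicExponent H w l => Pi.single q.1.1 (cechMonomial (edgeIdeal k H) q.1.1 q.1.2))
    (fun q => basicFunctional k H w col q.1.1 q.1.2) (fun q => ?_) ?_ (fun q x hx => ?_)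
    (fun q q' hne => ?_) fun q => h.basicFunctional_single_ne_zero q.2
  · obtain ⟨⟨F, b⟩, hb⟩ := q
    refine ⟨?_, ?_⟩
    · have := single_mem_cechCochains (edgeIdeal k H)
        (cechMonomial_mem_cechDegree (edgeIdeal k H) F b)
      rwa [hb.card, hb.sum] at this
    · rw [SetLike.mem_coe, LinearMap.mem_ker, cechDifferential_single]
      refine Finset.sum_eq_zero fun u hu => ?_
      have hind : ¬ ∀ a ∈ insert u F, ∀ b ∈ insert u F, ¬ H.Adj a b := by
        intro hind
        have := h.card_le_of_independent hind
        rw [Finset.card_insert_of_notMem (Finset.mem_compl.1 hu), hb.card] at this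
        omega
      rw [cechRing_eq_zero hind (cechRestrict _ _ _), Pi.single_zero, smul_zero]
  · refine inf_le_left.trans ((h.cechCochains_le_basicSpan l).trans ?_)
    refine sup_le_sup_right (Submodule.span_mono ?_) _
    rintro _ ⟨F, b, hb, rfl⟩
    exact ⟨⟨(F, b), hb⟩, rfl⟩
  · generalize Fintype.card ι = r at hx
    cases r with
    | zero =>
      rw [(Submodule.mem_bot k).1 hx, map_zero]
    | succ n =>
      obtain ⟨c, -, rfl⟩ := hx
      exact h.basicFunctional_cechDifferential q.2 c
  · refine h.basicFunctional_single_eq_zero q.2 q'.2 fun e => hne ?_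
    exact Subtype.ext (Prod.ext e.1 e.2)

/-- A zero set of size $i$ leaves $r-i$ negative exponents; grouping the subsets of a free set by
size produces the binomial coefficients. The extra values of $i$ in the outer range have binomial
coefficient zero. -/
theorem finrank_localCohomology (h : IsWhiskered H w col) (l : ℤ) :
    (Module.finrank k (LocalCohomologyDegree (edgeIdeal k H) (Fintype.card ι) l) : ℚ) =
    HahnSeries.coeff (∑ i ∈ Finset.range (Fintype.card V + 1), ∑ C ∈ minVertexCovers H,
      ((whiskerFree w C).card.choose i : LaurentSeries ℚ) *
        invFraction ^ ((Fintype.card ι : ℤ) - i)) (-l) := by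
  rw [(h.localCohomology l).2, (h.card_basicExponent l).2, Finset.sum_comm, HahnSeries.coeff_sum]
  refine Finset.sum_congr rfl fun C hC => ?_
  rw [mem_minVertexCovers] at hC
  rw [HahnSeries.coeff_sum]
  have h1 : ∀ σ ∈ (whiskerFree w C).powerset, (invFraction ^ (Cᶜ \ σ).card).coeff (-l) =
      (invFraction ^ ((Fintype.card ι : ℤ) - σ.card)).coeff (-l) := by
    intro σ hσ
    have hsub : σ ⊆ Cᶜ := fun u hu => by
      simpa using ((mem_whiskerFree w).1 (Finset.mem_powerset.1 hσ hu)).2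
    rw [Finset.card_sdiff_of_subset hsub, h.card_compl hC, ← zpow_natCast, Nat.cast_sub]
    rw [← h.card_compl hC]
    exact Finset.card_le_card hsub
  rw [Finset.sum_congr rfl h1, Finset.sum_powerset_apply_card
    (fun i => (invFraction ^ ((Fintype.card ι : ℤ) - i)).coeff (-l))]
  have h2 : ∀ i : ℕ, (((whiskerFree w C).card.choose i : LaurentSeries ℚ) *
      invFraction ^ ((Fintype.card ι : ℤ) - i)).coeff (-l) =
      (whiskerFree w C).card.choose i • (invFraction ^ ((Fintype.card ι : ℤ) - i)).coeff (-l) := by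
    intro i
    rw [← nsmul_eq_mul, HahnSeries.coeff_nsmul]
    rfl
  rw [Finset.sum_congr rfl fun i _ => h2 i]
  refine Finset.sum_subset ?_ fun i _ hi => ?_
  · exact Finset.range_subset_range.2 (Nat.succ_le_succ (Finset.card_le_univ _))
  · rw [Nat.choose_eq_zero_of_lt, zero_smul]
    simpa [Nat.lt_succ_iff] using hi

theorem isResolvedByWhiskerComplex (h : IsWhiskered H w col) {W : ι → Set V}
    (hW : ∀ i a, a ∈ W i ↔ a ∉ Set.range w ∧ col a = i) :
    IsResolvedByWhiskerComplex k H w W where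
  presentation := h.presentation hW
  resolution := whiskerComplex_isMinimalFreeResolution h hW
  betti := bettiNumber_coverIdeal h hW
  gradedBetti := gradedBettiNumber_coverIdeal h hW
  gradedBetti_field k' _ i j := by
    rw [gradedBettiNumber_coverIdeal h hW, gradedBettiNumber_coverIdeal h hW]
  projDim_betti := isGreatest_gradedBettiNumber h hW
  projDim := projectiveDimension_coverIdeal h hW
  dim := ringKrullDim_edgeIdeal fun C hC => by rw [natCard_notMem, h.card_compl hC]
  finite_localCohomology l := (h.localCohomology l).1
  hilbert l := h.finrank_localCohomology l

end IsWhiskered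

end

/-! ## Clique corona graphs -/

section Corona

variable {X : Type u} {Y : X → Type u} (G : SimpleGraph X) (y : ∀ i, Y i)

theorem inr_mem_range_corona {i : X} {b : Y i} :
    (Sum.inr ⟨i, b⟩ : X ⊕ (Σ i, Y i)) ∈ Set.range (fun i : X => Sum.inr ⟨i, y i⟩) ↔ b = y i := by
  constructor
  · rintro ⟨j, hj⟩
    cases hj
    rfl
  · rintro rfl
    exact ⟨i, rfl⟩

/-- The vertex `i` and the complete graph attached to it receive colour `i`. -/
theorem isWhiskered_coronaGraph :
    IsWhiskered (coronaGraph G (fun i => (⊤ : SimpleGraph (Y i))))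
      (fun i : X => (Sum.inr ⟨i, y i⟩ : X ⊕ (Σ i, Y i)))
      (Sum.elim id Sigma.fst) where
  col_w _ := rfl
  adj_w i a := by
    rcases a with j | ⟨j, b⟩
    · change i = j ↔ _ ∧ j = i
      simp [eq_comm]
    · rw [inr_mem_range_corona]
      change (∃ h : i = j, (⊤ : SimpleGraph (Y j)).Adj (h ▸ y i) b) ↔ ¬ b = y j ∧ j = i
      constructor
      · rintro ⟨rfl, h⟩
        exact ⟨fun e => h e.symm, rfl⟩
      · rintro ⟨h, rfl⟩
        exact ⟨rfl, fun e => h e.symm⟩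
  clique a b hab ha hb hc := by
    rcases a with i | ⟨i, a⟩ <;> rcases b with j | ⟨j, b⟩ <;> change i = j at hc <;> subst hc
    · exact absurd rfl hab
    · exact (rfl : i = i)
    · exact (rfl : i = i)
    · exact ⟨rfl, fun e => hab (by cases e; rfl)⟩

theorem isResolvedByWhiskerComplex_coronaGraph (k : Type u) [Field k] [Fintype X]
    [∀ i, Fintype (Y i)] [LinearOrder (X ⊕ (Σ i, Y i))] :
    IsResolvedByWhiskerComplex k (coronaGraph G (fun i => (⊤ : SimpleGraph (Y i))))
      (fun i : X => Sum.inr ⟨i, y i⟩)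
      (fun i => {Sum.inl i} ∪ {a | ∃ b : Y i, b ≠ y i ∧ a = Sum.inr ⟨i, b⟩}) := by
  refine (isWhiskered_coronaGraph G y).isResolvedByWhiskerComplex ?_
  rintro i (j | ⟨j, b⟩)
  · simp [eq_comm]
  · rw [inr_mem_range_corona]
    constructor
    · rintro (h | ⟨c, hc, h⟩)
      · cases h
      · cases h
        exact ⟨hc, rfl⟩
    · rintro ⟨h, e⟩
      change j = i at e
      subst e
      exact Or.inr ⟨b, h, rfl⟩

end Corona

/-! ## Chordal graphs -/

section Chordal

variable {V : Type u} {H : SimpleGraph V}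

theorem SimpleGraph.Walk.mk_getVert_mem_edges {G : SimpleGraph V} {u v : V} (p : G.Walk u v) {i : ℕ}
    (hi : i < p.length) : s(p.getVert i, p.getVert (i + 1)) ∈ p.edges := by
  induction p generalizing i with
  | nil => simp at hi
  | cons h p ih =>
    cases i with
    | zero => simp
    | succ i =>
      simp only [SimpleGraph.Walk.length_cons, Nat.add_lt_add_iff_right] at hi
      rw [SimpleGraph.Walk.edges_cons]
      simpa using Or.inr (ih hi)

/-- Adjacent vertices of a shortest walk are joined by an edge of the walk. -/
theorem SimpleGraph.Walk.mk_mem_edges_of_length_eq_dist {G : SimpleGraph V} {u v : V}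
    (p : G.Walk u v) (hp : p.length = G.dist u v) {x y : V} (hx : x ∈ p.support)
    (hy : y ∈ p.support) (hxy : G.Adj x y) : s(x, y) ∈ p.edges := by
  have key : ∀ i j, i ≤ j → j ≤ p.length → G.Adj (p.getVert i) (p.getVert j) →
      s(p.getVert i, p.getVert j) ∈ p.edges := by
    intro i j hij hj hadj
    -- An edge between the vertices in positions `i` and `j` is a shortcut unless `j ≤ i + 1`.
    have h1 := SimpleGraph.dist_le ((p.take i).append (Walk.cons hadj (p.drop j)))
    rw [Walk.length_append, Walk.length_cons, Walk.take_length, Walk.drop_length, ← hp] at h1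
    have h2 : i ≠ j := by
      rintro rfl
      exact G.loopless.irrefl _ hadj
    obtain rfl : j = i + 1 := by omega
    exact p.mk_getVert_mem_edges (by omega)
  obtain ⟨i, rfl, hi⟩ := Walk.mem_support_iff_exists_getVert.1 hx
  obtain ⟨j, rfl, hj⟩ := Walk.mem_support_iff_exists_getVert.1 hy
  rcases le_total i j with h | h
  · exact key i j h hj hxy
  · rw [Sym2.eq_swap]
    exact key j i h hi hxy.symm

/-- Two neighbours of `v` that are connected outside the closed neighbourhood of `v` are
adjacent. -/
theorem IsChordalGraph.adj_of_reachable (hH : IsChordalGraph H) {v s t : V} {A : Set V}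
    (hs : H.Adj v s) (ht : H.Adj v t) (hst : s ≠ t)
    (hA : ∀ x ∈ A, x ≠ s → x ≠ t → x ≠ v ∧ ¬ H.Adj v x)
    {G : SimpleGraph V} (hG : ∀ a b, G.Adj a b ↔ H.Adj a b ∧ a ∈ A ∧ b ∈ A)
    (hr : G.Reachable s t) : H.Adj s t := by
  by_contra hn
  -- A shortest path from `s` to `t`, closed through `v`, has length at least four if `s` and `t`
  -- are not adjacent. It has no chord: `v` sees only `s` and `t` on it, and a chord of the path
  -- would shorten it.
  obtain ⟨p, hp, hd⟩ := hr.exists_path_of_dist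
  have hle : G ≤ H := fun a b h => ((hG a b).1 h).1
  have hlen : 2 ≤ p.length := by
    by_contra! h
    interval_cases hl : p.length
    · exact hst (SimpleGraph.Walk.eq_of_length_eq_zero hl)
    · exact hn (hle (SimpleGraph.Walk.adj_of_length_eq_one hl))
  have hsup : ∀ x ∈ p.support, x ∈ A := by
    intro x hx
    have hne : ¬ p.Nil := fun h => by
      have := SimpleGraph.Walk.length_eq_zero_iff.2 h
      omega
    obtain ⟨i, rfl, hi⟩ := SimpleGraph.Walk.mem_support_iff_exists_getVert.1 hx
    rcases Nat.lt_or_ge i p.length with h | h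
    · exact ((hG _ _).1 (p.adj_getVert_succ h)).2.1
    · have := p.adj_getVert_succ (i := i - 1) (by omega)
      rw [Nat.sub_add_cancel (by omega)] at this
      exact ((hG _ _).1 this).2.2
  have hv : v ∉ p.support := fun h => by
    by_cases h1 : v = s
    · exact H.loopless.irrefl _ (h1 ▸ hs)
    · by_cases h2 : v = t
      · exact H.loopless.irrefl _ (h2 ▸ ht)
      · exact (hA v (hsup v h) h1 h2).1 rfl
  let q := (p.mapLe hle).concat ht.symm
  have hq : q.IsPath := ((SimpleGraph.Walk.isPath_mapLe hle).2 hp).concat (by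
    rwa [SimpleGraph.Walk.support_mapLe_eq_support]) _
  have hqe : q.edges = p.edges ++ [s(t, v)] := by
    rw [SimpleGraph.Walk.edges_concat, SimpleGraph.Walk.edges_mapLe_eq_edges,
      List.concat_eq_append]
  have hqs : q.support = p.support ++ [v] := by
    rw [SimpleGraph.Walk.support_concat, SimpleGraph.Walk.support_mapLe_eq_support]
  have hcyc : (SimpleGraph.Walk.cons hs q).IsCycle := by
    rw [SimpleGraph.Walk.cons_isCycle_iff]
    refine ⟨hq, ?_⟩
    rw [hqe, List.mem_append, List.mem_singleton]
    rintro (h | h)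
    · exact hv (p.fst_mem_support_of_mem_edges h)
    · rcases Sym2.eq_iff.1 h with h | h
      · exact H.loopless.irrefl _ (h.1 ▸ ht)
      · exact hst h.2
  obtain ⟨x, hx, y, hy, hxy, hne⟩ := hH v _ hcyc (by
    rw [SimpleGraph.Walk.length_cons, SimpleGraph.Walk.length_concat,
      SimpleGraph.Walk.length_mapLe]
    omega)
  have hsup' : ∀ x ∈ (SimpleGraph.Walk.cons hs q).support, x = v ∨ x ∈ p.support := by
    intro x hx
    rw [SimpleGraph.Walk.support_cons, hqs] at hx
    simp only [List.mem_cons, List.mem_append, List.not_mem_nil, or_false] at hx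
    tauto
  rw [SimpleGraph.Walk.edges_cons, hqe] at hne
  simp only [List.mem_cons, List.mem_append, List.not_mem_nil, or_false, not_or] at hne
  have hvx : ∀ x ∈ p.support, H.Adj v x → x = s ∨ x = t := by
    intro x hx hvx
    by_contra! h
    exact (hA x (hsup x hx) h.1 h.2).2 hvx
  rcases hsup' x hx with rfl | hx' <;> rcases hsup' y hy with rfl | hy'
  · exact H.loopless.irrefl _ hxy
  · rcases hvx y hy' hxy with rfl | rfl
    · exact hne.1 rfl
    · exact hne.2.2 Sym2.eq_swap
  · rcases hvx x hx' hxy.symm with rfl | rfl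
    · exact hne.1 Sym2.eq_swap
    · exact hne.2.2 rfl
  · exact hne.2.1 (p.mk_mem_edges_of_length_eq_dist hd hx' hy'
      ((hG x y).2 ⟨hxy, hsup x hx', hsup y hy'⟩))

/-- The part of `Y` outside the closed neighbourhood of `v` that is connected to `u`. -/
def remoteComponent (H : SimpleGraph V) (Y : Set V) (v u : V) : Set V :=
  {x | Relation.ReflTransGen (fun a b => H.Adj a b ∧ b ∈ Y ∧ b ≠ v ∧ ¬ H.Adj v b) u x}

theorem mem_of_mem_remoteComponent {Y : Set V} {v u x : V} (hu : u ∈ Y ∧ u ≠ v ∧ ¬ H.Adj v u)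
    (hx : x ∈ remoteComponent H Y v u) : x ∈ Y ∧ x ≠ v ∧ ¬ H.Adj v x := by
  rcases Relation.ReflTransGen.cases_tail hx with rfl | ⟨z, -, hz⟩
  · exact hu
  · exact hz.2

theorem remoteComponent_closed {Y : Set V} {v u x z : V} (hx : x ∈ remoteComponent H Y v u)
    (hxz : H.Adj x z) (hz : z ∈ Y) (hzv : z ≠ v) (hvz : ¬ H.Adj v z) :
    z ∈ remoteComponent H Y v u := Relation.ReflTransGen.tail hx ⟨hxz, hz, hzv, hvz⟩

/-- The component connects `c` to `d`, so `s` and `t` are joined by a walk whose inner vertices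
avoid the closed neighbourhood of `v`. -/
theorem IsChordalGraph.adj_of_boundary (hH : IsChordalGraph H) {Y : Set V} {v u s t c d : V}
    (hu : u ∈ Y ∧ u ≠ v ∧ ¬ H.Adj v u) (hs : H.Adj v s) (ht : H.Adj v t) (hst : s ≠ t)
    (hc : c ∈ remoteComponent H Y v u) (hd : d ∈ remoteComponent H Y v u) (hsc : H.Adj s c)
    (htd : H.Adj t d) : H.Adj s t := by
  let A : Set V := {s, t} ∪ remoteComponent H Y v u
  let G : SimpleGraph V :=
    { Adj := fun a b => H.Adj a b ∧ a ∈ A ∧ b ∈ A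
      symm := ⟨fun a b h => ⟨h.1.symm, h.2.2, h.2.1⟩⟩
      loopless := ⟨fun a h => H.loopless.irrefl a h.1⟩ }
  have hreach : ∀ x ∈ remoteComponent H Y v u, G.Reachable u x := by
    intro x hx
    induction hx with
    | refl => exact SimpleGraph.Reachable.refl u
    | @tail b e hb he ih =>
      have h1 : G.Adj b e := ⟨he.1, Or.inr hb, Or.inr (Relation.ReflTransGen.tail hb he)⟩
      exact ih.trans h1.reachable
  have h1 : G.Adj s c := ⟨hsc, Or.inl (Or.inl rfl), Or.inr hc⟩
  have h2 : G.Adj t d := ⟨htd, Or.inl (Or.inr rfl), Or.inr hd⟩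
  refine hH.adj_of_reachable (A := A) (G := G) hs ht hst ?_ (fun a b => Iff.rfl)
    (h1.reachable.trans (((hreach c hc).symm.trans (hreach d hd)).trans h2.reachable.symm))
  rintro x ((rfl | rfl) | hx) h3 h4
  · exact absurd rfl h3
  · exact absurd rfl h4
  · exact (mem_of_mem_remoteComponent hu hx).2

/-- Dirac's theorem: chordal graphs have simplicial vertices. -/
theorem IsChordalGraph.exists_simplicial [Finite V] (hH : IsChordalGraph H) {Y : Set V}
    (hY : Y.Nonempty) : ∃ u ∈ Y, ∀ a ∈ Y, ∀ b ∈ Y, H.Adj u a → H.Adj u b → a ≠ b → H.Adj a b := by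
  by_cases hP : ∃ q : V × V, q.1 ∈ Y ∧ q.2 ∈ Y ∧ q.2 ≠ q.1 ∧ ¬ H.Adj q.1 q.2
  -- Among the non-adjacent pairs, one with the smallest component is chosen.
  · obtain ⟨⟨v, u⟩, ⟨hv, hu, huv, hadj⟩, hmin⟩ := Set.exists_min_image
      {q : V × V | q.1 ∈ Y ∧ q.2 ∈ Y ∧ q.2 ≠ q.1 ∧ ¬ H.Adj q.1 q.2}
      (fun q => (remoteComponent H Y q.1 q.2).ncard) (Set.toFinite _) hP
    have hu' : u ∈ Y ∧ u ≠ v ∧ ¬ H.Adj v u := ⟨hu, huv, hadj⟩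
    set C := remoteComponent H Y v u with hC
    have hmem := fun x (hx : x ∈ C) => mem_of_mem_remoteComponent hu' hx
    have hbound : ∀ x ∈ C, ∀ z ∈ Y, H.Adj x z → z ∉ C → H.Adj v z := by
      intro x hx z hz hxz hzC
      by_contra hvz
      refine hzC (remoteComponent_closed hx hxz hz ?_ hvz)
      rintro rfl
      exact (hmem x hx).2.2 hxz.symm
    have hless : ∀ v' ∈ Y, ∀ u' ∈ Y, u' ≠ v' → ¬ H.Adj v' u' →
        remoteComponent H Y v' u' ⊆ C → C ⊆ remoteComponent H Y v' u' := by
      intro v' hv' u' hu' hne hn hsub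
      have := hmin (v', u') ⟨hv', hu', hne, hn⟩
      exact (Set.eq_of_subset_of_ncard_le hsub this (Set.toFinite _)).ge
    -- the boundary is completely joined to the component
    have hjoin : ∀ c ∈ C, ∀ s ∈ Y, s ∉ C → ∀ d ∈ C, H.Adj d s → H.Adj c s := by
      intro c hc s hs hsC d hd hds
      by_contra hcs
      have hvs := hbound d hd s hs hds hsC
      have hcs' : c ≠ s := fun e => hsC (e ▸ hc)
      -- A walk leaving `C` would enter its boundary, which is a clique, at a vertex `z` adjacent to
      -- `s`; such vertices are excluded. By minimality this component would contain `C`, yet it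
      -- misses `d`.
      have hsub : remoteComponent H Y s c ⊆ C := by
        intro x hx
        induction hx with
        | refl => exact hc
        | @tail x z _ hz ih =>
          by_contra hzC
          have hvz := hbound x ih z hz.2.1 hz.1 hzC
          exact hz.2.2.2 (hH.adj_of_boundary hu' hvs hvz hz.2.2.1.symm hd ih hds.symm hz.1.symm)
      have := hless s hs c (hmem c hc).1 hcs' (fun h => hcs h.symm) hsub hd
      exact (mem_of_mem_remoteComponent ⟨(hmem c hc).1, hcs', fun h => hcs h.symm⟩ this).2.2 hds.symm
    -- the component is a clique
    have hclique : ∀ c ∈ C, ∀ d ∈ C, c ≠ d → H.Adj c d := by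
      intro c hc d hd hcd
      by_contra hn
      -- The boundary of `C` is completely joined to `d`, so the component of `c` away from `d`
      -- cannot leave `C`; it misses `d`, against minimality.
      have hsub : remoteComponent H Y d c ⊆ C := by
        intro x hx
        induction hx with
        | refl => exact hc
        | @tail x z _ hz ih =>
          by_contra hzC
          exact hz.2.2.2 (hjoin d hd z hz.2.1 hzC x ih hz.1)
      have := hless d (hmem d hd).1 c (hmem c hc).1 hcd (fun h => hn h.symm) hsub hd
      exact (mem_of_mem_remoteComponent ⟨(hmem c hc).1, hcd, fun h => hn h.symm⟩ this).2.1 rfl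
    have huC : u ∈ C := Relation.ReflTransGen.refl
    refine ⟨u, hu, fun a ha b hb hua hub hab => ?_⟩
    by_cases haC : a ∈ C <;> by_cases hbC : b ∈ C
    · exact hclique a haC b hbC hab
    · exact hjoin a haC b hb hbC u huC hub
    · exact (hjoin b hbC a ha haC u huC hua).symm
    · exact hH.adj_of_boundary hu' (hbound u huC a ha hua haC) (hbound u huC b hb hub hbC) hab
        huC huC hua.symm hub.symm
  · push Not at hP
    obtain ⟨u, hu⟩ := hY
    exact ⟨u, hu, fun a ha b hb _ _ hab => hP (a, b) ha hb hab.symm⟩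

end Chordal

/-! ### Unmixed chordal graphs are clique-whiskered. -/

section ChordalUnmixed

variable {V : Type u} [Fintype V] {H : SimpleGraph V}

/-- Every independent set is contained in the complement of a minimal vertex cover. -/
theorem exists_isMinVertexCover_compl [DecidableEq V] {I : Finset V}
    (hI : ∀ a ∈ I, ∀ b ∈ I, ¬ H.Adj a b) :
    ∃ B, I ⊆ B ∧ (∀ a ∈ B, ∀ b ∈ B, ¬ H.Adj a b) ∧ IsMinVertexCover H Bᶜ := by
  obtain ⟨D, hD, hDm⟩ := exists_isMinVertexCover_subset H (C := Iᶜ) (fun a b hab => by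
    by_contra! h
    simp only [Finset.mem_coe, Finset.mem_compl, not_not] at h
    exact hI a h.1 b h.2 hab)
  refine ⟨Dᶜ, fun a ha => ?_, IsWhiskered.independent_compl hDm, by rwa [compl_compl]⟩
  rw [Finset.mem_compl]
  exact fun h => Finset.mem_compl.1 (hD h) ha

/-- All minimal vertex covers have the same cardinality. -/
def IsUnmixedGraph (H : SimpleGraph V) : Prop :=
  ∀ C C', IsMinVertexCover H C → IsMinVertexCover H C' → C.card = C'.card

theorem IsCohenMacaulayGraph.isUnmixedGraph {k : Type u} [Field k]
    (h : IsCohenMacaulayGraph k H) : IsUnmixedGraph H := fun _ _ hC hC' => h.card_eq hC hC'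

/-- An independent set extends to a maximal one, and all maximal ones are equally large. -/
theorem IsUnmixedGraph.card_le [DecidableEq V] (h : IsUnmixedGraph H) {I B : Finset V}
    (hI : ∀ a ∈ I, ∀ b ∈ I, ¬ H.Adj a b) (hB : IsMinVertexCover H Bᶜ) : I.card ≤ B.card := by
  obtain ⟨B', hIB, -, hB'⟩ := exists_isMinVertexCover_compl hI
  have := h _ _ hB hB'
  have h1 := Finset.card_add_card_compl B
  have h2 := Finset.card_add_card_compl B'
  have := Finset.card_le_card hIB
  omega

/-- In the four-cycle through `u`, `s`, `b`, `t` the diagonal from `u` to `b` is missing, so the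
other one is present. -/
theorem IsChordalGraph.adj_of_square {V : Type u} {H : SimpleGraph V} (hH : IsChordalGraph H) {u s t b : V} (hus : H.Adj u s)
    (hut : H.Adj u t) (hst : s ≠ t) (hbu : b ≠ u) (hub : ¬ H.Adj u b) (hsb : H.Adj s b)
    (htb : H.Adj t b) : H.Adj s t :=
  hH.adj_of_boundary (Y := Set.univ) ⟨trivial, hbu, hub⟩ hus hut hst
    Relation.ReflTransGen.refl Relation.ReflTransGen.refl hsb htb

/-- A clique is dominated by an independent set of vertices outside the clique if each of its
vertices has a neighbour outside the clique. -/
theorem IsChordalGraph.exists_dominating {V : Type u} {H : SimpleGraph V} [DecidableEq V]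
    (hH : IsChordalGraph H) {K : Set V}
    (hK : ∀ a ∈ K, ∀ b ∈ K, a ≠ b → H.Adj a b) (hout : ∀ a ∈ K, ∃ u ∉ K, H.Adj u a)
    (T : Finset V) (hT : ∀ a ∈ T, a ∈ K) :
    ∃ I : Finset V, (∀ a ∈ I, ∀ b ∈ I, ¬ H.Adj a b) ∧ (∀ u ∈ I, u ∉ K) ∧
      ∀ a ∈ T, ∃ u ∈ I, H.Adj u a := by
  classical
  induction T using Finset.induction_on with
  | empty => exact ⟨∅, by simp, by simp, by simp⟩
  | insert v T hvT ih =>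
    obtain ⟨I, hI, hIK, hdom⟩ := ih fun a ha => hT a (Finset.mem_insert_of_mem ha)
    have hv := hT v (Finset.mem_insert_self v T)
    by_cases hdv : ∃ u ∈ I, H.Adj u v
    · refine ⟨I, hI, hIK, fun a ha => ?_⟩
      rcases Finset.mem_insert.1 ha with rfl | ha
      · exact hdv
      · exact hdom a ha
    push Not at hdv
    obtain ⟨u, hu, huv⟩ := hout v hv
    refine ⟨insert u (I.filter fun z => ¬ H.Adj u z), fun a ha b hb hab => ?_, fun a ha => ?_,
      fun a ha => ?_⟩
    · simp only [Finset.mem_insert, Finset.mem_filter] at ha hb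
      rcases ha with rfl | ha <;> rcases hb with rfl | hb
      · exact H.loopless.irrefl _ hab
      · exact hb.2 hab
      · exact ha.2 hab.symm
      · exact hI a ha.1 b hb.1 hab
    · rcases Finset.mem_insert.1 ha with rfl | ha
      · exact hu
      · exact hIK a (Finset.mem_filter.1 ha).1
    · rcases Finset.mem_insert.1 ha with rfl | ha
      · exact ⟨u, Finset.mem_insert_self _ _, huv⟩
      · obtain ⟨z, hz, hza⟩ := hdom a ha
        by_cases huz : H.Adj u z
        · refine ⟨u, Finset.mem_insert_self _ _, ?_⟩
          by_contra hua
          have haK := hT a (Finset.mem_insert_of_mem ha)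
          have hva : v ≠ a := fun e => hvT (e ▸ ha)
          exact hdv z hz (hH.adj_of_square huv huz (fun e => hIK z hz (e ▸ hv))
            (fun e => hu (e ▸ haK)) hua (hK v hv a haK hva) hza).symm
        · exact ⟨z, Finset.mem_insert_of_mem (Finset.mem_filter.2 ⟨hz, huz⟩), hza⟩

variable {ι : Type v} {w : ι → V}

/-- In an unmixed graph, the closed neighbourhoods of simplicial vertices are disjoint or
equal. -/
theorem IsUnmixedGraph.eq_of_mem_of_mem (hU : IsUnmixedGraph H)
    (hclique : ∀ i a b, (a = w i ∨ H.Adj (w i) a) → (b = w i ∨ H.Adj (w i) b) → a ≠ b → H.Adj a b)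
    (hne : ∀ i j, i ≠ j → w j ≠ w i ∧ ¬ H.Adj (w i) (w j)) {x : V} {i j : ι}
    (hi : x = w i ∨ H.Adj (w i) x) (hj : x = w j ∨ H.Adj (w j) x) : i = j := by
  classical
  by_contra hij
  obtain ⟨A, hxA, hA, hAm⟩ := exists_isMinVertexCover_compl (H := H) (I := {x}) (by simp)
  rw [Finset.singleton_subset_iff] at hxA
  have key : ∀ i, (x = w i ∨ H.Adj (w i) x) → ∀ z ∈ A.erase x, ¬ H.Adj (w i) z := by
    intro i hi z hz hadj
    exact hA x hxA z (Finset.mem_of_mem_erase hz)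
      (hclique i x z hi (Or.inr hadj) (Finset.ne_of_mem_erase hz).symm)
  have key2 : ∀ i, (x = w i ∨ H.Adj (w i) x) → w i ∉ A.erase x := by
    intro i hi hmem
    rcases hi with hi | hi
    · exact Finset.ne_of_mem_erase hmem hi.symm
    · exact hA _ (Finset.mem_of_mem_erase hmem) x hxA hi
  -- Replacing `x` by both `w i` and `w j` keeps the set independent and makes it one larger than a
  -- maximal one.
  have hcard := hU.card_le (I := insert (w i) (insert (w j) (A.erase x))) (B := A) (by
    intro a ha b hb hab
    simp only [Finset.mem_insert] at ha hb
    rcases ha with rfl | rfl | ha <;> rcases hb with rfl | rfl | hb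
    · exact H.loopless.irrefl _ hab
    · exact (hne i j hij).2 hab
    · exact key i hi b hb hab
    · exact (hne i j hij).2 hab.symm
    · exact H.loopless.irrefl _ hab
    · exact key j hj b hb hab
    · exact key i hi a ha hab.symm
    · exact key j hj a ha hab.symm
    · exact hA a (Finset.mem_of_mem_erase ha) b (Finset.mem_of_mem_erase hb) hab) hAm
  rw [Finset.card_insert_of_notMem, Finset.card_insert_of_notMem (key2 j hj),
    Finset.card_erase_add_one hxA] at hcard
  · omega
  · rw [Finset.mem_insert, not_or]
    exact ⟨fun e => (hne i j hij).1 e.symm, key2 i hi⟩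

/-- The closed neighbourhoods of the `w i` become the colour classes. They are disjoint by
unmixedness; that they cover all vertices is shown by taking a simplicial vertex `y` of the subgraph
on the missed vertices `Y` and comparing two independent sets. -/
theorem IsChordalGraph.exists_isWhiskered [Fintype ι] (hH : IsChordalGraph H) (hU : IsUnmixedGraph H)
    (hclique : ∀ i a b, (a = w i ∨ H.Adj (w i) a) → (b = w i ∨ H.Adj (w i) b) → a ≠ b → H.Adj a b)
    (hne : ∀ i j, i ≠ j → w j ≠ w i ∧ ¬ H.Adj (w i) (w j))
    (hsimp : ∀ u, (∀ a b, H.Adj u a → H.Adj u b → a ≠ b → H.Adj a b) →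
      ∃ i, u = w i ∨ H.Adj (w i) u) :
    ∃ col : V → ι, IsWhiskered H w col ∧ ∀ a i, col a = i ↔ (a = w i ∨ H.Adj (w i) a) := by
  classical
  have hdisj := fun {x i j} => hU.eq_of_mem_of_mem (x := x) (i := i) (j := j) hclique hne
  have hcov : ∀ a, ∃ i, a = w i ∨ H.Adj (w i) a := by
    by_contra! hnot
    let Y : Set V := {a | ∀ i, ¬ (a = w i ∨ H.Adj (w i) a)}
    obtain ⟨y, hy, hys⟩ := hH.exists_simplicial (Y := Y) (by
      obtain ⟨a, ha⟩ := hnot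
      exact ⟨a, fun i h => h.elim (ha i).1 (ha i).2⟩)
    let K : Set V := {a | a ∈ Y ∧ (a = y ∨ H.Adj y a)}
    have hK : ∀ a ∈ K, ∀ b ∈ K, a ≠ b → H.Adj a b := by
      rintro a ⟨ha, rfl | ha'⟩ b ⟨hb, rfl | hb'⟩ hab
      · exact absurd rfl hab
      · exact hb'
      · exact ha'.symm
      · exact hys a ha b hb ha' hb' hab
    -- A vertex of the clique `K` without neighbours outside it would be simplicial in the whole
    -- graph and hence not missed.
    have hout : ∀ a ∈ K, ∃ u ∉ K, H.Adj u a := by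
      intro a ha
      by_contra! h
      obtain ⟨i, hi⟩ := hsimp a fun b c hab hac hbc => by
        have hbK : b ∈ K := by
          by_contra hb
          exact h b hb hab.symm
        have hcK : c ∈ K := by
          by_contra hc
          exact h c hc hac.symm
        exact hK b hbK c hcK hbc
      exact ha.1 i hi
    obtain ⟨I, hI, hIK, hdom⟩ := hH.exists_dominating hK hout (Finset.univ.filter fun a => a ∈ K)
      (by simp)
    obtain ⟨B, hIB, hB, hBm⟩ := exists_isMinVertexCover_compl hI
    have hBK : ∀ a ∈ B, a ∉ K := by
      intro a ha haK
      obtain ⟨u, hu, hua⟩ := hdom a (by simpa using haK)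
      exact hB u (hIB hu) a ha hua
    let BY := B.filter fun a => a ∈ Y
    have hyBY : y ∉ BY := fun h => hBK y (Finset.mem_filter.1 h).1 ⟨hy, Or.inl rfl⟩
    have hwY : ∀ i, ∀ a ∈ insert y BY, a ≠ w i ∧ ¬ H.Adj (w i) a := by
      intro i a ha
      have haY : a ∈ Y := by
        rcases Finset.mem_insert.1 ha with rfl | ha
        · exact hy
        · exact (Finset.mem_filter.1 ha).2
      exact ⟨fun e => haY i (Or.inl e), fun e => haY i (Or.inr e)⟩
    have hyB : ∀ a ∈ BY, ¬ H.Adj y a := fun a ha hya =>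
      hBK a (Finset.mem_filter.1 ha).1 ⟨(Finset.mem_filter.1 ha).2, Or.inr hya⟩
    -- `B` avoids `K`, so `y` can be added to `B ∩ Y`. With all the `w i` this makes one more vertex
    -- than the number of colours plus `|B ∩ Y|`, whereas `B` has at most one vertex in each covered
    -- clique.
    have h1 := hU.card_le (I := Finset.univ.image w ∪ insert y BY) (B := B) (by
      have hww : ∀ i j, ¬ H.Adj (w i) (w j) := fun i j h => by
        by_cases e : i = j
        · subst e
          exact H.loopless.irrefl _ h
        · exact (hne i j e).2 h
      intro a ha b hb hab
      simp only [Finset.mem_union, Finset.mem_image, Finset.mem_univ, true_and] at ha hb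
      rcases ha with ⟨i, rfl⟩ | ha <;> rcases hb with ⟨j, rfl⟩ | hb
      · exact hww i j hab
      · exact (hwY i b hb).2 hab
      · exact (hwY j a ha).2 hab.symm
      · rcases Finset.mem_insert.1 ha with rfl | ha' <;>
          rcases Finset.mem_insert.1 hb with rfl | hb'
        · exact H.loopless.irrefl _ hab
        · exact hyB b hb' hab
        · exact hyB a ha' hab.symm
        · exact hB a (Finset.mem_filter.1 ha').1 b (Finset.mem_filter.1 hb').1 hab) hBm
    rw [Finset.card_union_of_disjoint, Finset.card_image_of_injective,
      Finset.card_insert_of_notMem hyBY, Finset.card_univ] at h1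
    · have h2 : (B.filter fun a => ¬ a ∈ Y).card ≤ Fintype.card ι := by
        have hex : ∀ a ∈ B.filter fun a => ¬ a ∈ Y, ∃ i, a = w i ∨ H.Adj (w i) a := by
          intro a ha
          have := (Finset.mem_filter.1 ha).2
          simp only [Y, Set.mem_ofPred_eq, not_forall, not_not] at this
          exact this
        rcases isEmpty_or_nonempty ι with hι | hι
        · rw [Finset.eq_empty_of_forall_notMem fun a ha => (hex a ha).elim fun i _ => hι.elim i]
          exact Nat.zero_le _
        choose! f hf using hex
        rw [← Finset.card_univ]
        refine Finset.card_le_card_of_injOn f (fun _ _ => Finset.mem_univ _) fun a ha b hb e => ?_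
        by_contra hab
        exact hB a (Finset.mem_filter.1 ha).1 b (Finset.mem_filter.1 hb).1
          (hclique (f a) a b (hf a ha) (e ▸ hf b hb) hab)
      have h3 := Finset.card_filter_add_card_filter_not (s := B) (fun a => a ∈ Y)
      simp only [BY] at h1
      omega
    · intro i j e
      by_contra hij
      exact (hne i j hij).1 e.symm
    · rw [Finset.disjoint_left]
      intro a ha ha'
      obtain ⟨i, -, rfl⟩ := Finset.mem_image.1 ha
      exact (hwY i _ ha').1 rfl
  choose col hcol using hcov
  have hiff : ∀ a i, col a = i ↔ (a = w i ∨ H.Adj (w i) a) := fun a i =>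
    ⟨fun h => h ▸ hcol a, fun h => hdisj (hcol a) h⟩
  refine ⟨col, ⟨fun i => (hiff _ _).2 (Or.inl rfl), fun i a => ?_, fun a b hab _ _ e => ?_⟩, hiff⟩
  · constructor
    · intro h
      refine ⟨?_, (hiff _ _).2 (Or.inr h)⟩
      rintro ⟨j, rfl⟩
      by_cases e : i = j
      · subst e
        exact H.loopless.irrefl _ h
      · exact (hne i j e).2 h
    · rintro ⟨h1, h2⟩
      exact ((hiff _ _).1 h2).resolve_left fun e => h1 ⟨i, e.symm⟩
  · exact hclique (col a) a b (hcol a) (e ▸ hcol b) hab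

/-! ### Maximal cliques with free vertices -/

theorem exists_isMaximalClique {s : Set V} (hs : H.IsClique s) :
    ∃ F, s ⊆ F ∧ IsMaximalClique H F := by
  obtain ⟨F, hsF, hF⟩ := exists_maximal_ge_of_wellFoundedGT (fun t : Set V => H.IsClique t) s hs
  exact ⟨F, hsF, hF⟩

/-- An edge at `x` extends to a maximal clique through `x`, which can only be `F`. -/
theorem IsFreeVertex.mem_iff {F : Set V} {x a : V} (h : IsFreeVertex H F x) :
    a ∈ F ↔ a = x ∨ H.Adj x a := by
  constructor
  · intro ha
    by_cases e : a = x
    · exact Or.inl e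
    · exact Or.inr (h.1.prop h.2.1 ha fun h' => e h'.symm)
  · rintro (rfl | hxa)
    · exact h.2.1
    · obtain ⟨F', hsub, hF'⟩ := exists_isMaximalClique (H := H) (s := {x, a}) (by
        rw [SimpleGraph.isClique_pair]
        exact fun _ => hxa)
      rw [← h.2.2 F' hF' (hsub (Or.inl rfl))]
      exact hsub (Or.inr rfl)

/-- The closed neighbourhood of `u` is a clique and contains every clique through `u`. -/
theorem isFreeVertex_of_simplicial {V : Type u} {H : SimpleGraph V} {u : V}
    (hu : ∀ a b, H.Adj u a → H.Adj u b → a ≠ b → H.Adj a b) :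
    IsFreeVertex H {a | a = u ∨ H.Adj u a} u := by
  have hmax : ∀ F', H.IsClique F' → u ∈ F' → F' ⊆ {a | a = u ∨ H.Adj u a} := by
    intro F' hF' huF a ha
    by_cases e : a = u
    · exact Or.inl e
    · exact Or.inr (hF' huF ha fun h' => e h'.symm)
  have hcl : H.IsClique {a | a = u ∨ H.Adj u a} := by
    rintro a (rfl | ha) b (rfl | hb) hab
    · exact absurd rfl hab
    · exact hb
    · exact ha.symm
    · exact hu a b ha hb hab
  refine ⟨⟨hcl, fun F' hF' hle => hmax F' hF' (hle (Or.inl rfl))⟩, Or.inl rfl, fun F' hF' huF => ?_⟩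
  exact (hmax F' hF'.prop huF).antisymm (hF'.le_of_ge hcl (hmax F' hF'.prop huF))

/-- Freeness identifies `F i` with the closed neighbourhood of `w i`. A simplicial vertex is free in
its own closed neighbourhood, which is therefore one of the `F i`. -/
theorem isResolvedByWhiskerComplex_of_isChordalGraph [Fintype ι] (k : Type u) [Field k] [LinearOrder V]
    (hH : IsChordalGraph H) (hCM : IsCohenMacaulayGraph k H) {F : ι → Set V}
    (hinj : Function.Injective F) (hF : Set.range F = {K | ∃ a, IsFreeVertex H K a})
    (hw : ∀ i, IsFreeVertex H (F i) (w i)) :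
    IsResolvedByWhiskerComplex k H w (fun i => F i \ {w i}) := by
  obtain ⟨col, h, hcol⟩ := hH.exists_isWhiskered hCM.isUnmixedGraph (w := w)
    (fun i a b ha hb hab => (hw i).1.prop ((hw i).mem_iff.2 ha) ((hw i).mem_iff.2 hb) hab)
    (fun i j hij => by
      rw [← not_or, ← (hw i).mem_iff]
      exact fun hmem => hij (hinj ((hw j).2.2 _ (hw i).1 hmem)))
    (fun u hu => by
      have := isFreeVertex_of_simplicial hu
      have hmem : {a | a = u ∨ H.Adj u a} ∈ Set.range F := hF ▸ ⟨u, this⟩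
      obtain ⟨i, hi⟩ := hmem
      exact ⟨i, (hw i).mem_iff.1 (hi ▸ this.2.1)⟩)
  refine h.isResolvedByWhiskerComplex fun i a => ?_
  rw [hcol, Set.mem_sdiff, (hw i).mem_iff, Set.mem_singleton_iff]
  constructor
  · rintro ⟨h1, h2⟩
    refine ⟨?_, h1⟩
    rintro ⟨j, rfl⟩
    have e := (hcol (w j) i).2 h1
    rw [h.col_w] at e
    exact h2 (by rw [e])
  · rintro ⟨h1, h2⟩
    exact ⟨h2, fun e => h1 ⟨i, e.symm⟩⟩

end ChordalUnmixed

/-! ## Cameron–Walker graphs -/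

section Matchings

variable {V : Type u} {H : SimpleGraph V}

theorem IsMatchingSet.eq_of_mem {M : Finset (Sym2 V)} (hM : IsMatchingSet H M) {v a b : V}
    (ha : s(v, a) ∈ M) (hb : s(v, b) ∈ M) : a = b := by
  by_contra hab
  refine hM.2 _ ha _ hb (fun e => hab ?_) v (Sym2.mem_mk_left v a) (Sym2.mem_mk_left v b)
  exact Sym2.congr_right.1 e

theorem IsMatchingSet.insert [DecidableEq V] {M : Finset (Sym2 V)} (hM : IsMatchingSet H M)
    {a b : V} (hab : H.Adj a b) (ha : ∀ e ∈ M, a ∉ e) (hb : ∀ e ∈ M, b ∉ e) :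
    IsMatchingSet H (insert s(a, b) M) ∧ (insert s(a, b) M).card = M.card + 1 := by
  refine ⟨⟨fun e he => ?_, fun e he f hf hne x hxe hxf => ?_⟩, ?_⟩
  · rcases Finset.mem_insert.1 he with rfl | he
    · exact hab
    · exact hM.1 e he
  · rcases Finset.mem_insert.1 he with rfl | he' <;> rcases Finset.mem_insert.1 hf with rfl | hf'
    · exact hne rfl
    · rcases Sym2.mem_iff.1 hxe with rfl | rfl
      · exact ha f hf' hxf
      · exact hb f hf' hxf
    · rcases Sym2.mem_iff.1 hxf with rfl | rfl
      · exact ha e he' hxe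
      · exact hb e he' hxe
    · exact hM.2 e he' f hf' hne x hxe hxf
  · exact Finset.card_insert_of_notMem fun h => ha _ h (Sym2.mem_mk_left a b)

theorem IsMatchingSet.card_le [Finite V] {M : Finset (Sym2 V)} (hM : IsMatchingSet H M) :
    M.card ≤ matchingNumber H := by
  have : Fintype (Sym2 V) := Fintype.ofFinite _
  refine le_csSup ⟨Fintype.card (Sym2 V), ?_⟩ ⟨M, hM, rfl⟩
  rintro n ⟨M, -, rfl⟩
  exact Finset.card_le_univ M

theorem exists_isInducedMatchingSet [Finite V] :
    ∃ M : Finset (Sym2 V), IsInducedMatchingSet H M ∧ M.card = inducedMatchingNumber H := by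
  have : Fintype (Sym2 V) := Fintype.ofFinite _
  refine Nat.sSup_mem (s := {n | ∃ M : Finset (Sym2 V), IsInducedMatchingSet H M ∧ M.card = n})
    ⟨0, ∅, ⟨⟨by simp, by simp⟩, ?_⟩, rfl⟩ ⟨Fintype.card (Sym2 V), ?_⟩
  · intro f hf _ h
    induction f using Sym2.ind with
    | _ a b => simpa using h a (Sym2.mem_mk_left a b)
  · rintro n ⟨M, -, rfl⟩
    exact Finset.card_le_univ M

/-- A maximum matching with vertex set `P` that is induced; `π v` is the partner of `v`. -/
structure IsInducedMaximumMatching (H : SimpleGraph V) (P : Set V) (π : V → V) : Prop where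
  adj : ∀ v ∈ P, H.Adj v (π v)
  mem : ∀ v ∈ P, π v ∈ P
  involutive : ∀ v ∈ P, π (π v) = v
  induced : ∀ u ∈ P, ∀ v ∈ P, H.Adj u v → v = π u
  independent : ∀ u ∉ P, ∀ v ∉ P, ¬ H.Adj u v
  common : ∀ a ∈ P, ∀ u ∉ P, ∀ v ∉ P, H.Adj a u → H.Adj (π a) v → u = v

/-- By maximality, no edge joins two unmatched vertices, and no augmenting path `u`, `a`, `π a`, `v`
with `u ≠ v` exists. That the matching is induced leaves no further edges among the matched
vertices. -/
theorem IsInducedMatchingSet.exists_isInducedMaximumMatching [Finite V] {M : Finset (Sym2 V)}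
    (hM : IsInducedMatchingSet H M) (hcard : M.card = matchingNumber H) :
    ∃ P π, IsInducedMaximumMatching H P π := by
  classical
  have hex : ∀ v, (∃ e ∈ M, v ∈ e) → ∃ a, s(v, a) ∈ M := by
    rintro v ⟨e, he, hv⟩
    obtain ⟨a, rfl⟩ := Sym2.mem_iff_exists.1 hv
    exact ⟨a, he⟩
  choose! π hπ using hex
  have hmem : ∀ {a b}, s(a, b) ∈ M → ∃ e ∈ M, a ∈ e := fun {a b} h =>
    ⟨_, h, Sym2.mem_mk_left a b⟩
  have hmem' : ∀ {a b}, s(a, b) ∈ M → s(b, a) ∈ M := fun {a b} h => by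
    rwa [Sym2.eq_swap]
  refine ⟨{v | ∃ e ∈ M, v ∈ e}, π, ⟨fun v hv => hM.1.1 _ (hπ v hv), fun v hv => ?_, fun v hv => ?_,
    fun u hu v hv huv => ?_, fun u hu v hv huv => ?_, fun a ha u hu v hv hau hav => ?_⟩⟩
  · exact hmem (hmem' (hπ v hv))
  · exact hM.1.eq_of_mem (hπ _ (hmem (hmem' (hπ v hv)))) (hmem' (hπ v hv))
  · have : s(u, v) ∈ M := by
      by_contra hn
      refine hM.2 _ huv hn fun x hx => ?_
      rcases Sym2.mem_iff.1 hx with rfl | rfl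
      · exact hu
      · exact hv
    exact hM.1.eq_of_mem this (hπ u hu)
  · obtain ⟨h1, h2⟩ := hM.1.insert huv (fun e he hue => hu ⟨e, he, hue⟩)
      (fun e he hve => hv ⟨e, he, hve⟩)
    have := h1.card_le
    omega
  · by_contra huv
    have hne : a ≠ π a := (hM.1.1 _ (hπ a ha) : H.Adj a (π a)).ne
    have hE : IsMatchingSet H (M.erase s(a, π a)) :=
      ⟨fun e he => hM.1.1 e (Finset.mem_of_mem_erase he), fun e he f hf =>
        hM.1.2 e (Finset.mem_of_mem_erase he) f (Finset.mem_of_mem_erase hf)⟩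
    have hout : ∀ x ∈ s(a, π a), ∀ e ∈ M.erase s(a, π a), x ∉ e := fun x hx e he =>
      hM.1.2 _ (hπ a ha) e (Finset.mem_of_mem_erase he) (Finset.ne_of_mem_erase he).symm x hx
    obtain ⟨h1, h2⟩ := hE.insert hav (hout _ (Sym2.mem_mk_right _ _))
      (fun e he hve => hv ⟨e, Finset.mem_of_mem_erase he, hve⟩)
    have hua : u ≠ π a := fun e => hu (e ▸ hmem (hmem' (hπ a ha)))
    have hva : v ≠ a := fun e => hv (e ▸ ha)
    obtain ⟨h3, h4⟩ := h1.insert hau (fun e he hae => by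
        rcases Finset.mem_insert.1 he with rfl | he
        · rcases Sym2.mem_iff.1 hae with e | e
          · exact hne e
          · exact hva e.symm
        · exact hout a (Sym2.mem_mk_left _ _) e he hae)
      (fun e he hue => by
        rcases Finset.mem_insert.1 he with rfl | he
        · rcases Sym2.mem_iff.1 hue with e | e
          · exact hua e
          · exact huv e
        · exact hu ⟨e, Finset.mem_of_mem_erase he, hue⟩)
    have := h3.card_le
    have := Finset.card_erase_add_one (hπ a ha)
    omega

end Matchings

/-! ### Structure of unmixed Cameron–Walker graphs. -/

section CameronWalker

variable {V : Type u} {H : SimpleGraph V}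

theorem SimpleGraph.Connected.mem_of_closed (hH : H.Connected) {Z : Set V} {v : V} (hv : v ∈ Z)
    (hZ : ∀ a ∈ Z, ∀ b, H.Adj a b → b ∈ Z) (b : V) : b ∈ Z := by
  obtain ⟨p⟩ := hH.preconnected v b
  induction p with
  | nil => exact hv
  | cons h p ih => exact ih (hZ _ hv _ h)

/-- Walks are carried along `ρ` to walks in `S`, with some steps becoming stationary. -/
theorem SimpleGraph.Connected.induce_of_retraction (hH : H.Connected) {S : Set V} (ρ : V → V)
    (hρ : ∀ v, ρ v ∈ S) (hfix : ∀ s ∈ S, ρ s = s)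
    (hadj : ∀ a b, H.Adj a b → ρ a = ρ b ∨ H.Adj (ρ a) (ρ b)) : (H.induce S).Connected := by
  have key : ∀ a b, H.Walk a b → (H.induce S).Reachable ⟨ρ a, hρ a⟩ ⟨ρ b, hρ b⟩ := by
    intro a b p
    induction p with
    | nil => exact SimpleGraph.Reachable.refl _
    | @cons a c b h p ih =>
      rcases hadj a c h with e | e
      · have : (⟨ρ a, hρ a⟩ : S) = ⟨ρ c, hρ c⟩ := Subtype.ext e
        rwa [this]
      · have : (H.induce S).Adj ⟨ρ a, hρ a⟩ ⟨ρ c, hρ c⟩ := e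
        exact this.reachable.trans ih
  have : Nonempty V := hH.nonempty
  obtain ⟨v⟩ := this
  refine (SimpleGraph.connected_iff _).2 ⟨fun s t => ?_, ⟨⟨ρ v, hρ v⟩⟩⟩
  obtain ⟨p⟩ := hH.preconnected s.1 t.1
  have := key _ _ p
  simp only [hfix _ s.2, hfix _ t.2] at this
  exact this

theorem IsUnmixedGraph.false_of_exchange [Fintype V] [DecidableEq V] (hU : IsUnmixedGraph H)
    {B : Finset V} (hB : ∀ a ∈ B, ∀ b ∈ B, ¬ H.Adj a b) (hBm : IsMinVertexCover H Bᶜ) {x p q : V}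
    (hx : x ∈ B) (hp : p ∉ B.erase x) (hq : q ∉ B.erase x) (hpq : p ≠ q) (hadj : ¬ H.Adj p q)
    (hpB : ∀ c ∈ B.erase x, ¬ H.Adj p c) (hqB : ∀ c ∈ B.erase x, ¬ H.Adj q c) : False := by
  have hcard := hU.card_le (I := insert p (insert q (B.erase x))) (B := B) (by
    intro a ha b hb hab
    simp only [Finset.mem_insert] at ha hb
    rcases ha with rfl | rfl | ha <;> rcases hb with rfl | rfl | hb
    · exact H.loopless.irrefl _ hab
    · exact hadj hab
    · exact hpB b hb hab
    · exact hadj hab.symm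
    · exact H.loopless.irrefl _ hab
    · exact hqB b hb hab
    · exact hpB a ha hab.symm
    · exact hqB a ha hab.symm
    · exact hB a (Finset.mem_of_mem_erase ha) b (Finset.mem_of_mem_erase hb) hab) hBm
  rw [Finset.card_insert_of_notMem, Finset.card_insert_of_notMem hq,
    Finset.card_erase_add_one hx] at hcard
  · omega
  · rw [Finset.mem_insert, not_or]
    exact ⟨hpq, hp⟩

namespace IsInducedMaximumMatching

variable {P : Set V} {π : V → V}

theorem eq_partner (h : IsInducedMaximumMatching H P π) {v a : V} (hv : v ∈ P)
    (hn : ∀ u ∉ P, ¬ H.Adj v u) (ha : H.Adj v a) : a = π v := by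
  refine h.induced v hv a ?_ ha
  by_contra haP
  exact hn a haP ha

/-- Otherwise `v` and `π v` would form a whole component, and the connected graph would be a single
edge, which is a star. -/
theorem exists_adj (h : IsInducedMaximumMatching H P π) (hH : H.Connected)
    (hstar : ¬ IsStarGraph H) {v : V} (hv : v ∈ P) (hn : ∀ u ∉ P, ¬ H.Adj v u) :
    ∃ u ∉ P, H.Adj (π v) u := by
  by_contra! hn'
  have hall := hH.mem_of_closed (Z := {v, π v}) (v := v) (Or.inl rfl) (by
    rintro a (rfl | rfl) b hab
    · exact Or.inr (h.eq_partner hv hn hab)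
    · left
      rw [h.eq_partner (h.mem v hv) hn' hab, h.involutive v hv])
  refine hstar ⟨v, fun x y => ⟨fun hxy => ⟨hxy.ne, ?_⟩, ?_⟩⟩
  · rcases hall x with hx | hx
    · exact Or.inl hx
    · rcases hall y with hy | hy
      · exact Or.inr hy
      · exact absurd (hx.trans (Eq.symm hy)) hxy.ne
  · rintro ⟨hne, rfl | rfl⟩
    · rcases hall y with hy | hy
      · exact absurd (Eq.symm hy) hne
      · exact (show y = π x from hy) ▸ h.adj x hv
    · rcases hall x with hx | hx
      · exact absurd hx hne
      · exact (show x = π y from hx) ▸ (h.adj y hv).symm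

variable [Fintype V]

/-- Without a triangle at `u`, the partner of every neighbour of `u` is a leaf, and then one
neighbour `x` of `u` can be exchanged for the two vertices `π x` and `u` in a maximal independent
set. -/
theorem exists_triangle (h : IsInducedMaximumMatching H P π) (hH : H.Connected)
    (hstar : ¬ IsStarGraph H) (hU : IsUnmixedGraph H) {u : V} (hu : u ∉ P) :
    ∃ a ∈ P, H.Adj u a ∧ H.Adj u (π a) := by
  classical
  by_contra! hno
  have hnbr : ∀ a, H.Adj u a → a ∈ P := fun a ha => by
    by_contra haP
    exact h.independent u hu a haP ha
  -- An unmatched neighbour of `π a` would have to be `u` itself, which would complete a triangle.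
  have hleaf : ∀ a, H.Adj u a → ∀ v ∉ P, ¬ H.Adj (π a) v := by
    intro a ha v hv hav
    have := h.common a (hnbr a ha) u hu v hv ha.symm hav
    exact hno a (hnbr a ha) ha (this ▸ hav.symm)
  have hpart : ∀ a c, H.Adj u a → H.Adj (π a) c → c = a := fun a c ha hc => by
    rw [h.eq_partner (h.mem a (hnbr a ha)) (hleaf a ha) hc, h.involutive a (hnbr a ha)]
  obtain ⟨x, hx⟩ : ∃ x, H.Adj u x := by
    by_contra! hn
    have hall := hH.mem_of_closed (Z := {u}) (v := u) rfl (by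
      rintro a rfl b hab
      exact absurd hab (hn b))
    refine hstar ⟨u, fun x y => ⟨fun hxy => ?_, fun hxy => ?_⟩⟩
    · exact absurd ((show x = u from hall x).trans (show y = u from hall y).symm) hxy.ne
    · exact absurd ((show x = u from hall x).trans (show y = u from hall y).symm) hxy.1
  -- `B` contains `x` and the partners of all other neighbours of `u`, hence no neighbour of `u`
  -- except `x`.
  obtain ⟨B, hIB, hB, hBm⟩ := exists_isMinVertexCover_compl (H := H)
    (I := insert x ((Finset.univ.filter fun v => H.Adj u v ∧ v ≠ x).image π)) (by
      have key : ∀ a c, H.Adj u a → a ≠ x →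
          c ∈ insert x ((Finset.univ.filter fun v => H.Adj u v ∧ v ≠ x).image π) →
          ¬ H.Adj (π a) c := by
        intro a c ha hax hc hac
        have e := hpart a c ha hac
        subst e
        rcases Finset.mem_insert.1 hc with hc | hc
        · exact hax hc
        · obtain ⟨d, hd, e⟩ := Finset.mem_image.1 hc
          have hd' := (Finset.mem_filter.1 hd).2.1
          refine hleaf d hd' u hu ?_
          rw [e]
          exact ha.symm
      intro a ha b hb hab
      rcases Finset.mem_insert.1 ha with rfl | ha'
      · rcases Finset.mem_insert.1 hb with rfl | hb'
        · exact H.loopless.irrefl _ hab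
        · obtain ⟨d, hd, rfl⟩ := Finset.mem_image.1 hb'
          have hd' := (Finset.mem_filter.1 hd).2
          exact key d _ hd'.1 hd'.2 ha hab.symm
      · obtain ⟨d, hd, rfl⟩ := Finset.mem_image.1 ha'
        have hd' := (Finset.mem_filter.1 hd).2
        exact key d b hd'.1 hd'.2 hb hab)
  have hxB : x ∈ B := hIB (Finset.mem_insert_self _ _)
  refine hU.false_of_exchange hB hBm hxB (p := π x) (q := u) ?_ ?_ ?_ ?_ ?_ ?_
  · exact fun hp => hB x hxB _ (Finset.mem_of_mem_erase hp) (h.adj x (hnbr x hx))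
  · exact fun hq => hB x hxB _ (Finset.mem_of_mem_erase hq) hx.symm
  · exact fun e => hu (e ▸ h.mem x (hnbr x hx))
  · exact hleaf x hx u hu
  · exact fun c hc hxc => Finset.ne_of_mem_erase hc (hpart x c hx hxc)
  · intro c hc huc
    refine hB c (Finset.mem_of_mem_erase hc) (π c) (hIB (Finset.mem_insert_of_mem
      (Finset.mem_image_of_mem π (Finset.mem_filter.2 ⟨Finset.mem_univ c, huc,
        Finset.ne_of_mem_erase hc⟩)))) (h.adj c (hnbr c huc))

/-- If `u` lay in two triangles, it could be exchanged in a maximal independent set for one matched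
vertex from each: the neighbours of such a vertex are `u` and its partner, and the partner is
adjacent to `u`. -/
theorem eq_or_eq_of_triangle (h : IsInducedMaximumMatching H P π) (hU : IsUnmixedGraph H)
    {u a c : V} (hu : u ∉ P) (ha : a ∈ P) (hc : c ∈ P) (hua : H.Adj u a) (hua' : H.Adj u (π a))
    (huc : H.Adj u c) (huc' : H.Adj u (π c)) : c = a ∨ c = π a := by
  classical
  by_contra! hne
  obtain ⟨B, hIB, hB, hBm⟩ := exists_isMinVertexCover_compl (H := H) (I := {u}) (by simp)
  have huB : u ∈ B := hIB (Finset.mem_singleton_self u)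
  have key : ∀ a ∈ P, H.Adj u a → H.Adj u (π a) → ∀ c ∈ B.erase u, ¬ H.Adj a c := by
    intro a ha hua hua' c hc hac
    have hcu := Finset.ne_of_mem_erase hc
    have hcB := Finset.mem_of_mem_erase hc
    by_cases hcP : c ∈ P
    · rw [h.induced a ha c hcP hac] at hcB
      exact hB u huB _ hcB hua'
    · exact hcu (h.common a ha c hcP u hu hac hua'.symm)
  refine hU.false_of_exchange hB hBm huB (p := a) (q := c) ?_ ?_ hne.1.symm ?_
    (key a ha hua hua') (key c hc huc huc')
  · exact fun h' => hB u huB a (Finset.mem_of_mem_erase h') hua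
  · exact fun h' => hB u huB c (Finset.mem_of_mem_erase h') huc
  · exact fun hac => hne.2 (h.induced a ha c hc hac)

/-- The unmatched vertices are the `y j`, each with the matching edge of its triangle. Of any other
matching edge exactly one end has unmatched neighbours: one does by connectedness, and both would
give a triangle. That end is an `x i`, and the other is its leaf. -/
theorem exists_labelling (h : IsInducedMaximumMatching H P π) (hH : H.Connected)
    (hstar : ¬ IsStarGraph H) (hU : IsUnmixedGraph H) :
    ∃ (n m : ℕ) (x l : Fin n → V) (y z w : Fin m → V), IsCameronWalkerLabelling H x l y z w := by
  classical
  let X : Set V := {v | v ∈ P ∧ (∃ u ∉ P, H.Adj v u) ∧ ∀ u ∉ P, ¬ H.Adj (π v) u}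
  let ex := Fintype.equivFin X
  let ey := Fintype.equivFin (Pᶜ : Set V)
  let x : Fin (Fintype.card X) → V := fun i => ex.symm i
  let y : Fin (Fintype.card (Pᶜ : Set V)) → V := fun j => ey.symm j
  have hxX : ∀ i, x i ∈ X := fun i => (ex.symm i).2
  have hxinj : Function.Injective x := Subtype.val_injective.comp ex.symm.injective
  have hyinj : Function.Injective y := Subtype.val_injective.comp ey.symm.injective
  have hxsurj : ∀ v ∈ X, ∃ i, x i = v := fun v hv => ⟨ex ⟨v, hv⟩, by simp [x]⟩
  have hysurj : ∀ v ∉ P, ∃ j, y j = v := fun v hv => ⟨ey ⟨v, hv⟩, by simp [y]⟩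
  have hyP : ∀ j, y j ∉ P := fun j => (ey.symm j).2
  choose z hzP hyz hyw using fun j => h.exists_triangle hH hstar hU (hyP j)
  let l : Fin (Fintype.card X) → V := fun i => π (x i)
  let w : Fin (Fintype.card (Pᶜ : Set V)) → V := fun j => π (z j)
  have hlP : ∀ i, l i ∈ P := fun i => h.mem _ (hxX i).1
  have hwP : ∀ j, w j ∈ P := fun j => h.mem _ (hzP j)
  have hleaf : ∀ i a, H.Adj (l i) a ↔ a = x i := by
    intro i a
    constructor
    · intro ha
      rw [h.eq_partner (hlP i) (hxX i).2.2 ha, h.involutive _ (hxX i).1]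
    · rintro rfl
      exact (h.adj _ (hxX i).1).symm
  have hz : ∀ j a, H.Adj (z j) a ↔ a = y j ∨ a = w j := by
    intro j a
    constructor
    · intro ha
      by_cases haP : a ∈ P
      · exact Or.inr (h.induced _ (hzP j) a haP ha)
      · exact Or.inl (h.common _ (hzP j) a haP _ (hyP j) ha (hyw j).symm)
    · rintro (rfl | rfl)
      · exact (hyz j).symm
      · exact h.adj _ (hzP j)
  have hw : ∀ j a, H.Adj (w j) a ↔ a = y j ∨ a = z j := by
    intro j a
    constructor
    · intro ha
      by_cases haP : a ∈ P
      · right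
        rw [h.induced _ (hwP j) a haP ha, h.involutive _ (hzP j)]
      · exact Or.inl (h.common _ (hzP j) _ (hyP j) a haP (hyz j).symm ha).symm
    · rintro (rfl | rfl)
      · exact (hyw j).symm
      · exact (h.adj _ (hzP j)).symm
  have hS : ∀ v, (v ∈ Set.range x ∪ Set.range y) ∨ (∃ i, v = l i) ∨ (∃ j, v = z j ∨ v = w j) := by
    intro v
    by_cases hv : v ∈ P
    · by_cases h1 : ∃ u ∉ P, H.Adj v u
      · by_cases h2 : ∃ u ∉ P, H.Adj (π v) u
        · right; right
          obtain ⟨u, hu, huv⟩ := h1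
          obtain ⟨u', hu', huv'⟩ := h2
          obtain rfl := h.common v hv u hu u' hu' huv huv'
          obtain ⟨j, rfl⟩ := hysurj u hu
          exact ⟨j, h.eq_or_eq_of_triangle hU hu (hzP j) hv (hyz j) (hyw j) huv.symm huv'.symm⟩
        · left; left
          push Not at h2
          exact hxsurj v ⟨hv, h1, h2⟩
      · right; left
        push Not at h1
        obtain ⟨i, hi⟩ := hxsurj (π v) ⟨h.mem v hv, h.exists_adj hH hstar hv h1, by
          rwa [h.involutive v hv]⟩
        exact ⟨i, by simp only [l]; rw [hi, h.involutive v hv]⟩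
    · left; right
      exact hysurj v hv
  have hxl : ∀ i i', x i ≠ l i' := by
    intro i i' e
    obtain ⟨u, hu, hadj⟩ := (hxX i).2.1
    rw [e, hleaf] at hadj
    exact hu (hadj ▸ (hxX i').1)
  have hxz : ∀ i j, x i ≠ z j := fun i j e =>
    (hxX i).2.2 (y j) (hyP j) (by rw [e]; exact (hyw j).symm)
  have hxw : ∀ i j, x i ≠ w j := fun i j e =>
    (hxX i).2.2 (y j) (hyP j) (by
      rw [e, show π (w j) = z j from h.involutive _ (hzP j)]; exact (hyz j).symm)
  have hlz : ∀ i j, l i ≠ z j := fun i j e => by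
    have := (hleaf i (y j)).1 (e ▸ (hyz j).symm)
    exact hyP j (this ▸ (hxX i).1)
  have hlw : ∀ i j, l i ≠ w j := fun i j e => by
    have := (hleaf i (y j)).1 (e ▸ (hyw j).symm)
    exact hyP j (this ▸ (hxX i).1)
  have hzy : ∀ j j', H.Adj (z j) (y j') → j' = j := fun j j' hadj => by
    rcases (hz j _).1 hadj with e | e
    · exact hyinj e
    · exact absurd (e ▸ hwP j) (hyP j')
  have hwy : ∀ j j', H.Adj (w j) (y j') → j' = j := fun j j' hadj => by
    rcases (hw j _).1 hadj with e | e
    · exact hyinj e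
    · exact absurd (e ▸ hzP j) (hyP j')
  have hbij : Function.Bijective (Sum.elim x (Sum.elim y (Sum.elim l (Sum.elim z w)))) := by
    constructor
    · refine hxinj.sumElim (hyinj.sumElim (Function.Injective.sumElim ?_
        (Function.Injective.sumElim ?_ ?_ ?_) ?_) ?_) ?_
      · intro i i' e
        exact hxinj ((hleaf i' _).1 (by rw [← e, hleaf]))
      · intro j j' e
        exact (hzy j' j (e ▸ (hyz j).symm))
      · intro j j' e
        exact (hwy j' j (e ▸ (hyw j).symm))
      · intro j j' e
        obtain rfl := hwy j' j (e ▸ (hyz j).symm)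
        exact (h.adj _ (hzP j)).ne e
      · rintro i (j | j)
        · exact hlz i j
        · exact hlw i j
      · rintro j (i | j' | j') e
        · exact hyP j (e ▸ hlP i)
        · exact hyP j (e ▸ hzP j')
        · exact hyP j (e ▸ hwP j')
      · rintro i (j | i' | j | j)
        · exact fun e : x i = y j => hyP j (e ▸ (hxX i).1)
        · exact hxl i i'
        · exact hxz i j
        · exact hxw i j
    · intro v
      rcases hS v with (⟨i, rfl⟩ | ⟨j, rfl⟩) | ⟨i, rfl⟩ | ⟨j, rfl | rfl⟩
      · exact ⟨Sum.inl i, rfl⟩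
      · exact ⟨Sum.inr (Sum.inl j), rfl⟩
      · exact ⟨Sum.inr (Sum.inr (Sum.inl i)), rfl⟩
      · exact ⟨Sum.inr (Sum.inr (Sum.inr (Sum.inl j))), rfl⟩
      · exact ⟨Sum.inr (Sum.inr (Sum.inr (Sum.inr j))), rfl⟩
  -- The retraction onto the bipartite part: a leaf goes to its `x i`, the outer vertices of a
  -- triangle go to its `y j`.
  have hret : ∀ v, ∃ s ∈ Set.range x ∪ Set.range y, (v ∈ Set.range x ∪ Set.range y → s = v) ∧
      (v ∉ Set.range x ∪ Set.range y → ∀ a, H.Adj v a →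
        a = s ∨ (a ∉ Set.range x ∪ Set.range y ∧ H.Adj a s)) := by
    intro v
    by_cases hv : v ∈ Set.range x ∪ Set.range y
    · exact ⟨v, hv, fun _ => rfl, fun h' => absurd hv h'⟩
    rcases hS v with hv' | ⟨i, rfl⟩ | ⟨j, rfl | rfl⟩
    · exact absurd hv' hv
    · exact ⟨x i, Or.inl ⟨i, rfl⟩, fun h' => absurd h' hv, fun _ a ha => Or.inl ((hleaf i a).1 ha)⟩
    · refine ⟨y j, Or.inr ⟨j, rfl⟩, fun h' => absurd h' hv, fun _ a ha => ?_⟩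
      rcases (hz j a).1 ha with rfl | rfl
      · exact Or.inl rfl
      · refine Or.inr ⟨?_, (hyw j).symm⟩
        rintro (⟨i, e⟩ | ⟨j', e⟩)
        · exact hxw i j e
        · exact hyP j' (e ▸ hwP j)
    · refine ⟨y j, Or.inr ⟨j, rfl⟩, fun h' => absurd h' hv, fun _ a ha => ?_⟩
      rcases (hw j a).1 ha with rfl | rfl
      · exact Or.inl rfl
      · refine Or.inr ⟨?_, (hyz j).symm⟩
        rintro (⟨i, e⟩ | ⟨j', e⟩)
        · exact hxz i j e
        · exact hyP j' (e ▸ hzP j)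
  choose ρ hρ hfix hnb using hret
  refine ⟨_, _, x, l, y, z, w, hbij, fun i j hadj => ?_, fun i j => h.independent _ (hyP i) _ (hyP j),
    hH.induce_of_retraction ρ hρ hfix fun a b hab => ?_, hleaf, hz, hw⟩
  · obtain ⟨u, hu, hadj'⟩ := (hxX j).2.1
    rw [h.induced _ (hxX i).1 _ (hxX j).1 hadj] at hadj'
    exact (hxX i).2.2 u hu hadj'
  · by_cases ha : a ∈ Set.range x ∪ Set.range y <;> by_cases hb : b ∈ Set.range x ∪ Set.range y
    · right
      rwa [hfix a ha, hfix b hb]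
    · left
      rw [hfix a ha]
      exact (hnb b hb a hab.symm).resolve_right fun h' => h'.1 ha
    · left
      rw [hfix b hb]
      exact ((hnb a ha b hab).resolve_right fun h' => h'.1 hb).symm
    · left
      rcases hnb a ha b hab with e | ⟨-, e⟩
      · exact absurd (e ▸ hρ a) hb
      · exact (hnb b hb _ e).resolve_right fun h' => h'.1 (hρ a)

end IsInducedMaximumMatching

theorem IsCameronWalker.exists_labelling [Fintype V] (hH : IsCameronWalker H)
    (hU : IsUnmixedGraph H) :
    ∃ (n m : ℕ) (x l : Fin n → V) (y z w : Fin m → V), IsCameronWalkerLabelling H x l y z w := by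
  obtain ⟨M, hM, hcard⟩ := exists_isInducedMatchingSet (H := H)
  obtain ⟨P, π, h⟩ := hM.exists_isInducedMaximumMatching
    (hcard.trans hH.inducedMatchingNumber_eq)
  exact h.exists_labelling hH.connected hH.not_star hU

/-- A leaf edge forms one colour class, a pendant triangle another. The colouring is well defined
because the five families list every vertex exactly once. -/
theorem IsCameronWalkerLabelling.exists_isWhiskered {n m : ℕ} {x l : Fin n → V}
    {y z w : Fin m → V} (h : IsCameronWalkerLabelling H x l y z w) :
    ∃ col : V → Fin n ⊕ Fin m, IsWhiskered H (Sum.elim l w) col ∧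
      ∀ i a, a ∈ (Sum.elim (fun i => {x i}) (fun j => {y j, z j}) : Fin n ⊕ Fin m → Set V) i ↔
        a ∉ Set.range (Sum.elim l w) ∧ col a = i := by
  let e := Equiv.ofBijective _ h.bijective
  let c : Fin n ⊕ Fin m ⊕ Fin n ⊕ Fin m ⊕ Fin m → Fin n ⊕ Fin m :=
    Sum.elim Sum.inl (Sum.elim Sum.inr (Sum.elim Sum.inl (Sum.elim Sum.inr Sum.inr)))
  have hinj : ∀ {p q}, e p = e q ↔ p = q := e.injective.eq_iff
  have hc : ∀ p, c (e.symm (e p)) = c p := fun p => by rw [e.symm_apply_apply]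
  have ex : ∀ i, e (Sum.inl i) = x i := fun _ => rfl
  have ey : ∀ i, e (Sum.inr (Sum.inl i)) = y i := fun _ => rfl
  have el : ∀ i, e (Sum.inr (Sum.inr (Sum.inl i))) = l i := fun _ => rfl
  have ez : ∀ i, e (Sum.inr (Sum.inr (Sum.inr (Sum.inl i)))) = z i := fun _ => rfl
  have ew : ∀ i, e (Sum.inr (Sum.inr (Sum.inr (Sum.inr i)))) = w i := fun _ => rfl
  have hW : ∀ i a, a ∈ (Sum.elim (fun i => {x i}) (fun j => {y j, z j}) :
      Fin n ⊕ Fin m → Set V) i ↔ a ∉ Set.range (Sum.elim l w) ∧ c (e.symm a) = i := by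
    intro i a
    obtain ⟨p, rfl⟩ := e.surjective a
    rw [hc]
    rcases i with i | i <;> rcases p with p | p | p | p | p <;>
      simp [← ex, ← ey, ← el, ← ez, ← ew, hinj, c]
  have hadj : ∀ i a, H.Adj (Sum.elim l w i) a ↔
      a ∈ (Sum.elim (fun i => {x i}) (fun j => {y j, z j}) : Fin n ⊕ Fin m → Set V) i := by
    rintro (i | i) a
    · exact h.leaf i a
    · exact h.triangle_w i a
  refine ⟨fun a => c (e.symm a), ⟨?_, fun i a => (hadj i a).trans (hW i a), ?_⟩, hW⟩
  · rintro (i | i)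
    · exact hc (Sum.inr (Sum.inr (Sum.inl i)))
    · exact hc (Sum.inr (Sum.inr (Sum.inr (Sum.inr i))))
  · intro a b hab ha hb hcol
    have ha' := (hW _ a).2 ⟨ha, rfl⟩
    have hb' := (hW _ b).2 ⟨hb, hcol.symm⟩
    revert ha' hb'
    generalize c (e.symm a) = i
    rcases i with i | i
    · rintro rfl rfl
      exact absurd rfl hab
    · rintro (rfl | rfl) (rfl | rfl)
      · exact absurd rfl hab
      · exact ((h.triangle_z i _).2 (Or.inl rfl)).symm
      · exact (h.triangle_z i _).2 (Or.inl rfl)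
      · exact absurd rfl hab

theorem IsCameronWalkerLabelling.isResolvedByWhiskerComplex (k : Type u) [Field k] [Fintype V]
    [LinearOrder V] {n m : ℕ} {x l : Fin n → V} {y z w : Fin m → V}
    (h : IsCameronWalkerLabelling H x l y z w) :
    IsResolvedByWhiskerComplex k H (Sum.elim l w)
      (Sum.elim (fun i => {x i}) (fun j => {y j, z j})) := by
  obtain ⟨col, hw, hW⟩ := h.exists_isWhiskered
  exact hw.isResolvedByWhiskerComplex hW

end CameronWalker

/-! ### The theorem for the three families. -/

theorem mainTheorem11 :
    -- Cohen–Macaulay chordal graphs: `F 0, …, F (m - 1)` are the maximal cliques that admit a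
    -- free vertex, and `w i` is a free vertex of `F i`
    (∀ (k : Type u) [Field k] (V : Type u) [Fintype V] [LinearOrder V] (H : SimpleGraph V),
      IsChordalGraph H → IsCohenMacaulayGraph k H →
      ∀ (m : ℕ) (F : Fin m → Set V) (w : Fin m → V),
        Function.Injective F →
        Set.range F = {K | ∃ a, IsFreeVertex H K a} →
        (∀ i, IsFreeVertex H (F i) (w i)) →
        IsResolvedByWhiskerComplex k H w (fun i => F i \ {w i})) ∧
    -- clique corona graphs: `y i` is a chosen vertex of the complete graph attached to `i`
    (∀ (k : Type u) [Field k] (X : Type u) [Fintype X] (Y : X → Type u) [∀ i, Fintype (Y i)]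
      [LinearOrder (X ⊕ (Σ i, Y i))] (G : SimpleGraph X) (y : ∀ i, Y i),
      IsResolvedByWhiskerComplex k (coronaGraph G (fun i => (⊤ : SimpleGraph (Y i))))
        (fun i : X => Sum.inr ⟨i, y i⟩)
        (fun i => {Sum.inl i} ∪ {a | ∃ b : Y i, b ≠ y i ∧ a = Sum.inr ⟨i, b⟩})) ∧
    -- Cohen–Macaulay Cameron–Walker graphs
    (∀ (k : Type u) [Field k] (V : Type u) [Fintype V] [LinearOrder V] (H : SimpleGraph V),
      IsCameronWalker H → IsCohenMacaulayGraph k H →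
      (∃ (n m : ℕ) (x l : Fin n → V) (y z w : Fin m → V),
        IsCameronWalkerLabelling H x l y z w) ∧
      ∀ (n m : ℕ) (x l : Fin n → V) (y z w : Fin m → V),
        IsCameronWalkerLabelling H x l y z w →
        IsResolvedByWhiskerComplex k H (Sum.elim l w)
          (Sum.elim (fun i => {x i}) (fun j => {y j, z j}))) := by
  refine ⟨?_, ?_, ?_⟩
  · intro k _ V _ _ H hH hCM m F w hinj hF hw
    exact isResolvedByWhiskerComplex_of_isChordalGraph k hH hCM hinj hF hw
  · intro k _ X _ Y _ _ G y
    exact isResolvedByWhiskerComplex_coronaGraph G y k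
  · intro k _ V _ _ H hH hCM
    exact ⟨hH.exists_labelling hCM.isUnmixedGraph, fun n m x l y z w h =>
      h.isResolvedByWhiskerComplex k⟩
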